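/- For a finite group $\pi$, regard the group algebra $\mathbb{C}\pi$ as a $\pi\times\pi$-module by $(g,h)\cdot x=gxh^{-1}$, let $\varepsilon\colon\mathbb{C}\pi\to\mathbb{C}$, $\sum a_g g\mapsto\sum a_g$, be the augmentation, and for $W=\mathbb{C}\pi$ or $W=\mathrm{Ker}\,\varepsilon$ let $$\mathscr{A}_\Theta^{\mathrm{odd}}(W)=\Bigl(\bigl(\mathrm{Sym}^3\,W\bigr)_{\pi\times\pi}\Bigr)^{\mathbb{Z}_2},$$ where $(\cdot)_{\pi\times\pi}$ denotes coinvariants and $\mathbb{Z}_2$ acts by the involution induced by the linear extension of $x\mapsto x^{-1}$ $(x\in\pi)$ in each factor. For an integer $m$ let $p_3(m)$ be the number of integer solutions of $x+y+z=m$, $0\le x\le y\le z$ (so $p_3(m)=0$ for $m<0$). Write $\mathbb{Z}_n$ for the cyclic group of order $n$, and $D^*_{4p}=\langle x,y\mid x^2=(xy)^2=y^p\rangle$, $D'_{2^{k+2}p}=\langle x,y\mid x^{2^{k+2}}=1,\ y^p=1,\ xy^{-1}=yx\rangle$, $T^*=\langle a,b\mid (ab)^2=a^3=b^3\rangle$,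 $T'_{8\cdot 3^k}=\langle x,y,z\mid x^2=(xy)^2=y^2,\ zxz^{-1}=y,\ zyz^{-1}=xy,\ z^{3^k}=1\rangle$, $O^*=\langle a,b\mid (ab)^2=a^3=b^4\rangle$, $I^*=\langle a,b\mid (ab)^2=a^3=b^5\rangle$. The spaces $\mathscr{A}_\Theta^{\mathrm{odd}}(\mathbb{C}\pi)$ and $\mathscr{A}_\Theta^{\mathrm{odd}}(\mathrm{Ker}\,\varepsilon)$ are finite-dimensional, and their dimensions $d=\dim\mathscr{A}_\Theta^{\mathrm{odd}}(\mathbb{C}\pi)$ and $d'=\dim\mathscr{A}_\Theta^{\mathrm{odd}}(\mathrm{Ker}\,\varepsilon)$ are as follows. (a) If $\pi=\mathbb{Z}_n$, $n\ge1$, then $d=p_3(n)=\frac1{12}n^2+\frac12n+c$ and $d'=p_3(n-3)=\frac1{12}n^2+c'$, where $(c,c')$ is $(1,0)$ if $2\mid n$, $3\mid n$; $(\frac23,-\frac13)$ if $2\mid n$, $3\nmid n$; $(\frac34,\frac14)$ if $2\nmid n$, $3\mid n$; $(\frac5{12},-\frac1{12})$ if $2\nmid n$, $3\nmid n$. (b1)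 If $\pi=\mathbb{Z}_m\times D^*_{4p}$, $m\ge1$, $p>0$ even, $(m,2p)=1$, then $d=\frac16m^2p^2+\frac12m^2p+\frac23m^2+\frac32mp+\frac16p^2+m+\frac12p+c$ and $d'=\frac16m^2p^2+\frac12m^2p+\frac23m^2+mp+\frac16p^2-\frac12m+c'$, where $(c,c')=(1,-\frac12)$ if $3\nmid p$ and $3\nmid m$, and $(c,c')=(\frac43,-\frac16)$ otherwise. (b2) If $\pi=\mathbb{Z}_m\times D^*_{4p}$, $m\ge1$, $p>0$ odd, $(m,2p)=1$, then $d=\frac16m^2p^2+\frac12m^2p+\frac23m^2+\frac32mp+\frac16p^2+\frac12m+c$ and $d'=\frac16m^2p^2+\frac12m^2p+\frac23m^2+mp+\frac16p^2-m-\frac12p+c'$, where $(c,c')=(\frac12,0)$ if $3\nmid p$ and $3\nmid m$, and $(c,c')=(\frac56,\frac13)$ otherwise. (c) If $\pi=\mathbb{Z}_m\times D'_{2^{k+2}p}$, $m\ge1$, $k\ge0$, $p\ge3$ odd, $(m,2p)=1$, then $d=\frac16 2^{2k}m^2p^2+\frac12 2^{2k}m^2p+\frac23 2^{2k}m^2+\frac32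 2^kmp+\frac16p^2+\frac12 2^km+c$ and $d'=\frac16 2^{2k}m^2p^2+\frac12 2^{2k}m^2p+\frac23 2^{2k}m^2+2^kmp-2^km+\frac16p^2-\frac12p+c'$, where $(c,c')=(\frac12,0)$ if $3\nmid p$ and $3\nmid m$, and $(c,c')=(\frac56,\frac13)$ otherwise. (d) If $\pi=\mathbb{Z}_m\times T^*$, $m\ge1$, $(m,6)=1$, then $d=\frac{19}3m^2+6m+\frac83$ and $d'=\frac{19}3m^2+\frac52m+\frac76$. (e) If $\pi=\mathbb{Z}_m\times T'_{8\cdot3^k}$, $m\ge1$, $(m,6)=1$, $k\ge2$, then $d=19\cdot3^{2k-3}m^2+2\cdot3^km+3$ and $d'=19\cdot3^{2k-3}m^2+\frac56\cdot3^km+\frac32$. For $k=1$ the values are those of (d). (f) If $\pi=\mathbb{Z}_m\times O^*$, $m\ge1$, $(m,6)=1$, then $d=\frac{34}3m^2+12m+\frac{35}3$ and $d'=\frac{34}3m^2+8m+\frac{23}3$. (g) If $\pi=\mathbb{Z}_m\times I^*$, $m\ge1$, $(m,30)=1$, then $d=\frac{74}3m^2+19m+\frac{64}3$ and $d'=\frac{74}3m^2+\frac{29}2m+\frac{101}6$.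 -/

import Mathlib

open scoped TensorProduct

namespace ThetaSpace

noncomputable section

/-! ## The third symmetric power as a functor -/

/-- The linear map `Sym³ V → Sym³ W`, `x · y · z ↦ f x · f y · f z`, induced by a linear map
`f : V → W`. -/
def symCubeMap {V W : Type} [AddCommGroup V] [Module ℂ V] [AddCommGroup W] [Module ℂ W]
    (f : V →ₗ[ℂ] W) : (Sym[ℂ]^3 V) →ₗ[ℂ] (Sym[ℂ]^3 W) where
  toFun := AddCon.lift (addConGen (SymmetricPower.Rel ℂ (Fin 3) V))
    ((SymmetricPower.mk ℂ (Fin 3) W).comp (PiTensorProduct.map fun _ => f)).toAddMonoidHom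
    (AddCon.addConGen_le.2 (by
      rintro _ _ ⟨e, v⟩
      have h := SymmetricPower.tprod_equiv (R := ℂ) e (fun i => f (v i))
      simpa [AddCon.ker_rel, SymmetricPower.tprod, PiTensorProduct.map_tprod] using h.symm))
  map_add' := map_add _
  map_smul' c x := by
    refine AddCon.induction_on x fun t => ?_
    exact ((SymmetricPower.mk ℂ (Fin 3) W).comp (PiTensorProduct.map fun _ => f)).map_smul c t

theorem symCubeMap_tprod {V W : Type} [AddCommGroup V] [Module ℂ V] [AddCommGroup W]
    [Module ℂ W] (f : V →ₗ[ℂ] W) (v : Fin 3 → V) :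
    symCubeMap f (SymmetricPower.tprod ℂ v) = SymmetricPower.tprod ℂ (fun i => f (v i)) := by
  change SymmetricPower.mk ℂ (Fin 3) W
    (PiTensorProduct.map (fun _ => f) (PiTensorProduct.tprod ℂ v)) = _
  rw [PiTensorProduct.map_tprod]
  rfl

theorem symCube_hom_ext {V M : Type} [AddCommGroup V] [Module ℂ V] [AddCommGroup M] [Module ℂ M]
    {f g : (Sym[ℂ]^3 V) →ₗ[ℂ] M}
    (h : ∀ v : Fin 3 → V, f (SymmetricPower.tprod ℂ v) = g (SymmetricPower.tprod ℂ v)) :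
    f = g := by
  refine LinearMap.ext_on_range (v := fun v : Fin 3 → V => SymmetricPower.tprod ℂ v) ?_ h
  exact SymmetricPower.span_tprod_eq_top ℂ (Fin 3) V

theorem symCubeMap_comp {U V W : Type} [AddCommGroup U] [Module ℂ U] [AddCommGroup V]
    [Module ℂ V] [AddCommGroup W] [Module ℂ W] (g : V →ₗ[ℂ] W) (f : U →ₗ[ℂ] V) :
    symCubeMap (g ∘ₗ f) = symCubeMap g ∘ₗ symCubeMap f :=
  symCube_hom_ext fun v => by simp [symCubeMap_tprod]

theorem symCubeMap_id {V : Type} [AddCommGroup V] [Module ℂ V] :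
    symCubeMap (LinearMap.id : V →ₗ[ℂ] V) = LinearMap.id :=
  symCube_hom_ext fun v => by simp [symCubeMap_tprod]

/-- The representation on `Sym³ V` induced by a representation on `V`. -/
def symCubeRep {H V : Type} [Group H] [AddCommGroup V] [Module ℂ V]
    (ρ : Representation ℂ H V) : Representation ℂ H (Sym[ℂ]^3 V) where
  toFun h := symCubeMap (ρ h)
  map_one' := by rw [map_one]; exact symCubeMap_id
  map_mul' a b := by rw [map_mul]; exact symCubeMap_comp _ _

/-! ## Coinvariants of the third symmetric power, and the `ℤ/2`-invariants in them -/

/-- `(Sym³ V)_{π × π}`, for a `π × π`-module `V`. -/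
abbrev SThetaOdd {G V : Type} [Group G] [AddCommGroup V] [Module ℂ V]
    (ρ : Representation ℂ (G × G) V) : Type :=
  (symCubeRep ρ).Coinvariants

/-- The endomorphism of `(Sym³ V)_{π × π}` induced by a linear map `τ : V → V` that intertwines
the action of `(g, h)` with that of `(h, g)`; on classes it is
`[x · y · z] ↦ [τ x · τ y · τ z]`. -/
def thetaInvolution {G V : Type} [Group G] [AddCommGroup V] [Module ℂ V]
    (ρ : Representation ℂ (G × G) V) (τ : V →ₗ[ℂ] V)
    (hτ : ∀ g h : G, τ ∘ₗ ρ (g, h) = ρ (h, g) ∘ₗ τ) : SThetaOdd ρ →ₗ[ℂ] SThetaOdd ρ :=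
  Representation.Coinvariants.lift (symCubeRep ρ)
    (Representation.Coinvariants.mk (symCubeRep ρ) ∘ₗ symCubeMap τ) (by
      rintro ⟨g, h⟩
      have e : symCubeMap τ ∘ₗ symCubeRep ρ (g, h) = symCubeRep ρ (h, g) ∘ₗ symCubeMap τ := by
        change symCubeMap τ ∘ₗ symCubeMap (ρ (g, h)) = symCubeMap (ρ (h, g)) ∘ₗ symCubeMap τ
        rw [← symCubeMap_comp, hτ, symCubeMap_comp]
      rw [LinearMap.comp_assoc, e]
      ext x
      exact Representation.Coinvariants.mk_self_apply (symCubeRep ρ) (h, g) (symCubeMap τ x))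

/-- `((Sym³ V)_{π × π})^{ℤ/2}`: the vectors fixed by the map induced by `τ`. -/
def AThetaOdd {G V : Type} [Group G] [AddCommGroup V] [Module ℂ V]
    (ρ : Representation ℂ (G × G) V) (τ : V →ₗ[ℂ] V)
    (hτ : ∀ g h : G, τ ∘ₗ ρ (g, h) = ρ (h, g) ∘ₗ τ) : Submodule ℂ (SThetaOdd ρ) :=
  LinearMap.eqLocus (thetaInvolution ρ τ hτ) LinearMap.id

/-! ## The group algebra and its augmentation ideal -/

/-- The group algebra `ℂπ` as a `π × π`-module, `(g, h) · x = g x h⁻¹`. -/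
def biregular (G : Type) [Group G] : Representation ℂ (G × G) (MonoidAlgebra ℂ G) where
  toFun gh := MonoidAlgebra.mapDomainLinearMap ℂ ℂ (fun x : G => gh.1 * x * gh.2⁻¹)
  map_one' := by ext x : 2; simp
  map_mul' a b := by ext x : 2; simp [mul_assoc]

/-- The linear extension `ℂπ → ℂπ` of the inversion `x ↦ x⁻¹`. -/
def inversion (G : Type) [Group G] : MonoidAlgebra ℂ G →ₗ[ℂ] MonoidAlgebra ℂ G :=
  MonoidAlgebra.mapDomainLinearMap ℂ ℂ (fun x : G => x⁻¹)

theorem inversion_comp_biregular (G : Type) [Group G] (g h : G) :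
    inversion G ∘ₗ biregular G (g, h) = biregular G (h, g) ∘ₗ inversion G := by
  ext x : 2
  simp [inversion, biregular, mul_assoc]

/-- The augmentation `ε : ℂπ → ℂ`, `∑ a_g g ↦ ∑ a_g`. -/
def augmentation (G : Type) [Group G] : MonoidAlgebra ℂ G →ₐ[ℂ] ℂ :=
  MonoidAlgebra.lift ℂ ℂ G 1

/-- `Ker ε`. -/
def kerAug (G : Type) [Group G] : Submodule ℂ (MonoidAlgebra ℂ G) :=
  LinearMap.ker (augmentation G).toLinearMap

theorem augmentation_biregular (G : Type) [Group G] (gh : G × G) (x : MonoidAlgebra ℂ G) :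
    augmentation G (biregular G gh x) = augmentation G x := by
  have : (augmentation G).toLinearMap ∘ₗ biregular G gh = (augmentation G).toLinearMap := by
    ext x : 2
    simp [augmentation, biregular]
  exact LinearMap.congr_fun this x

theorem augmentation_inversion (G : Type) [Group G] (x : MonoidAlgebra ℂ G) :
    augmentation G (inversion G x) = augmentation G x := by
  have : (augmentation G).toLinearMap ∘ₗ inversion G = (augmentation G).toLinearMap := by
    ext x : 2
    simp [augmentation, inversion]
  exact LinearMap.congr_fun this x

/-- `Ker ε` as a `π × π`-submodule of `ℂπ`. -/
def kerAugRep (G : Type) [Group G] : Representation ℂ (G × G) (kerAug G) :=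
  (biregular G).subrepresentation (kerAug G) fun gh x (hx : augmentation G x = 0) =>
    (augmentation_biregular G gh x).trans hx

/-- The restriction of the inversion to `Ker ε`. -/
def kerAugInversion (G : Type) [Group G] : kerAug G →ₗ[ℂ] kerAug G :=
  (inversion G).restrict fun x (hx : augmentation G x = 0) =>
    (augmentation_inversion G x).trans hx

theorem kerAugInversion_comp (G : Type) [Group G] (g h : G) :
    kerAugInversion G ∘ₗ kerAugRep G (g, h) = kerAugRep G (h, g) ∘ₗ kerAugInversion G :=
  LinearMap.ext fun x =>
    Subtype.ext (LinearMap.congr_fun (inversion_comp_biregular G g h) (x : MonoidAlgebra ℂ G))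

/-- `𝒜_Θ^odd(ℂπ)`. -/
abbrev AThetaGroupAlgebra (G : Type) [Group G] : Submodule ℂ (SThetaOdd (biregular G)) :=
  AThetaOdd (biregular G) (inversion G) (inversion_comp_biregular G)

/-- `𝒜_Θ^odd(Ker ε)`. -/
abbrev AThetaKer (G : Type) [Group G] : Submodule ℂ (SThetaOdd (kerAugRep G)) :=
  AThetaOdd (kerAugRep G) (kerAugInversion G) (kerAugInversion_comp G)

/-- `𝒜_Θ^odd(ℂπ)` and `𝒜_Θ^odd(Ker ε)` are finite-dimensional, of dimensions `d` and `d'`. -/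
def HasThetaDims (G : Type) [Group G] (d d' : ℚ) : Prop :=
  (Module.Finite ℂ (AThetaGroupAlgebra G) ∧
    (Module.finrank ℂ (AThetaGroupAlgebra G) : ℚ) = d) ∧
  (Module.Finite ℂ (AThetaKer G) ∧ (Module.finrank ℂ (AThetaKer G) : ℚ) = d')

/-! ## The groups -/

/-- The cyclic group of order `n` (for `n ≥ 1`), written multiplicatively. -/
abbrev Cyc (n : ℕ) : Type := Multiplicative (ZMod n)

/-- `⟨x, y ∣ x² = (xy)² = y^p⟩`. -/
abbrev BinaryDihedral (p : ℕ) : Type :=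
  let x : FreeGroup (Fin 2) := FreeGroup.of 0
  let y : FreeGroup (Fin 2) := FreeGroup.of 1
  PresentedGroup ({x ^ 2 * ((x * y) ^ 2)⁻¹, (x * y) ^ 2 * (y ^ p)⁻¹} : Set (FreeGroup (Fin 2)))

/-- `D'_{2^{k+2} p} = ⟨x, y ∣ x^{2^{k+2}} = 1, y^p = 1, x y⁻¹ = y x⟩`. -/
abbrev DPrime (k p : ℕ) : Type :=
  let x : FreeGroup (Fin 2) := FreeGroup.of 0
  let y : FreeGroup (Fin 2) := FreeGroup.of 1
  PresentedGroup ({x ^ 2 ^ (k + 2), y ^ p, x * y⁻¹ * (y * x)⁻¹} : Set (FreeGroup (Fin 2)))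

/-- `⟨a, b ∣ (ab)² = a³ = b^r⟩`. -/
abbrev BinaryPolyhedral (r : ℕ) : Type :=
  let a : FreeGroup (Fin 2) := FreeGroup.of 0
  let b : FreeGroup (Fin 2) := FreeGroup.of 1
  PresentedGroup ({(a * b) ^ 2 * (a ^ 3)⁻¹, a ^ 3 * (b ^ r)⁻¹} : Set (FreeGroup (Fin 2)))

/-- The binary tetrahedral group `T* = ⟨a, b ∣ (ab)² = a³ = b³⟩`. -/
abbrev TStar : Type := BinaryPolyhedral 3

/-- The binary octahedral group `O* = ⟨a, b ∣ (ab)² = a³ = b⁴⟩`. -/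
abbrev OStar : Type := BinaryPolyhedral 4

/-- The binary icosahedral group `I* = ⟨a, b ∣ (ab)² = a³ = b⁵⟩`. -/
abbrev IStar : Type := BinaryPolyhedral 5

/-- `T'_{8·3^k} =
⟨x, y, z ∣ x² = (xy)² = y², z x z⁻¹ = y, z y z⁻¹ = x y, z^{3^k} = 1⟩`. -/
abbrev TPrime (k : ℕ) : Type :=
  let x : FreeGroup (Fin 3) := FreeGroup.of 0
  let y : FreeGroup (Fin 3) := FreeGroup.of 1
  let z : FreeGroup (Fin 3) := FreeGroup.of 2
  PresentedGroup ({x ^ 2 * ((x * y) ^ 2)⁻¹, (x * y) ^ 2 * (y ^ 2)⁻¹, z * x * z⁻¹ * y⁻¹,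
    z * y * z⁻¹ * (x * y)⁻¹, z ^ 3 ^ k} : Set (FreeGroup (Fin 3)))

/-! ## Partitions into at most three parts -/

/-- The number of integer solutions of `x + y + z = m`, `0 ≤ x ≤ y ≤ z`
(there are none if `m < 0`). -/
def p3 (m : ℤ) : ℕ :=
  {t : ℤ × ℤ × ℤ | 0 ≤ t.1 ∧ t.1 ≤ t.2.1 ∧ t.2.1 ≤ t.2.2 ∧ t.1 + t.2.1 + t.2.2 = m}.ncard

end

end ThetaSpace

open ThetaSpace

/-!
Dualising, `𝒜_Θ^odd(ℂπ)` has the dimension of the space of functions `F : π³ → ℂ` that are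
symmetric, invariant under `(u, v, w) ↦ (g u h⁻¹, g v h⁻¹, g w h⁻¹)` and invariant under
simultaneous inversion (`finrank_AThetaGroupAlgebra`): an invariant linear form on `Sym³ ℂπ` is
determined by its values on triples of group elements. The linear forms on `Sym³ (Ker ε)` that are
invariant correspond to those `F` which moreover sum to zero in one variable, and summing out a
variable maps the space of all such `F` onto the analogous space of functions on `π²`
(`contraction_surjective`). Hence `dim 𝒜_Θ^odd(ℂπ) - dim 𝒜_Θ^odd(Ker ε)` is the dimension of the
latter space (`finrank_AThetaKer_add`).

The functions on `πⁿ` in question are the functions constant on the orbits of a finite group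
`ThetaGroup n π` of order `2 n! |π|²`, so that Burnside's lemma turns both dimensions into counts
of solutions of equations in `π`. For `n = 3`
(`twelve_mul_finrank_invariantFunctions_three`) it gives, with `N = |π|`,

`12 N d = #{[a, b] = [a, c] = 1} + 6 #{[a², b] = 1} + 2 #{a³ = b³} + #{a² = b² = c²}
  + 2 #{a² = b³}`,

and for `n = 2` it gives `2 N (d - d') = #{[a, b] = 1} + #{a² = b²}`.

All these counts are multiplicative over direct products, so each is needed only for cyclic groups
and for one further factor, where they are collected in a statement `HasCounts`.

* In a commutative group they depend only on the orders of the group and of its 2- and 3-torsion.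
  For cyclic groups the result is compared with `p3 n = p3 (n - 3) + (⌊n / 2⌋ + 1)`.
* The binary dihedral group is the quaternion group `QuaternionGroup p` of Mathlib. Like the
  dihedral groups, it consists of a commutative subgroup of index two and a coset of it whose
  elements invert the subgroup and have a common square; `IsDicyclic.hasCounts` treats all such
  groups.
* The groups `D'` and `T'` are semidirect products `N ⋊ C` with `C` cyclic, acting through a
  quotient `Y` of order `2` or `3`. The counts for `N ⋊ C` follow from counts in `N ⋊ Y`
  (`hasCounts_semidirect`), because the solutions of each equation in `C` over a given solution in
  `Y` are easily parametrised.
* The groups `T*`, `O*`, `I*` are enumerated. The defining relations imply that the group is a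
  union of explicit double cosets of the cyclic subgroup generated by `b`
  (`mem_doubleCosetList`), and a homomorphism to `SL₂` over a prime field shows that the listed
  elements are distinct and allows the counts to be computed on matrices.
-/

namespace ThetaSpace

/-! ### The symmetry group of triples and pairs, and Burnside counting -/

/-- The group `(G × G) ⋊ (ℤ/2 × S_n)` acting on `n`-tuples of elements of `G`: `(g, h)` acts by
`x ↦ g x h⁻¹` on every entry, `ℤ/2` by inversion of every entry, `S_n` by permutation of the
entries. An element first permutes and inverts, then multiplies by `left` and `right⁻¹`; inversion
exchanges the two factors of `G × G`. -/
structure ThetaGroup (n : ℕ) (G : Type) where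
  left : G
  right : G
  flip : Bool
  perm : Equiv.Perm (Fin n)

namespace ThetaGroup

variable {n : ℕ} {G : Type}

/-- The underlying set of `ThetaGroup n G`. -/
def equivProd (n : ℕ) (G : Type) : ThetaGroup n G ≃ (G × G) × Bool × Equiv.Perm (Fin n) where
  toFun a := ((a.left, a.right), a.flip, a.perm)
  invFun a := ⟨a.1.1, a.1.2, a.2.1, a.2.2⟩
  left_inv _ := rfl
  right_inv _ := rfl

instance [Finite G] : Finite (ThetaGroup n G) := Finite.of_equiv _ (equivProd n G).symm

theorem card_eq (n : ℕ) (G : Type) :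
    Nat.card (ThetaGroup n G) = 2 * n.factorial * Nat.card G ^ 2 := by
  rw [Nat.card_congr (equivProd n G)]
  simp [Fintype.card_perm]
  ring

variable [Group G]

instance : Mul (ThetaGroup n G) where
  mul a b := ⟨a.left * bif a.flip then b.right else b.left,
    a.right * bif a.flip then b.left else b.right, xor a.flip b.flip, a.perm * b.perm⟩

instance : One (ThetaGroup n G) := ⟨⟨1, 1, false, 1⟩⟩

instance : Inv (ThetaGroup n G) where
  inv a := ⟨bif a.flip then a.right⁻¹ else a.left⁻¹, bif a.flip then a.left⁻¹ else a.right⁻¹,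
    a.flip, a.perm⁻¹⟩

theorem mul_def (a b : ThetaGroup n G) :
    a * b = ⟨a.left * bif a.flip then b.right else b.left,
      a.right * bif a.flip then b.left else b.right, xor a.flip b.flip, a.perm * b.perm⟩ := rfl

theorem one_def : (1 : ThetaGroup n G) = ⟨1, 1, false, 1⟩ := rfl

theorem inv_def (a : ThetaGroup n G) :
    a⁻¹ = ⟨bif a.flip then a.right⁻¹ else a.left⁻¹, bif a.flip then a.left⁻¹ else a.right⁻¹,
      a.flip, a.perm⁻¹⟩ := rfl

instance : Group (ThetaGroup n G) :=
  Group.ofLeftAxioms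
    (by rintro ⟨a, a', s, σ⟩ ⟨b, b', t, ρ⟩ ⟨c, c', u, μ⟩
        cases s <;> cases t <;> simp [mul_def, mul_assoc])
    (by rintro ⟨a, a', s, σ⟩; simp [mul_def, one_def])
    (by rintro ⟨a, a', s, σ⟩; cases s <;> simp [mul_def, one_def, inv_def])

instance : SMul (ThetaGroup n G) (Fin n → G) where
  smul a v i := a.left * (bif a.flip then (v (a.perm⁻¹ i))⁻¹ else v (a.perm⁻¹ i)) * a.right⁻¹

theorem smul_apply (a : ThetaGroup n G) (v : Fin n → G) (i : Fin n) :
    (a • v) i =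
      a.left * (bif a.flip then (v (a.perm⁻¹ i))⁻¹ else v (a.perm⁻¹ i)) * a.right⁻¹ := rfl

instance : MulAction (ThetaGroup n G) (Fin n → G) where
  one_smul v := funext fun i => by
    change 1 * (bif false then _ else v ((1 : Equiv.Perm (Fin n))⁻¹ i)) * 1⁻¹ = v i
    simp
  mul_smul := by
    rintro ⟨a, a', s, σ⟩ ⟨b, b', t, ρ⟩ v
    funext i
    simp only [mul_def, smul_apply]
    cases s <;> cases t <;> simp [mul_assoc]

end ThetaGroup

/-- The functions on `Gⁿ` that are constant on the orbits of `ThetaGroup n G`. -/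
def invariantFunctions (n : ℕ) (G : Type) [Group G] : Submodule ℂ ((Fin n → G) → ℂ) where
  carrier := {F | ∀ (a : ThetaGroup n G) v, F (a • v) = F v}
  add_mem' hF hF' a v := by simp [hF a v, hF' a v]
  zero_mem' _ _ := rfl
  smul_mem' c F hF a v := by simp [hF a v]

/-- Invariance can be tested on the three kinds of generators of `ThetaGroup n G`. -/
theorem mem_invariantFunctions_iff {n : ℕ} {G : Type} [Group G] {F : (Fin n → G) → ℂ} :
    F ∈ invariantFunctions n G ↔
      (∀ (σ : Equiv.Perm (Fin n)) v, F (fun i => v (σ i)) = F v) ∧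
      (∀ (g h : G) v, F (fun i => g * v i * h⁻¹) = F v) ∧ ∀ v, F (fun i => (v i)⁻¹) = F v := by
  refine ⟨fun H => ⟨fun σ v => ?_, fun g h v => ?_, fun v => ?_⟩, ?_⟩
  · simpa [ThetaGroup.smul_apply, funext_iff] using (congrArg F (funext fun i => by
      simp [ThetaGroup.smul_apply])).trans (H ⟨1, 1, false, σ⁻¹⟩ v)
  · exact (congrArg F (funext fun i => by
      simp [ThetaGroup.smul_apply])).trans (H ⟨g, h, false, 1⟩ v)
  · exact (congrArg F (funext fun i => by
      simp [ThetaGroup.smul_apply])).trans (H ⟨1, 1, true, 1⟩ v)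
  · rintro ⟨H₁, H₂, H₃⟩ ⟨g, h, s, σ⟩ v
    refine (H₂ g h fun i => bif s then (v (σ⁻¹ i))⁻¹ else v (σ⁻¹ i)).trans ?_
    cases s
    · exact H₁ σ⁻¹ v
    · exact (H₃ fun i => v (σ⁻¹ i)).trans (H₁ σ⁻¹ v)

theorem finrank_invariantFunctions (n : ℕ) (G : Type) [Group G] [Finite G] :
    Module.finrank ℂ (invariantFunctions n G) =
      Nat.card (MulAction.orbitRel.Quotient (ThetaGroup n G) (Fin n → G)) := by
  classical
  let e : (MulAction.orbitRel.Quotient (ThetaGroup n G) (Fin n → G) → ℂ) ≃ₗ[ℂ]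
      invariantFunctions n G :=
    { toFun φ := ⟨fun v => φ (Quotient.mk'' v), fun a v =>
        congrArg φ (Quotient.sound' (MulAction.mem_orbit v a))⟩
      map_add' _ _ := rfl
      map_smul' _ _ := rfl
      invFun F q := Quotient.liftOn' q F.1 (by
        rintro _ v ⟨a, rfl⟩
        exact F.2 a v)
      left_inv φ := by
        funext q
        induction q using Quotient.inductionOn'
        rfl
      right_inv F := rfl }
  have := Fintype.ofFinite (MulAction.orbitRel.Quotient (ThetaGroup n G) (Fin n → G))
  rw [← e.finrank_eq, Module.finrank_fintype_fun_eq_card, Nat.card_eq_fintype_card]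

/-- Burnside's lemma for `ThetaGroup n G`. -/
theorem card_orbits_mul (n : ℕ) (G : Type) [Group G] :
    Nat.card {x : ThetaGroup n G × (Fin n → G) // x.1 • x.2 = x.2} =
      Nat.card (MulAction.orbitRel.Quotient (ThetaGroup n G) (Fin n → G)) *
        Nat.card (ThetaGroup n G) := by
  rw [← Nat.card_prod]
  refine Nat.card_congr (Equiv.trans ?_
    (MulAction.sigmaFixedByEquivOrbitsProdGroup (ThetaGroup n G) (Fin n → G)))
  exact
    { toFun x := ⟨x.1.1, x.1.2, x.2⟩
      invFun x := ⟨(x.1, x.2.1), x.2.2⟩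
      left_inv _ := rfl
      right_inv _ := rfl }

/-! ### Counting solutions of equations in a group -/

section Counts
variable (G : Type) [Group G]

/-- The number of triples `(a, b, c)` such that `a` commutes with `b` and with `c`. -/
noncomputable def commTriples : ℕ :=
  Nat.card {x : G × G × G // Commute x.1 x.2.1 ∧ Commute x.1 x.2.2}

/-- The number of pairs `(a, b)` such that `a²` commutes with `b`. -/
noncomputable def commSquarePairs : ℕ :=
  Nat.card {x : G × G // Commute (x.1 ^ 2) x.2}

/-- The number of pairs with equal cubes. -/
noncomputable def cubePairs : ℕ :=
  Nat.card {x : G × G // x.1 ^ 3 = x.2 ^ 3}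

/-- The number of triples with equal squares. -/
noncomputable def squareTriples : ℕ :=
  Nat.card {x : G × G × G // x.1 ^ 2 = x.2.1 ^ 2 ∧ x.1 ^ 2 = x.2.2 ^ 2}

/-- The number of pairs `(a, b)` with `a² = b³`. -/
noncomputable def squareCubePairs : ℕ :=
  Nat.card {x : G × G // x.1 ^ 2 = x.2 ^ 3}

/-- The number of commuting pairs. -/
noncomputable def commPairs : ℕ :=
  Nat.card {x : G × G // Commute x.1 x.2}

/-- The number of pairs with equal squares. -/
noncomputable def squarePairs : ℕ :=
  Nat.card {x : G × G // x.1 ^ 2 = x.2 ^ 2}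

end Counts

/-! ### Fixed points of the symmetry group -/

section Fixed
variable {n : ℕ} (G : Type) [Group G]

/-- The number of fixed tuples of the elements `(g, h, σ)` of `ThetaGroup n G` with given `σ` that
do not invert, summed over `g` and `h`. -/
noncomputable def plainFixed (σ : Equiv.Perm (Fin n)) : ℕ :=
  Nat.card {x : (G × G) × (Fin n → G) // ∀ i, x.1.1 * x.2 i = x.2 (σ i) * x.1.2}

/-- The number of fixed tuples of the elements `(g, h, σ)` of `ThetaGroup n G` with given `σ` that
invert, summed over `g` and `h`. -/
noncomputable def flipFixed (σ : Equiv.Perm (Fin n)) : ℕ :=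
  Nat.card {x : (G × G) × (Fin n → G) // ∀ i, x.2 (σ i) * x.1.2 * x.2 i = x.1.1}

/-- Only the cycle type of `σ` matters. -/
theorem plainFixed_conj (σ ρ : Equiv.Perm (Fin n)) :
    plainFixed G (ρ * σ * ρ⁻¹) = plainFixed G σ :=
  Nat.card_congr (Equiv.subtypeEquiv
    ((Equiv.refl (G × G)).prodCongr (Equiv.arrowCongr ρ.symm (Equiv.refl G))) fun x => by
      constructor
      · intro H i
        simpa [Equiv.arrowCongr] using H (ρ i)
      · intro H i
        simpa [Equiv.arrowCongr] using H (ρ.symm i))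

theorem flipFixed_conj (σ ρ : Equiv.Perm (Fin n)) :
    flipFixed G (ρ * σ * ρ⁻¹) = flipFixed G σ :=
  Nat.card_congr (Equiv.subtypeEquiv
    ((Equiv.refl (G × G)).prodCongr (Equiv.arrowCongr ρ.symm (Equiv.refl G))) fun x => by
      constructor
      · intro H i
        simpa [Equiv.arrowCongr] using H (ρ i)
      · intro H i
        simpa [Equiv.arrowCongr] using H (ρ.symm i))

theorem card_fixed_eq_sum [Finite G] :
    Nat.card {x : ThetaGroup n G × (Fin n → G) // x.1 • x.2 = x.2} =
      ∑ σ : Equiv.Perm (Fin n), (plainFixed G σ + flipFixed G σ) := by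
  classical
  let e : {x : ThetaGroup n G × (Fin n → G) // x.1 • x.2 = x.2} ≃
      (Σ σ : Equiv.Perm (Fin n),
        ({x : (G × G) × (Fin n → G) // ∀ i, x.1.1 * x.2 i = x.2 (σ i) * x.1.2} ⊕
          {x : (G × G) × (Fin n → G) // ∀ i, x.2 (σ i) * x.1.2 * x.2 i = x.1.1})) :=
    { toFun := fun
        | ⟨(⟨g, h, false, σ⟩, v), hx⟩ => ⟨σ, Sum.inl ⟨((g, h), v), fun i => by
            have := congrFun hx (σ i)
            simp [ThetaGroup.smul_apply] at this
            simp [← this]⟩⟩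
        | ⟨(⟨g, h, true, σ⟩, v), hx⟩ => ⟨σ, Sum.inr ⟨((g, h), v), fun i => by
            have := congrFun hx (σ i)
            simp [ThetaGroup.smul_apply] at this
            simp [← this]⟩⟩
      invFun := fun
        | ⟨σ, Sum.inl ⟨((g, h), v), hx⟩⟩ => ⟨(⟨g, h, false, σ⟩, v), funext fun i => by
            have := hx (σ⁻¹ i)
            simp at this
            simp [ThetaGroup.smul_apply, this]⟩
        | ⟨σ, Sum.inr ⟨((g, h), v), hx⟩⟩ => ⟨(⟨g, h, true, σ⟩, v), funext fun i => by
            have := hx (σ⁻¹ i)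
            simp at this
            simp [ThetaGroup.smul_apply, ← this]⟩
      left_inv := by rintro ⟨⟨⟨g, h, _ | _, σ⟩, v⟩, hx⟩ <;> rfl
      right_inv := by rintro ⟨σ, ⟨⟨⟨g, h⟩, v⟩, hx⟩ | ⟨⟨⟨g, h⟩, v⟩, hx⟩⟩ <;> rfl }
  rw [Nat.card_congr e, Nat.card_sigma]
  exact Finset.sum_congr rfl fun σ _ => Nat.card_sum

theorem plainFixed_three_one :
    plainFixed G (1 : Equiv.Perm (Fin 3)) = Nat.card G * commTriples G := by
  rw [commTriples, ← Nat.card_prod]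
  refine Nat.card_congr
    { toFun x := (x.1.2 0, ⟨(x.1.1.2, (x.1.2 0)⁻¹ * x.1.2 1, (x.1.2 0)⁻¹ * x.1.2 2), ?_⟩)
      invFun y := ⟨((y.1 * y.2.1.1 * y.1⁻¹, y.2.1.1), ![y.1, y.1 * y.2.1.2.1, y.1 * y.2.1.2.2]), ?_⟩
      left_inv := ?_
      right_inv := ?_ }
  · obtain ⟨⟨⟨g, h⟩, v⟩, H⟩ := x
    simp only [Equiv.Perm.coe_one, id] at H
    have h0 : h = (v 0)⁻¹ * g * v 0 := by rw [mul_assoc, H 0]; group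
    constructor
    · change h * ((v 0)⁻¹ * v 1) = (v 0)⁻¹ * v 1 * h
      rw [mul_assoc, ← H 1, h0]; group
    · change h * ((v 0)⁻¹ * v 2) = (v 0)⁻¹ * v 2 * h
      rw [mul_assoc, ← H 2, h0]; group
  · obtain ⟨w, ⟨⟨h, a, b⟩, H, H'⟩⟩ := y
    intro i
    fin_cases i
    · simp
    · simpa [mul_assoc] using H.eq
    · simpa [mul_assoc] using H'.eq
  · rintro ⟨⟨⟨g, h⟩, v⟩, H⟩
    ext i
    · simpa [mul_inv_eq_iff_eq_mul] using (H 0).symm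
    · rfl
    · fin_cases i <;> simp
  · rintro ⟨w, ⟨⟨h, a, b⟩, H, H'⟩⟩
    simp

theorem flipFixed_three_one :
    flipFixed G (1 : Equiv.Perm (Fin 3)) = Nat.card G * squareTriples G := by
  rw [squareTriples, ← Nat.card_prod]
  refine Nat.card_congr
    { toFun x := (x.1.1.2, ⟨(x.1.2 0 * x.1.1.2, x.1.2 1 * x.1.1.2, x.1.2 2 * x.1.1.2), ?_⟩)
      invFun y := ⟨((y.2.1.1 ^ 2 * y.1⁻¹, y.1),
        ![y.2.1.1 * y.1⁻¹, y.2.1.2.1 * y.1⁻¹, y.2.1.2.2 * y.1⁻¹]), ?_⟩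
      left_inv := ?_
      right_inv := ?_ }
  · obtain ⟨⟨⟨g, h⟩, v⟩, H⟩ := x
    have H' : ∀ i, (v i * h) ^ 2 = g * h := fun i => by
      have := H i
      simp only [Equiv.Perm.coe_one, id] at this
      rw [← this, sq]; simp [mul_assoc]
    exact ⟨(H' 0).trans (H' 1).symm, (H' 0).trans (H' 2).symm⟩
  · obtain ⟨h, ⟨⟨a, b, c⟩, H, H'⟩⟩ := y
    simp only at H H'
    intro i
    fin_cases i
    · simp [sq, mul_assoc]
    · simp [H, sq, mul_assoc]
    · simp [H', sq, mul_assoc]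
  · rintro ⟨⟨⟨g, h⟩, v⟩, H⟩
    ext i
    · simpa [sq, mul_assoc] using H 0
    · rfl
    · fin_cases i <;> simp
  · rintro ⟨w, ⟨⟨h, a, b⟩, H, H'⟩⟩
    simp

theorem plainFixed_three_swap :
    plainFixed G (Equiv.swap 0 1 : Equiv.Perm (Fin 3)) = Nat.card G * commSquarePairs G := by
  rw [commSquarePairs, ← Nat.card_prod]
  refine Nat.card_congr
    { toFun x := (x.1.2 2, ⟨(x.1.1.2, (x.1.2 2)⁻¹ * x.1.2 1), ?_⟩)
      invFun y := ⟨((y.1 * y.2.1.1 * y.1⁻¹, y.2.1.1),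
        ![y.1 * y.2.1.1 * y.2.1.2 * y.2.1.1⁻¹, y.1 * y.2.1.2, y.1]), ?_⟩
      left_inv := ?_
      right_inv := ?_ }
  · obtain ⟨⟨⟨g, h⟩, v⟩, H⟩ := x
    have h0 : g * v 0 = v 1 * h := by simpa using H 0
    have h1 : g * v 1 = v 0 * h := by simpa using H 1
    have h2 : g * v 2 = v 2 * h := by simpa [Equiv.swap_apply_of_ne_of_ne] using H 2
    have hg : v 2 * h * (v 2)⁻¹ = g := by rw [← h2]; group
    change h ^ 2 * ((v 2)⁻¹ * v 1) = (v 2)⁻¹ * v 1 * h ^ 2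
    calc h ^ 2 * ((v 2)⁻¹ * v 1) =
          (v 2)⁻¹ * ((v 2 * h * (v 2)⁻¹) * ((v 2 * h * (v 2)⁻¹) * v 1)) := by
          simp [sq, mul_assoc]
      _ = _ := by rw [hg, h1, ← mul_assoc g, h0, sq]; simp [mul_assoc]
  · obtain ⟨w, ⟨⟨h, a⟩, H⟩⟩ := y
    replace H : h ^ 2 * a = a * h ^ 2 := H
    intro i
    fin_cases i
    · have : h * (h * (a * h⁻¹)) = a * h := by
        rw [← mul_assoc, ← mul_assoc, ← sq, H, sq]; simp [mul_assoc]
      simpa [mul_assoc] using this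
    · simp [mul_assoc]
    · simp [mul_assoc, Equiv.swap_apply_of_ne_of_ne]
  · rintro ⟨⟨⟨g, h⟩, v⟩, H⟩
    have h1 : g * v 1 = v 0 * h := by simpa using H 1
    have h2 : g * v 2 = v 2 * h := by simpa [Equiv.swap_apply_of_ne_of_ne] using H 2
    have hg : v 2 * h * (v 2)⁻¹ = g := by rw [← h2]; group
    ext i
    · exact hg
    · rfl
    · fin_cases i
      · have : v 2 * h * (v 2)⁻¹ * v 1 * h⁻¹ = v 0 := by rw [hg, h1]; group
        simpa [mul_assoc] using this
      · simp
      · rfl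
  · rintro ⟨w, ⟨⟨h, a⟩, H⟩⟩
    simp

theorem flipFixed_three_swap :
    flipFixed G (Equiv.swap 0 1 : Equiv.Perm (Fin 3)) = Nat.card G * commSquarePairs G := by
  rw [commSquarePairs, ← Nat.card_prod]
  refine Nat.card_congr
    { toFun x := (x.1.1.2, ⟨(x.1.2 2 * x.1.1.2, x.1.2 1 * x.1.1.2), ?_⟩)
      invFun y := ⟨((y.2.1.1 ^ 2 * y.1⁻¹, y.1),
        ![y.2.1.2⁻¹ * y.2.1.1 ^ 2 * y.1⁻¹, y.2.1.2 * y.1⁻¹, y.2.1.1 * y.1⁻¹]), ?_⟩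
      left_inv := ?_
      right_inv := ?_ }
  · obtain ⟨⟨⟨g, h⟩, v⟩, H⟩ := x
    have h0 : v 1 * h * v 0 = g := by simpa using H 0
    have h1 : v 0 * h * v 1 = g := by simpa using H 1
    have h2 : v 2 * h * v 2 = g := by simpa [Equiv.swap_apply_of_ne_of_ne] using H 2
    change (v 2 * h) ^ 2 * (v 1 * h) = v 1 * h * (v 2 * h) ^ 2
    have e : (v 2 * h) ^ 2 = g * h := by rw [← h2, sq]; simp [mul_assoc]
    rw [e]
    calc g * h * (v 1 * h) = (v 1 * h * v 0) * h * v 1 * h := by rw [h0]; simp [mul_assoc]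
      _ = v 1 * h * (v 0 * h * v 1) * h := by simp [mul_assoc]
      _ = _ := by rw [h1]; simp [mul_assoc]
  · obtain ⟨h, ⟨⟨u, a⟩, H⟩⟩ := y
    replace H : u ^ 2 * a = a * u ^ 2 := H
    intro i
    fin_cases i
    · simp [mul_assoc]
    · have : a⁻¹ * (u ^ 2 * a * h⁻¹) = u ^ 2 * h⁻¹ := by rw [H]; simp [mul_assoc]
      simpa [mul_assoc] using this
    · simp [mul_assoc, Equiv.swap_apply_of_ne_of_ne, sq]
  · rintro ⟨⟨⟨g, h⟩, v⟩, H⟩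
    have h0 : v 1 * h * v 0 = g := by simpa using H 0
    have h2 : v 2 * h * v 2 = g := by simpa [Equiv.swap_apply_of_ne_of_ne] using H 2
    have e : (v 2 * h) ^ 2 = g * h := by rw [← h2, sq]; simp [mul_assoc]
    ext i
    · simp [e]
    · rfl
    · fin_cases i
      · simp [e, ← h0, mul_assoc]
      · simp
      · simp
  · rintro ⟨w, ⟨⟨h, a⟩, H⟩⟩
    simp

theorem plainFixed_three_rotate :
    plainFixed G (finRotate 3) = Nat.card G * cubePairs G := by
  rw [cubePairs, ← Nat.card_prod]
  refine Nat.card_congr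
    { toFun x := (x.1.2 0, ⟨((x.1.2 0)⁻¹ * x.1.1.1 * x.1.2 0, x.1.1.2), ?_⟩)
      invFun y := ⟨((y.1 * y.2.1.1 * y.1⁻¹, y.2.1.2),
        ![y.1, y.1 * y.2.1.1 * y.2.1.2⁻¹, y.1 * y.2.1.1 * y.2.1.1 * y.2.1.2⁻¹ * y.2.1.2⁻¹]), ?_⟩
      left_inv := ?_
      right_inv := ?_ }
  · obtain ⟨⟨⟨g, h⟩, v⟩, H⟩ := x
    have h0 : g * v 0 = v 1 * h := by simpa using H 0
    have h1 : g * v 1 = v 2 * h := by simpa using H 1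
    have h2 : g * v 2 = v 0 * h := by simpa using H 2
    change ((v 0)⁻¹ * g * v 0) ^ 3 = h ^ 3
    calc ((v 0)⁻¹ * g * v 0) ^ 3 = (v 0)⁻¹ * (g * (g * (g * v 0))) := by
          simp [pow_succ, mul_assoc]
      _ = (v 0)⁻¹ * (g * (g * v 1) * h) := by rw [h0]; simp [mul_assoc]
      _ = (v 0)⁻¹ * (g * v 2 * h * h) := by rw [h1]; simp [mul_assoc]
      _ = _ := by rw [h2]; simp [pow_succ, mul_assoc]
  · obtain ⟨w, ⟨⟨a, h⟩, H⟩⟩ := y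
    replace H : a ^ 3 = h ^ 3 := H
    intro i
    fin_cases i
    · simp
    · simp [mul_assoc]
    · have : a * (a * (a * (h⁻¹ * h⁻¹))) = h := by
        rw [← mul_assoc a a, ← mul_assoc, ← sq, ← pow_succ, H]; simp [pow_succ, mul_assoc]
      simpa [mul_assoc] using this
  · rintro ⟨⟨⟨g, h⟩, v⟩, H⟩
    have h0 : g * v 0 = v 1 * h := by simpa using H 0
    have h1 : g * v 1 = v 2 * h := by simpa using H 1
    ext i
    · simp [mul_assoc]
    · rfl
    · fin_cases i
      · simp
      · simp [mul_assoc, h0]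
      · have : g * (g * (v 0 * (h⁻¹ * h⁻¹))) = v 2 := by
          rw [← mul_assoc g (v 0), h0, ← mul_assoc g, ← mul_assoc g, h1]; simp [mul_assoc]
        simpa [mul_assoc] using this
  · rintro ⟨w, ⟨⟨h, a⟩, H⟩⟩
    simp [mul_assoc]

theorem flipFixed_three_rotate :
    flipFixed G (finRotate 3) = Nat.card G * squareCubePairs G := by
  rw [squareCubePairs, ← Nat.card_prod]
  refine Nat.card_congr
    { toFun x := (x.1.1.2, ⟨(x.1.2 0 * x.1.1.2 * x.1.1.1 * x.1.1.2, x.1.1.1 * x.1.1.2), ?_⟩)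
      invFun y := ⟨((y.2.1.2 * y.1⁻¹, y.1),
        ![y.2.1.1 * y.2.1.2⁻¹ * y.1⁻¹, y.2.1.2 * y.2.1.2 * y.2.1.1⁻¹ * y.1⁻¹,
          y.2.1.2 * y.2.1.1 * y.2.1.2⁻¹ * y.2.1.2⁻¹ * y.1⁻¹]), ?_⟩
      left_inv := ?_
      right_inv := ?_ }
  · obtain ⟨⟨⟨g, h⟩, v⟩, H⟩ := x
    have h0 : v 1 * h * v 0 = g := by simpa using H 0
    have h1 : v 2 * h * v 1 = g := by simpa using H 1
    have h2 : v 0 * h * v 2 = g := by simpa using H 2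
    change (v 0 * h * g * h) ^ 2 = (g * h) ^ 3
    calc (v 0 * h * g * h) ^ 2 = v 0 * h * g * h * (v 0 * h * g * h) := sq _
      _ = v 0 * h * (v 2 * h * v 1) * h * (v 0 * h * g * h) := by rw [h1]
      _ = (v 0 * h * v 2) * h * (v 1 * h * v 0) * h * g * h := by simp [mul_assoc]
      _ = _ := by rw [h0, h2]; simp [pow_succ, mul_assoc]
  · obtain ⟨h, ⟨⟨u, k⟩, H⟩⟩ := y
    replace H : u ^ 2 = k ^ 3 := H
    intro i
    fin_cases i
    · simp [mul_assoc]
    · simp [mul_assoc]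
    · have : u * u = k * (k * k) := by rw [← sq, H, pow_succ', sq]
      have : u * (u * (k⁻¹ * (k⁻¹ * h⁻¹))) = k * h⁻¹ := by
        rw [← mul_assoc, this]; simp [mul_assoc]
      simpa [mul_assoc] using this
  · rintro ⟨⟨⟨g, h⟩, v⟩, H⟩
    have h0 : v 1 * h * v 0 = g := by simpa using H 0
    have h1 : v 2 * h * v 1 = g := by simpa using H 1
    ext i
    · simp
    · rfl
    · fin_cases i
      · simp [mul_assoc]
      · have : v 1 = g * (v 0)⁻¹ * h⁻¹ := by rw [← h0]; group
        simp [this, mul_assoc]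
      · have h3 : v 1 = g * (v 0)⁻¹ * h⁻¹ := by rw [← h0]; group
        have : v 2 = g * (v 1)⁻¹ * h⁻¹ := by rw [← h1]; group
        simp [this, h3, mul_assoc]
  · rintro ⟨w, ⟨⟨h, a⟩, H⟩⟩
    simp [mul_assoc]

theorem plainFixed_two_one :
    plainFixed G (1 : Equiv.Perm (Fin 2)) = Nat.card G * commPairs G := by
  rw [commPairs, ← Nat.card_prod]
  refine Nat.card_congr
    { toFun x := (x.1.2 0, ⟨(x.1.1.2, (x.1.2 0)⁻¹ * x.1.2 1), ?_⟩)
      invFun y := ⟨((y.1 * y.2.1.1 * y.1⁻¹, y.2.1.1), ![y.1, y.1 * y.2.1.2]), ?_⟩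
      left_inv := ?_
      right_inv := ?_ }
  · obtain ⟨⟨⟨g, h⟩, v⟩, H⟩ := x
    simp only [Equiv.Perm.coe_one, id] at H
    have h0 : h = (v 0)⁻¹ * g * v 0 := by rw [mul_assoc, H 0]; group
    change h * ((v 0)⁻¹ * v 1) = (v 0)⁻¹ * v 1 * h
    rw [mul_assoc, ← H 1, h0]; group
  · obtain ⟨w, ⟨⟨h, a⟩, H⟩⟩ := y
    intro i
    fin_cases i
    · simp
    · simpa [mul_assoc] using H.eq
  · rintro ⟨⟨⟨g, h⟩, v⟩, H⟩
    ext i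
    · simpa [mul_inv_eq_iff_eq_mul] using (H 0).symm
    · rfl
    · fin_cases i <;> simp
  · rintro ⟨w, ⟨⟨h, a⟩, H⟩⟩
    simp

theorem flipFixed_two_one :
    flipFixed G (1 : Equiv.Perm (Fin 2)) = Nat.card G * squarePairs G := by
  rw [squarePairs, ← Nat.card_prod]
  refine Nat.card_congr
    { toFun x := (x.1.1.2, ⟨(x.1.2 0 * x.1.1.2, x.1.2 1 * x.1.1.2), ?_⟩)
      invFun y := ⟨((y.2.1.1 ^ 2 * y.1⁻¹, y.1), ![y.2.1.1 * y.1⁻¹, y.2.1.2 * y.1⁻¹]), ?_⟩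
      left_inv := ?_
      right_inv := ?_ }
  · obtain ⟨⟨⟨g, h⟩, v⟩, H⟩ := x
    have H' : ∀ i, (v i * h) ^ 2 = g * h := fun i => by
      have := H i
      simp only [Equiv.Perm.coe_one, id] at this
      rw [← this, sq]; simp [mul_assoc]
    exact (H' 0).trans (H' 1).symm
  · obtain ⟨h, ⟨⟨a, b⟩, H⟩⟩ := y
    simp only at H
    intro i
    fin_cases i
    · simp [sq, mul_assoc]
    · simp [H, sq, mul_assoc]
  · rintro ⟨⟨⟨g, h⟩, v⟩, H⟩
    ext i
    · simpa [sq, mul_assoc] using H 0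
    · rfl
    · fin_cases i <;> simp
  · rintro ⟨w, ⟨⟨h, a⟩, H⟩⟩
    simp

theorem plainFixed_two_swap :
    plainFixed G (Equiv.swap 0 1 : Equiv.Perm (Fin 2)) = Nat.card G * squarePairs G := by
  rw [squarePairs, ← Nat.card_prod]
  refine Nat.card_congr
    { toFun x := (x.1.2 0, ⟨((x.1.2 0)⁻¹ * x.1.1.1 * x.1.2 0, x.1.1.2), ?_⟩)
      invFun y := ⟨((y.1 * y.2.1.1 * y.1⁻¹, y.2.1.2), ![y.1, y.1 * y.2.1.1 * y.2.1.2⁻¹]), ?_⟩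
      left_inv := ?_
      right_inv := ?_ }
  · obtain ⟨⟨⟨g, h⟩, v⟩, H⟩ := x
    have h0 : g * v 0 = v 1 * h := by simpa using H 0
    have h1 : g * v 1 = v 0 * h := by simpa using H 1
    change ((v 0)⁻¹ * g * v 0) ^ 2 = h ^ 2
    calc ((v 0)⁻¹ * g * v 0) ^ 2 = (v 0)⁻¹ * (g * (g * v 0)) := by
          simp [pow_succ, mul_assoc]
      _ = _ := by rw [h0, ← mul_assoc g, h1]; simp [pow_succ, mul_assoc]
  · obtain ⟨w, ⟨⟨a, h⟩, H⟩⟩ := y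
    replace H : a ^ 2 = h ^ 2 := H
    intro i
    fin_cases i
    · simp
    · have : a * (a * h⁻¹) = h := by rw [← mul_assoc, ← sq, H]; simp [sq]
      simpa [mul_assoc] using this
  · rintro ⟨⟨⟨g, h⟩, v⟩, H⟩
    have h0 : g * v 0 = v 1 * h := by simpa using H 0
    ext i
    · simp [mul_assoc]
    · rfl
    · fin_cases i
      · simp
      · simp [mul_assoc, h0]
  · rintro ⟨w, ⟨⟨h, a⟩, H⟩⟩
    simp [mul_assoc]

theorem flipFixed_two_swap :
    flipFixed G (Equiv.swap 0 1 : Equiv.Perm (Fin 2)) = Nat.card G * commPairs G := by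
  rw [commPairs, ← Nat.card_prod]
  refine Nat.card_congr
    { toFun x := (x.1.1.2, ⟨(x.1.2 0 * x.1.1.2, x.1.2 1 * x.1.1.2), ?_⟩)
      invFun y := ⟨((y.2.1.1 * y.2.1.2 * y.1⁻¹, y.1), ![y.2.1.1 * y.1⁻¹, y.2.1.2 * y.1⁻¹]), ?_⟩
      left_inv := ?_
      right_inv := ?_ }
  · obtain ⟨⟨⟨g, h⟩, v⟩, H⟩ := x
    have h0 : v 1 * h * v 0 = g := by simpa using H 0
    have h1 : v 0 * h * v 1 = g := by simpa using H 1
    change v 0 * h * (v 1 * h) = v 1 * h * (v 0 * h)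
    rw [← mul_assoc, h1, ← mul_assoc, h0]
  · obtain ⟨h, ⟨⟨u, a⟩, H⟩⟩ := y
    replace H : u * a = a * u := H
    intro i
    fin_cases i
    · simp [H, mul_assoc]
    · simp [mul_assoc]
  · rintro ⟨⟨⟨g, h⟩, v⟩, H⟩
    have h1 : v 0 * h * v 1 = g := by simpa using H 1
    ext i
    · simpa [mul_assoc] using h1
    · rfl
    · fin_cases i <;> simp
  · rintro ⟨w, ⟨⟨h, a⟩, H⟩⟩
    simp

/-- Burnside's lemma for triples: the classes of `S₃` are those of the identity, of the three
transpositions and of the two rotations. -/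
theorem twelve_mul_finrank_invariantFunctions_three [Finite G] :
    12 * Nat.card G * Module.finrank ℂ (invariantFunctions 3 G) =
      commTriples G + 6 * commSquarePairs G + 2 * cubePairs G + squareTriples G +
        2 * squareCubePairs G := by
  have h := card_orbits_mul 3 G
  rw [card_fixed_eq_sum, ← finrank_invariantFunctions, ThetaGroup.card_eq] at h
  have huniv : (Finset.univ : Finset (Equiv.Perm (Fin 3))) =
      {1, Equiv.swap 0 1, Equiv.swap 1 2 * Equiv.swap 0 1 * (Equiv.swap 1 2)⁻¹,
        Equiv.swap 0 2 * Equiv.swap 0 1 * (Equiv.swap 0 2)⁻¹, finRotate 3,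
        Equiv.swap 0 1 * finRotate 3 * (Equiv.swap 0 1)⁻¹} := by decide
  rw [huniv, Finset.sum_insert (by decide), Finset.sum_insert (by decide),
    Finset.sum_insert (by decide), Finset.sum_insert (by decide),
    Finset.sum_insert (by decide), Finset.sum_singleton] at h
  simp only [plainFixed_conj, flipFixed_conj, plainFixed_three_one, plainFixed_three_rotate,
    plainFixed_three_swap, flipFixed_three_one, flipFixed_three_rotate, flipFixed_three_swap] at h
  refine Nat.eq_of_mul_eq_mul_left (Nat.card_pos (α := G)) ?_
  simp only [Nat.factorial] at h
  linarith

theorem two_mul_finrank_invariantFunctions_two [Finite G] :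
    2 * Nat.card G * Module.finrank ℂ (invariantFunctions 2 G) = commPairs G + squarePairs G := by
  have h := card_orbits_mul 2 G
  rw [card_fixed_eq_sum, ← finrank_invariantFunctions, ThetaGroup.card_eq] at h
  have huniv : (Finset.univ : Finset (Equiv.Perm (Fin 2))) = {1, Equiv.swap 0 1} := by decide
  rw [huniv, Finset.sum_insert (by decide), Finset.sum_singleton] at h
  simp only [plainFixed_two_one, plainFixed_two_swap, flipFixed_two_one, flipFixed_two_swap] at h
  refine Nat.eq_of_mul_eq_mul_left (Nat.card_pos (α := G)) ?_
  simp only [Nat.factorial] at h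
  linarith

end Fixed

/-! ### Invariant linear forms on symmetric cubes -/

section Forms
variable {V W : Type} [AddCommGroup V] [Module ℂ V] [AddCommGroup W] [Module ℂ W]

instance finite_symCube [Module.Finite ℂ V] : Module.Finite ℂ (Sym[ℂ]^3 V) := by
  have : Module.Finite ℂ (⨂[ℂ] _ : Fin 3, V) :=
    Module.Finite.of_basis (Basis.piTensorProduct fun _ : Fin 3 => Module.finBasis ℂ V)
  exact Module.Finite.of_surjective (SymmetricPower.mk ℂ (Fin 3) V)
    (LinearMap.range_eq_top.1 (SymmetricPower.range_mk ℂ (Fin 3) V))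

instance finite_SThetaOdd {G : Type} [Group G] [Module.Finite ℂ V]
    (ρ : Representation ℂ (G × G) V) : Module.Finite ℂ (SThetaOdd ρ) :=
  Module.Finite.of_surjective _ (Representation.Coinvariants.mk_surjective (symCubeRep ρ))

/-- The linear form on `Sym³ V` induced by a symmetric trilinear form on `V`. -/
noncomputable def symCubeLift (M : MultilinearMap ℂ (fun _ : Fin 3 => V) ℂ)
    (hM : ∀ (e : Equiv.Perm (Fin 3)) v, M (fun i => v (e i)) = M v) : (Sym[ℂ]^3 V) →ₗ[ℂ] ℂ where
  toFun := AddCon.lift (addConGen (SymmetricPower.Rel ℂ (Fin 3) V))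
    (PiTensorProduct.lift M).toAddMonoidHom
    (AddCon.addConGen_le.2 (by
      rintro _ _ ⟨e, v⟩
      simpa [AddCon.ker_rel] using (hM e v).symm))
  map_add' := map_add _
  map_smul' c x := by
    refine AddCon.induction_on x fun t => ?_
    exact (PiTensorProduct.lift M).map_smul c t

theorem symCubeLift_tprod (M : MultilinearMap ℂ (fun _ : Fin 3 => V) ℂ)
    (hM : ∀ (e : Equiv.Perm (Fin 3)) v, M (fun i => v (e i)) = M v) (v : Fin 3 → V) :
    symCubeLift M hM (SymmetricPower.tprod ℂ v) = M v :=
  PiTensorProduct.lift.tprod (φ := M) v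

variable {G : Type} [Group G]

/-- The linear forms on `Sym³ V` invariant under `G × G` and under the involution `τ`, that is, the
dual of the space of coinvariants of `G × G`, restricted to its `τ`-invariants. -/
def invariantForms (ρ : Representation ℂ (G × G) V) (τ : V →ₗ[ℂ] V) :
    Submodule ℂ (Module.Dual ℂ (Sym[ℂ]^3 V)) where
  carrier := {l | (∀ g, l ∘ₗ symCubeMap (ρ g) = l) ∧ l ∘ₗ symCubeMap τ = l}
  add_mem' h h' := ⟨fun g => by rw [LinearMap.add_comp, h.1, h'.1],
    by rw [LinearMap.add_comp, h.2, h'.2]⟩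
  zero_mem' := ⟨fun _ => rfl, rfl⟩
  smul_mem' c l h := ⟨fun g => by rw [LinearMap.smul_comp, h.1], by rw [LinearMap.smul_comp, h.2]⟩

/-- An endomorphism and its transpose have the same nullity. -/
theorem finrank_ker_dualMap {E : Type} [AddCommGroup E] [Module ℂ E] [Module.Finite ℂ E]
    (f : E →ₗ[ℂ] E) :
    Module.finrank ℂ (LinearMap.ker f.dualMap) = Module.finrank ℂ (LinearMap.ker f) := by
  have h := f.finrank_range_add_finrank_ker
  have h' := f.dualMap.finrank_range_add_finrank_ker
  rw [LinearMap.finrank_range_dualMap_eq_finrank_range, Subspace.dual_finrank_eq] at h'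
  omega

/-- The `τ`-fixed vectors of the coinvariants are the kernel of an endomorphism whose transpose has
the invariant linear forms as its kernel. -/
theorem finrank_AThetaOdd [Module.Finite ℂ V] (ρ : Representation ℂ (G × G) V) (τ : V →ₗ[ℂ] V)
    (hτ : ∀ g h : G, τ ∘ₗ ρ (g, h) = ρ (h, g) ∘ₗ τ) :
    Module.finrank ℂ (AThetaOdd ρ τ hτ) = Module.finrank ℂ (invariantForms ρ τ) := by
  rw [AThetaOdd, LinearMap.eqLocus_eq_ker_sub, ← finrank_ker_dualMap]
  have hmk : ∀ l : Module.Dual ℂ (SThetaOdd ρ),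
      (thetaInvolution ρ τ hτ - LinearMap.id).dualMap l = 0 ↔
        (l ∘ₗ Representation.Coinvariants.mk (symCubeRep ρ)) ∘ₗ symCubeMap τ =
          l ∘ₗ Representation.Coinvariants.mk (symCubeRep ρ) := by
    intro l
    have e : (l ∘ₗ Representation.Coinvariants.mk (symCubeRep ρ)) ∘ₗ symCubeMap τ =
        (l ∘ₗ thetaInvolution ρ τ hτ) ∘ₗ Representation.Coinvariants.mk (symCubeRep ρ) := rfl
    rw [e, LinearMap.dualMap_apply', LinearMap.comp_sub, sub_eq_zero]
    exact ⟨fun h => by rw [h]; rfl, fun h => Representation.Coinvariants.hom_ext h⟩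
  refine LinearEquiv.finrank_eq
    { toFun l := ⟨l.1 ∘ₗ Representation.Coinvariants.mk (symCubeRep ρ), fun g => ?_,
        (hmk l.1).1 l.2⟩
      map_add' _ _ := rfl
      map_smul' _ _ := rfl
      invFun l := ⟨Representation.Coinvariants.lift (symCubeRep ρ) l.1 l.2.1, ?_⟩
      left_inv l := Subtype.ext (Representation.Coinvariants.hom_ext rfl)
      right_inv l := Subtype.ext rfl }
  · exact LinearMap.ext fun x => congrArg l.1 (Representation.Coinvariants.mk_self_apply _ g x)
  · exact (hmk _).2 l.2.2

end Forms

/-! ### The group algebra -/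

section GroupAlgebra

section
variable {G : Type}

instance finite_groupAlgebra [Finite G] : Module.Finite ℂ (MonoidAlgebra ℂ G) :=
  Module.Finite.of_basis (MonoidAlgebra.basis G ℂ)

theorem symCube_groupAlgebra_hom_ext [Finite G] {l l' : (Sym[ℂ]^3 (MonoidAlgebra ℂ G)) →ₗ[ℂ] ℂ}
    (h : ∀ v : Fin 3 → G, l (SymmetricPower.tprod ℂ fun i => MonoidAlgebra.single (v i) 1) =
      l' (SymmetricPower.tprod ℂ fun i => MonoidAlgebra.single (v i) 1)) : l = l' := by
  have : l.compMultilinearMap (SymmetricPower.tprod ℂ) =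
      l'.compMultilinearMap (SymmetricPower.tprod ℂ) :=
    Module.Basis.ext_multilinear (fun _ => MonoidAlgebra.basis G ℂ) fun v => by
      simpa using h v
  exact symCube_hom_ext fun v => congrFun (congrArg DFunLike.coe this) v

variable [Fintype G]

/-- The trilinear form on `ℂG` with values `F` on triples of group elements. -/
noncomputable def trilinear (F : (Fin 3 → G) → ℂ) :
    MultilinearMap ℂ (fun _ : Fin 3 => MonoidAlgebra ℂ G) ℂ :=
  ∑ v : Fin 3 → G, F v • (MultilinearMap.mkPiAlgebra ℂ (Fin 3) ℂ).compLinearMap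
    fun i => (MonoidAlgebra.basis G ℂ).coord (v i)

theorem trilinear_apply (F : (Fin 3 → G) → ℂ) (x : Fin 3 → MonoidAlgebra ℂ G) :
    trilinear F x = ∑ v : Fin 3 → G, F v * ∏ i, (x i).coeff (v i) := by
  simp [trilinear, MonoidAlgebra.basis]

theorem trilinear_single (F : (Fin 3 → G) → ℂ) (v : Fin 3 → G) :
    trilinear F (fun i => MonoidAlgebra.single (v i) 1) = F v := by
  classical
  rw [trilinear_apply, Finset.sum_eq_single v]
  · simp
  · intro w _ hw
    obtain ⟨i, hi⟩ := Function.ne_iff.1 hw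
    rw [Finset.prod_eq_zero (Finset.mem_univ i), mul_zero]
    simp [hi.symm]
  · simp

theorem trilinear_perm {F : (Fin 3 → G) → ℂ}
    (hF : ∀ (σ : Equiv.Perm (Fin 3)) v, F (fun i => v (σ i)) = F v) (σ : Equiv.Perm (Fin 3))
    (x : Fin 3 → MonoidAlgebra ℂ G) : trilinear F (fun i => x (σ i)) = trilinear F x := by
  rw [trilinear_apply, trilinear_apply]
  refine (Fintype.sum_equiv (Equiv.arrowCongr σ (Equiv.refl G)).symm _ _ fun v => ?_).symm
  have : (Equiv.arrowCongr σ (Equiv.refl G)).symm v = fun i => v (σ i) := rfl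
  rw [this, hF]
  congr 1
  exact (Equiv.prod_comp σ fun i => (x i).coeff (v i)).symm

/-- The linear form on `Sym³ ℂG` with values `F` on triples of group elements. -/
noncomputable def symForm (F : (Fin 3 → G) → ℂ)
    (hF : ∀ (σ : Equiv.Perm (Fin 3)) v, F (fun i => v (σ i)) = F v) :
    (Sym[ℂ]^3 (MonoidAlgebra ℂ G)) →ₗ[ℂ] ℂ :=
  symCubeLift (trilinear F) (trilinear_perm hF)

theorem symForm_single (F : (Fin 3 → G) → ℂ)
    (hF : ∀ (σ : Equiv.Perm (Fin 3)) v, F (fun i => v (σ i)) = F v) (v : Fin 3 → G) :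
    symForm F hF (SymmetricPower.tprod ℂ fun i => MonoidAlgebra.single (v i) 1) = F v := by
  rw [symForm, symCubeLift_tprod, trilinear_single]

end

variable (G : Type) [Group G]

theorem biregular_single (g h x : G) (c : ℂ) :
    biregular G (g, h) (MonoidAlgebra.single x c) = MonoidAlgebra.single (g * x * h⁻¹) c := by
  simp [biregular]

theorem inversion_single (x : G) (c : ℂ) :
    inversion G (MonoidAlgebra.single x c) = MonoidAlgebra.single x⁻¹ c := by
  simp [inversion]

theorem augmentation_single (x : G) (c : ℂ) :
    augmentation G (MonoidAlgebra.single x c) = c := by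
  simp [augmentation]

variable {G}

theorem invariantForms_eval_mem {l : Module.Dual ℂ (Sym[ℂ]^3 (MonoidAlgebra ℂ G))}
    (hl : l ∈ invariantForms (biregular G) (inversion G)) :
    (fun v : Fin 3 → G => l (SymmetricPower.tprod ℂ fun i => MonoidAlgebra.single (v i) 1)) ∈
      invariantFunctions 3 G := by
  refine mem_invariantFunctions_iff.2 ⟨fun σ v => ?_, fun g h v => ?_, fun v => ?_⟩
  · exact congrArg l (SymmetricPower.tprod_equiv σ fun i =>
      (MonoidAlgebra.single (v i) 1 : MonoidAlgebra ℂ G))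
  · have := LinearMap.congr_fun (hl.1 (g, h))
      (SymmetricPower.tprod ℂ fun i => MonoidAlgebra.single (v i) 1)
    simpa only [LinearMap.comp_apply, symCubeMap_tprod, biregular_single] using this
  · have := LinearMap.congr_fun hl.2
      (SymmetricPower.tprod ℂ fun i => MonoidAlgebra.single (v i) 1)
    simpa only [LinearMap.comp_apply, symCubeMap_tprod, inversion_single] using this

variable [Fintype G]

theorem symForm_mem {F : (Fin 3 → G) → ℂ} (hF : F ∈ invariantFunctions 3 G) :
    symForm F (mem_invariantFunctions_iff.1 hF).1 ∈
      invariantForms (biregular G) (inversion G) := by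
  obtain ⟨h₁, h₂, h₃⟩ := mem_invariantFunctions_iff.1 hF
  refine ⟨fun ⟨g, h⟩ => symCube_groupAlgebra_hom_ext fun v => ?_,
    symCube_groupAlgebra_hom_ext fun v => ?_⟩
  · simp only [LinearMap.comp_apply, symCubeMap_tprod, biregular_single, symForm_single]
    exact h₂ g h v
  · simp only [LinearMap.comp_apply, symCubeMap_tprod, inversion_single, symForm_single]
    exact h₃ v

/-- An invariant linear form on `Sym³ ℂG` is the same as an invariant function on `G³`. -/
theorem finrank_AThetaGroupAlgebra :
    Module.finrank ℂ (AThetaGroupAlgebra G) = Module.finrank ℂ (invariantFunctions 3 G) := by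
  rw [AThetaGroupAlgebra, finrank_AThetaOdd]
  exact LinearEquiv.finrank_eq
    { toFun l := ⟨_, invariantForms_eval_mem l.2⟩
      map_add' _ _ := rfl
      map_smul' _ _ := rfl
      invFun F := ⟨_, symForm_mem F.2⟩
      left_inv l := Subtype.ext (symCube_groupAlgebra_hom_ext fun v =>
        symForm_single _ (mem_invariantFunctions_iff.1 (invariantForms_eval_mem l.2)).1 v)
      right_inv F := Subtype.ext (funext fun v =>
        symForm_single _ (mem_invariantFunctions_iff.1 F.2).1 v) }

end GroupAlgebra

/-! ### The augmentation ideal -/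

section AugmentationIdeal

theorem comp_subtype_mem {G : Type} [Group G] {l : Module.Dual ℂ (Sym[ℂ]^3 (MonoidAlgebra ℂ G))}
    (hl : l ∈ invariantForms (biregular G) (inversion G)) :
    l ∘ₗ symCubeMap (kerAug G).subtype ∈ invariantForms (kerAugRep G) (kerAugInversion G) := by
  refine ⟨fun a => ?_, ?_⟩
  · have e : (kerAug G).subtype ∘ₗ kerAugRep G a = biregular G a ∘ₗ (kerAug G).subtype := rfl
    rw [LinearMap.comp_assoc, ← symCubeMap_comp, e, symCubeMap_comp, ← LinearMap.comp_assoc, hl.1]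
  · have e : (kerAug G).subtype ∘ₗ kerAugInversion G = inversion G ∘ₗ (kerAug G).subtype := rfl
    rw [LinearMap.comp_assoc, ← symCubeMap_comp, e, symCubeMap_comp, ← LinearMap.comp_assoc, hl.2]

/-- The sum of the group elements. -/
noncomputable def normElement (G : Type) [Fintype G] : MonoidAlgebra ℂ G :=
  ∑ g : G, MonoidAlgebra.single g 1

/-- If `F` sums to zero in one variable then its linear form vanishes on all products with the sum
of the group elements. -/
theorem symForm_normElement {G : Type} [Fintype G] {F : (Fin 3 → G) → ℂ}
    (hF : ∀ (σ : Equiv.Perm (Fin 3)) v, F (fun i => v (σ i)) = F v)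
    (h0 : ∀ y z, ∑ x, F ![x, y, z] = 0) (v : Fin 3 → MonoidAlgebra ℂ G) (i : Fin 3)
    (hi : v i = normElement G) : symForm F hF (SymmetricPower.tprod ℂ v) = 0 := by
  -- By symmetry the norm element may be taken in the first place.
  wlog h : i = 0 generalizing v i
  · rw [← SymmetricPower.tprod_equiv (Equiv.swap 0 i)]
    exact this _ 0 (by simpa using hi) rfl
  subst h
  let M : MultilinearMap ℂ (fun _ : Fin 2 => MonoidAlgebra ℂ G) ℂ :=
    ((trilinear F).curryLeft (normElement G))
  have hM : M = 0 := Module.Basis.ext_multilinear (fun _ => MonoidAlgebra.basis G ℂ) fun w => by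
    change trilinear F (Fin.cons (normElement G) fun i => MonoidAlgebra.basis G ℂ (w i)) = 0
    rw [← h0 (w 0) (w 1)]
    change (trilinear F).curryLeft (normElement G) _ = _
    rw [normElement, map_sum, sum_apply]
    refine Finset.sum_congr rfl fun x _ => ?_
    rw [← trilinear_single F, MultilinearMap.curryLeft_apply]
    congr 1
    funext i
    fin_cases i <;> rfl
  rw [symForm, symCubeLift_tprod]
  have := congrFun (congrArg DFunLike.coe hM) (Fin.tail v)
  rw [← Fin.cons_self_tail v, hi]
  exact this

variable (G : Type) [Group G] [Fintype G]

/-- Summing an invariant function on `G³` over its first variable. -/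
noncomputable def contraction : invariantFunctions 3 G →ₗ[ℂ] invariantFunctions 2 G where
  toFun F := ⟨fun w => ∑ x, F.1 ![x, w 0, w 1], by
    obtain ⟨h₁, h₂, h₃⟩ := mem_invariantFunctions_iff.1 F.2
    refine mem_invariantFunctions_iff.2 ⟨fun σ w => ?_, fun g h w => ?_, fun w => ?_⟩
    · have hσ : ∀ σ : Equiv.Perm (Fin 2), σ = 1 ∨ σ = Equiv.swap 0 1 := by decide
      rcases hσ σ with rfl | rfl
      · rfl
      · refine Finset.sum_congr rfl fun x _ => ?_
        rw [← h₁ (Equiv.swap 1 2)]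
        refine congrArg F.1 (funext fun i => ?_)
        fin_cases i <;> simp [Equiv.swap_apply_of_ne_of_ne]
    · rw [← Equiv.sum_comp ((Equiv.mulLeft g).trans (Equiv.mulRight h⁻¹))]
      refine Finset.sum_congr rfl fun x _ => ?_
      rw [← h₂ g h ![x, w 0, w 1]]
      refine congrArg F.1 (funext fun i => ?_)
      fin_cases i <;> simp
    · rw [← Equiv.sum_comp (Equiv.inv G)]
      refine Finset.sum_congr rfl fun x _ => ?_
      rw [← h₃ ![x, w 0, w 1]]
      refine congrArg F.1 (funext fun i => ?_)
      fin_cases i <;> simp⟩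
  map_add' F F' := Subtype.ext (funext fun w => Finset.sum_add_distrib)
  map_smul' c F := Subtype.ext (funext fun w => (Finset.mul_sum _ _ _).symm)

theorem contraction_apply (F : invariantFunctions 3 G) (w : Fin 2 → G) :
    (contraction G F).1 w = ∑ x, F.1 ![x, w 0, w 1] := rfl

/-- A preimage of `f` is, up to scaling and an additive constant,
`(x, y, z) ↦ f (x, y) + f (x, z) + f (y, z)`; the sums of `f` over one variable are constant
because `G` acts transitively on itself. -/
theorem contraction_surjective : Function.Surjective (contraction G) := by
  classical
  intro f
  obtain ⟨h₁, h₂, h₃⟩ := mem_invariantFunctions_iff.1 f.2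
  have hsymm : ∀ x y, f.1 ![x, y] = f.1 ![y, x] := fun x y => by
    rw [← h₁ (Equiv.swap 0 1)]
    refine congrArg f.1 (funext fun i => ?_)
    fin_cases i <;> simp
  have hconst : ∀ y, ∑ x, f.1 ![x, y] = ∑ x, f.1 ![x, 1] := fun y => by
    rw [← Equiv.sum_comp (Equiv.mulLeft y)]
    refine Finset.sum_congr rfl fun x _ => ?_
    rw [← h₂ y 1 ![x, 1]]
    refine congrArg f.1 (funext fun i => ?_)
    fin_cases i <;> simp
  have hn : (Fintype.card G : ℂ) ≠ 0 := Nat.cast_ne_zero.2 Fintype.card_ne_zero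
  set s := ∑ x, f.1 ![x, 1] with hs
  -- Every unordered pair of indices occurs twice, whence the factor `2` in `hp`.
  let p : (Fin 3 → G) → ℂ := fun v =>
    ∑ i, ∑ j, if i = j then 0 else f.1 ![v i, v j]
  have hp : ∀ x y z, p ![x, y, z] = 2 * (f.1 ![x, y] + f.1 ![x, z] + f.1 ![y, z]) := by
    intro x y z
    simp only [p, Fin.sum_univ_three]
    simp [hsymm y x, hsymm z x, hsymm z y]
    ring
  refine ⟨⟨fun v => (2 * Fintype.card G : ℂ)⁻¹ * p v - 2 * s / (Fintype.card G) ^ 2, ?_⟩, ?_⟩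
  · refine mem_invariantFunctions_iff.2 ⟨fun σ v => ?_, fun g h v => ?_, fun v => ?_⟩
    · have : p (fun i => v (σ i)) = p v := by
        simp only [p]
        rw [← Equiv.sum_comp σ fun i => ∑ j, if i = j then 0 else f.1 ![v i, v j]]
        refine Finset.sum_congr rfl fun i _ => ?_
        rw [← Equiv.sum_comp σ fun j => if σ i = j then 0 else f.1 ![v (σ i), v j]]
        simp
      simp only [this]
    · have : p (fun i => g * v i * h⁻¹) = p v := by
        simp only [p]
        refine Finset.sum_congr rfl fun i _ => Finset.sum_congr rfl fun j _ => ?_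
        rw [← h₂ g h ![v i, v j]]
        congr 1
        refine congrArg f.1 (funext fun i => ?_)
        fin_cases i <;> simp
      simp only [this]
    · have : p (fun i => (v i)⁻¹) = p v := by
        simp only [p]
        refine Finset.sum_congr rfl fun i _ => Finset.sum_congr rfl fun j _ => ?_
        rw [← h₃ ![v i, v j]]
        congr 1
        refine congrArg f.1 (funext fun i => ?_)
        fin_cases i <;> simp
      simp only [this]
  · refine Subtype.ext (funext fun w => ?_)
    rw [contraction_apply]
    simp only [hp]
    rw [Finset.sum_sub_distrib, ← Finset.mul_sum, ← Finset.mul_sum, Finset.sum_add_distrib,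
      Finset.sum_add_distrib, hconst, hconst]
    have hw : ![w 0, w 1] = w := by
      funext i
      fin_cases i <;> rfl
    simp only [hw, Finset.sum_const, Finset.card_univ, nsmul_eq_mul]
    field_simp
    ring

theorem augmentation_normElement : augmentation G (normElement G) = Fintype.card G := by
  simp [normElement, augmentation_single]

theorem biregular_normElement (a : G × G) : biregular G a (normElement G) = normElement G := by
  obtain ⟨g, h⟩ := a
  simp only [normElement, map_sum, biregular_single]
  exact Equiv.sum_comp ((Equiv.mulLeft g).trans (Equiv.mulRight h⁻¹))
    fun x => (MonoidAlgebra.single x 1 : MonoidAlgebra ℂ G)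

theorem inversion_normElement : inversion G (normElement G) = normElement G := by
  simp only [normElement, map_sum, inversion_single]
  exact Equiv.sum_comp (Equiv.inv G) fun x => (MonoidAlgebra.single x 1 : MonoidAlgebra ℂ G)

theorem sub_normElement_mem (x : MonoidAlgebra ℂ G) :
    x - ((Fintype.card G : ℂ)⁻¹ * augmentation G x) • normElement G ∈ kerAug G := by
  have hn : (Fintype.card G : ℂ) ≠ 0 := Nat.cast_ne_zero.2 Fintype.card_ne_zero
  change augmentation G _ = 0
  rw [map_sub, map_smul, augmentation_normElement, smul_eq_mul]
  field_simp
  ring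

/-- The projection of `ℂG` onto `Ker ε` along the line spanned by the sum of the group elements. -/
noncomputable def augProj : MonoidAlgebra ℂ G →ₗ[ℂ] kerAug G where
  toFun x := ⟨_, sub_normElement_mem G x⟩
  map_add' x y := Subtype.ext (by
    simp only [map_add, mul_add, add_smul, Submodule.coe_add]
    abel)
  map_smul' c x := Subtype.ext (by
    simp only [map_smul, smul_eq_mul, RingHom.id_apply, Submodule.coe_smul, smul_sub, smul_smul]
    congr 2
    ring)

theorem coe_augProj (x : MonoidAlgebra ℂ G) : (augProj G x : MonoidAlgebra ℂ G) =
    x - ((Fintype.card G : ℂ)⁻¹ * augmentation G x) • normElement G := rfl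

theorem augProj_coe (x : kerAug G) : augProj G x = x := by
  refine Subtype.ext ?_
  rw [coe_augProj, show augmentation G (x : MonoidAlgebra ℂ G) = 0 from x.2]
  simp

theorem augProj_biregular (a : G × G) (x : MonoidAlgebra ℂ G) :
    augProj G (biregular G a x) = kerAugRep G a (augProj G x) := by
  refine Subtype.ext ?_
  change _ = biregular G a (augProj G x)
  rw [coe_augProj, coe_augProj, map_sub, map_smul, biregular_normElement, augmentation_biregular]

theorem augProj_inversion (x : MonoidAlgebra ℂ G) :
    augProj G (inversion G x) = kerAugInversion G (augProj G x) := by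
  refine Subtype.ext ?_
  change _ = inversion G (augProj G x)
  rw [coe_augProj, coe_augProj, map_sub, map_smul, inversion_normElement, augmentation_inversion]

theorem augProj_normElement : augProj G (normElement G) = 0 := by
  have hn : (Fintype.card G : ℂ) ≠ 0 := Nat.cast_ne_zero.2 Fintype.card_ne_zero
  refine Subtype.ext ?_
  rw [coe_augProj, augmentation_normElement, inv_mul_cancel₀ hn]
  simp

variable {G}

theorem comp_augProj_mem {l : Module.Dual ℂ (Sym[ℂ]^3 (kerAug G))}
    (hl : l ∈ invariantForms (kerAugRep G) (kerAugInversion G)) :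
    l ∘ₗ symCubeMap (augProj G) ∈ invariantForms (biregular G) (inversion G) := by
  refine ⟨fun a => ?_, ?_⟩
  · have e : augProj G ∘ₗ biregular G a = kerAugRep G a ∘ₗ augProj G :=
      LinearMap.ext (augProj_biregular G a)
    rw [LinearMap.comp_assoc, ← symCubeMap_comp, e, symCubeMap_comp, ← LinearMap.comp_assoc, hl.1]
  · have e : augProj G ∘ₗ inversion G = kerAugInversion G ∘ₗ augProj G :=
      LinearMap.ext (augProj_inversion G)
    rw [LinearMap.comp_assoc, ← symCubeMap_comp, e, symCubeMap_comp, ← LinearMap.comp_assoc, hl.2]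

/-- If `F` sums to zero in one variable then its linear form factors through `augProj`. -/
theorem symForm_augProj {F : (Fin 3 → G) → ℂ}
    (hF : ∀ (σ : Equiv.Perm (Fin 3)) v, F (fun i => v (σ i)) = F v)
    (h0 : ∀ y z, ∑ x, F ![x, y, z] = 0) (v : Fin 3 → MonoidAlgebra ℂ G) :
    symForm F hF (SymmetricPower.tprod ℂ fun i => (augProj G (v i) : MonoidAlgebra ℂ G)) =
      symForm F hF (SymmetricPower.tprod ℂ v) := by
  have step : ∀ (w : Fin 3 → MonoidAlgebra ℂ G) i, symForm F hF (SymmetricPower.tprod ℂ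
      (Function.update w i (augProj G (w i)))) = symForm F hF (SymmetricPower.tprod ℂ w) := by
    intro w i
    rw [coe_augProj, MultilinearMap.map_update_sub, map_sub, Function.update_eq_self,
      MultilinearMap.map_update_smul, map_smul,
      symForm_normElement hF h0 _ i (Function.update_self i _ w)]
    simp
  refine Eq.trans ?_ ((step _ 2).trans ((step _ 1).trans (step v 0)))
  congr 2
  funext i
  fin_cases i <;> simp

/-- Pulling back along `augProj` identifies the invariant linear forms on `Sym³ (Ker ε)` with the
kernel of `contraction`. -/
theorem finrank_AThetaKer_add :
    Module.finrank ℂ (AThetaKer G) + Module.finrank ℂ (invariantFunctions 2 G) =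
      Module.finrank ℂ (invariantFunctions 3 G) := by
  rw [AThetaKer, finrank_AThetaOdd, ← (contraction G).finrank_range_add_finrank_ker,
    LinearMap.range_eq_top.2 (contraction_surjective G), finrank_top, add_comm]
  congr 1
  have hker : ∀ F : invariantFunctions 3 G, F ∈ LinearMap.ker (contraction G) ↔
      ∀ y z, ∑ x, F.1 ![x, y, z] = 0 := by
    intro F
    rw [LinearMap.mem_ker, Subtype.ext_iff, funext_iff]
    exact ⟨fun h y z => h ![y, z], fun h w => h (w 0) (w 1)⟩
  refine LinearEquiv.finrank_eq
    { toFun l := ⟨⟨_, invariantForms_eval_mem (comp_augProj_mem l.2)⟩, (hker _).2 fun y z => ?_⟩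
      map_add' _ _ := rfl
      map_smul' _ _ := rfl
      invFun F := ⟨_, comp_subtype_mem (symForm_mem F.1.2)⟩
      left_inv l := Subtype.ext ?_
      right_inv F := Subtype.ext (Subtype.ext (funext fun v => ?_)) }
  · let M : MultilinearMap ℂ (fun _ : Fin 3 => MonoidAlgebra ℂ G) ℂ :=
      (l.1 ∘ₗ symCubeMap (augProj G)).compMultilinearMap (SymmetricPower.tprod ℂ)
    have hM : ∀ x, M.curryLeft (MonoidAlgebra.single x 1)
        ![MonoidAlgebra.single y 1, MonoidAlgebra.single z 1] =
        M fun i => MonoidAlgebra.single (![x, y, z] i) 1 := fun x => by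
      rw [MultilinearMap.curryLeft_apply]
      congr 1
      funext i
      fin_cases i <;> rfl
    change ∑ x, M (fun i => MonoidAlgebra.single (![x, y, z] i) 1) = 0
    simp only [← hM]
    rw [← sum_apply, ← map_sum]
    change M (Fin.cons (normElement G) _) = 0
    change l.1 (symCubeMap (augProj G) (SymmetricPower.tprod ℂ _)) = 0
    rw [symCubeMap_tprod, (SymmetricPower.tprod ℂ).map_coord_zero 0, map_zero]
    exact augProj_normElement G
  · have e : l.1 ∘ₗ symCubeMap (augProj G) ∘ₗ symCubeMap (kerAug G).subtype = l.1 := by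
      rw [← symCubeMap_comp, show augProj G ∘ₗ (kerAug G).subtype = LinearMap.id from
        LinearMap.ext (augProj_coe G), symCubeMap_id, LinearMap.comp_id]
    have h := (mem_invariantFunctions_iff.1 (invariantForms_eval_mem (comp_augProj_mem l.2))).1
    have e' : symForm _ h = l.1 ∘ₗ symCubeMap (augProj G) :=
      symCube_groupAlgebra_hom_ext fun v => symForm_single _ h v
    exact (congrArg (· ∘ₗ symCubeMap (kerAug G).subtype) e').trans e
  · obtain ⟨F, hF⟩ := F
    rw [hker] at hF
    have h := (mem_invariantFunctions_iff.1 F.2).1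
    change symForm F.1 h (symCubeMap (kerAug G).subtype (symCubeMap (augProj G)
      (SymmetricPower.tprod ℂ fun i => MonoidAlgebra.single (v i) 1))) = F.1 v
    rw [symCubeMap_tprod, symCubeMap_tprod]
    exact (symForm_augProj h hF _).trans (symForm_single _ h v)

end AugmentationIdeal

variable {G : Type} [Group G]

theorem hasThetaDims_of_counts [Finite G] {n A B C D E P Q : ℕ} (hn : Nat.card G = n)
    (hA : commTriples G = A) (hB : commSquarePairs G = B) (hC : cubePairs G = C)
    (hD : squareTriples G = D) (hE : squareCubePairs G = E) (hP : commPairs G = P)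
    (hQ : squarePairs G = Q) :
    HasThetaDims G ((A + 6 * B + 2 * C + D + 2 * E : ℚ) / (12 * n))
      ((A + 6 * B + 2 * C + D + 2 * E : ℚ) / (12 * n) - (P + Q : ℚ) / (2 * n)) := by
  have := Fintype.ofFinite G
  have h0 : (n : ℚ) ≠ 0 := by
    rw [← hn]
    exact Nat.cast_ne_zero.2 Nat.card_pos.ne'
  have h3 := congrArg (Nat.cast (R := ℚ)) (twelve_mul_finrank_invariantFunctions_three G)
  have h2 := congrArg (Nat.cast (R := ℚ)) (two_mul_finrank_invariantFunctions_two G)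
  have hk := congrArg (Nat.cast (R := ℚ)) (finrank_AThetaKer_add (G := G))
  rw [hn, hA, hB, hC, hD, hE] at h3
  rw [hn, hP, hQ] at h2
  push_cast at h2 h3 hk
  have h3' : (Module.finrank ℂ (invariantFunctions 3 G) : ℚ) =
      (A + 6 * B + 2 * C + D + 2 * E : ℚ) / (12 * n) := by
    rw [← h3]; field_simp
  have h2' : (Module.finrank ℂ (invariantFunctions 2 G) : ℚ) = (P + Q : ℚ) / (2 * n) := by
    rw [← h2]; field_simp
  refine ⟨⟨inferInstance, ?_⟩, ⟨inferInstance, ?_⟩⟩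
  · rw [finrank_AThetaGroupAlgebra, h3']
  · rw [← h3', ← h2', ← hk, add_sub_cancel_right]

/-! ### Cardinalities of sets of pairs and triples -/

section CardProd
variable {G H : Type}

theorem card_pairs_congr (e : G ≃ H) {R : G × G → Prop} {S : H × H → Prop}
    (h : ∀ x, R x ↔ S (e x.1, e x.2)) : Nat.card {x // R x} = Nat.card {x // S x} :=
  Nat.card_congr (Equiv.subtypeEquiv (e.prodCongr e) h)

theorem card_triples_congr (e : G ≃ H) {R : G × G × G → Prop} {S : H × H × H → Prop}
    (h : ∀ x, R x ↔ S (e x.1, e x.2.1, e x.2.2)) : Nat.card {x // R x} = Nat.card {x // S x} :=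
  Nat.card_congr (Equiv.subtypeEquiv (e.prodCongr (e.prodCongr e)) h)

theorem card_pairs_prod {R : G × G → Prop} {S : H × H → Prop} {U : (G × H) × (G × H) → Prop}
    (h : ∀ x, U x ↔ R (x.1.1, x.2.1) ∧ S (x.1.2, x.2.2)) :
    Nat.card {x // U x} = Nat.card {x // R x} * Nat.card {x // S x} := by
  rw [← Nat.card_prod, Nat.card_congr (Equiv.prodSubtypeFstEquivSubtypeProd
    (p := R) (β := {x // S x})).symm]
  exact Nat.card_congr
    { toFun x := ⟨((x.1.1.1, x.1.2.1), ⟨(x.1.1.2, x.1.2.2), ((h _).1 x.2).2⟩), ((h _).1 x.2).1⟩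
      invFun y := ⟨((y.1.1.1, y.1.2.1.1), (y.1.1.2, y.1.2.1.2)), (h _).2 ⟨y.2, y.1.2.2⟩⟩
      left_inv _ := rfl
      right_inv _ := rfl }

theorem card_triples_prod {R : G × G × G → Prop} {S : H × H × H → Prop}
    {U : (G × H) × (G × H) × (G × H) → Prop}
    (h : ∀ x, U x ↔ R (x.1.1, x.2.1.1, x.2.2.1) ∧ S (x.1.2, x.2.1.2, x.2.2.2)) :
    Nat.card {x // U x} = Nat.card {x // R x} * Nat.card {x // S x} := by
  rw [← Nat.card_prod]
  exact Nat.card_congr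
    { toFun x := (⟨_, ((h _).1 x.2).1⟩, ⟨_, ((h _).1 x.2).2⟩)
      invFun y := ⟨((y.1.1.1, y.2.1.1), (y.1.1.2.1, y.2.1.2.1), (y.1.1.2.2, y.2.1.2.2)),
        (h _).2 ⟨y.1.2, y.2.2⟩⟩
      left_inv _ := rfl
      right_inv _ := rfl }

theorem card_pairs_eq_sum [Fintype G] (R : G → G → Prop) :
    Nat.card {x : G × G // R x.1 x.2} = ∑ x, Nat.card {y // R x y} := by
  have e : {x : G × G // R x.1 x.2} ≃ Σ x : G, {y // R x y} :=
    { toFun x := ⟨x.1.1, x.1.2, x.2⟩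
      invFun y := ⟨(y.1, y.2.1), y.2.2⟩
      left_inv _ := rfl
      right_inv _ := rfl }
  rw [Nat.card_congr e, Nat.card_sigma]

theorem card_triples_eq_sum [Fintype G] (R : G → G → Prop) :
    Nat.card {x : G × G × G // R x.1 x.2.1 ∧ R x.1 x.2.2} = ∑ x, Nat.card {y // R x y} ^ 2 := by
  have e : {x : G × G × G // R x.1 x.2.1 ∧ R x.1 x.2.2} ≃
      Σ x : G, {y // R x y} × {y // R x y} :=
    { toFun x := ⟨x.1.1, ⟨x.1.2.1, x.2.1⟩, ⟨x.1.2.2, x.2.2⟩⟩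
      invFun y := ⟨(y.1, y.2.1.1, y.2.2.1), y.2.1.2, y.2.2.2⟩
      left_inv _ := rfl
      right_inv _ := rfl }
  rw [Nat.card_congr e, Nat.card_sigma]
  exact Finset.sum_congr rfl fun x _ => by rw [Nat.card_prod, sq]

end CardProd

/-- The order of `G` is `n`, and the numbers of solutions of the equations in Burnside's formulas
are `A`, `B`, `C`, `D`, `E` (triples) and `P`, `Q` (pairs). -/
structure HasCounts (G : Type) [Group G] (n A B C D E P Q : ℕ) : Prop where
  card : Nat.card G = n
  commTriples : commTriples G = A
  commSquarePairs : commSquarePairs G = B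
  cubePairs : cubePairs G = C
  squareTriples : squareTriples G = D
  squareCubePairs : squareCubePairs G = E
  commPairs : commPairs G = P
  squarePairs : squarePairs G = Q

namespace HasCounts

variable {G H : Type} [Group G] [Group H] {n A B C D E P Q n' A' B' C' D' E' P' Q' : ℕ}

theorem congr (h : HasCounts G n A B C D E P Q) (e : G ≃* H) :
    HasCounts H n A B C D E P Q where
  card := (Nat.card_congr e.toEquiv).symm.trans h.card
  commTriples := (card_triples_congr e.toEquiv fun x => by
    simp [commute_iff_eq, ← map_mul]).symm.trans h.commTriples
  commSquarePairs := (card_pairs_congr e.toEquiv fun x => by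
    simp [commute_iff_eq, ← map_mul, ← map_pow]).symm.trans h.commSquarePairs
  cubePairs := (card_pairs_congr e.toEquiv fun x => by simp [← map_pow]).symm.trans h.cubePairs
  squareTriples := (card_triples_congr e.toEquiv fun x => by simp [← map_pow]).symm.trans
    h.squareTriples
  squareCubePairs := (card_pairs_congr e.toEquiv fun x => by simp [← map_pow]).symm.trans
    h.squareCubePairs
  commPairs := (card_pairs_congr e.toEquiv fun x => by simp [commute_iff_eq, ← map_mul]).symm.trans
    h.commPairs
  squarePairs := (card_pairs_congr e.toEquiv fun x => by simp [← map_pow]).symm.trans h.squarePairs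

theorem prod (h : HasCounts G n A B C D E P Q) (h' : HasCounts H n' A' B' C' D' E' P' Q') :
    HasCounts (G × H) (n * n') (A * A') (B * B') (C * C') (D * D') (E * E') (P * P') (Q * Q') where
  card := by rw [Nat.card_prod, h.card, h'.card]
  commTriples := by
    rw [← h.commTriples, ← h'.commTriples]
    exact card_triples_prod fun x => by
      simp only [commute_iff_eq, Prod.ext_iff, Prod.fst_mul, Prod.snd_mul]
      tauto
  commSquarePairs := by
    rw [← h.commSquarePairs, ← h'.commSquarePairs]
    exact card_pairs_prod fun x => by simp [commute_iff_eq, Prod.ext_iff]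
  cubePairs := by
    rw [← h.cubePairs, ← h'.cubePairs]
    exact card_pairs_prod fun x => by simp [Prod.ext_iff]
  squareTriples := by
    rw [← h.squareTriples, ← h'.squareTriples]
    exact card_triples_prod fun x => by
      simp only [Prod.ext_iff, Prod.pow_fst, Prod.pow_snd]
      tauto
  squareCubePairs := by
    rw [← h.squareCubePairs, ← h'.squareCubePairs]
    exact card_pairs_prod fun x => by simp [Prod.ext_iff]
  commPairs := by
    rw [← h.commPairs, ← h'.commPairs]
    exact card_pairs_prod fun x => by simp [commute_iff_eq, Prod.ext_iff]
  squarePairs := by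
    rw [← h.squarePairs, ← h'.squarePairs]
    exact card_pairs_prod fun x => by simp [Prod.ext_iff]

theorem hasThetaDims [Finite G] (h : HasCounts G n A B C D E P Q) {d d' : ℚ}
    (hd : (A + 6 * B + 2 * C + D + 2 * E : ℚ) = 12 * n * d)
    (hd' : (P + Q : ℚ) = 2 * n * (d - d')) : HasThetaDims G d d' := by
  have h0 : (n : ℚ) ≠ 0 := by
    rw [← h.card]
    exact Nat.cast_ne_zero.2 Nat.card_pos.ne'
  have key := hasThetaDims_of_counts h.card h.commTriples h.commSquarePairs h.cubePairs
    h.squareTriples h.squareCubePairs h.commPairs h.squarePairs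
  have e₁ : (A + 6 * B + 2 * C + D + 2 * E : ℚ) / (12 * n) = d := by
    rw [hd]; field_simp
  have e₂ : (P + Q : ℚ) / (2 * n) = d - d' := by
    rw [hd']; field_simp
  rwa [e₁, e₂, sub_sub_cancel] at key

end HasCounts

/-! ### Commutative and cyclic groups -/

section Comm

theorem mul_inv_sq_cube {Z : Type} [CommGroup Z] {u k : Z} (h : u ^ 2 = k ^ 3) :
    (u * k⁻¹) ^ 3 = u := by
  rw [mul_pow, pow_succ', h, inv_pow, mul_assoc, mul_inv_cancel, mul_one]

theorem mul_inv_sq_sq {Z : Type} [CommGroup Z] {u k : Z} (h : u ^ 2 = k ^ 3) :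
    (u * k⁻¹) ^ 2 = k := by
  rw [mul_pow, h, inv_pow, ← div_eq_mul_inv, pow_succ, mul_div_cancel_left]

theorem pow_three_mul_inv_sq {Z : Type} [CommGroup Z] (t : Z) : t ^ 3 * (t ^ 2)⁻¹ = t := by
  rw [pow_succ, mul_comm, inv_mul_cancel_left]

variable (Z : Type) [CommGroup Z]

/-- In a commutative group, a pair `(u, v)` with `u ^ k = v ^ k` is given by `u` and the quotient
`u⁻¹ v`, an element of the `k`-torsion. -/
def powPairsEquiv (k : ℕ) :
    {x : Z × Z // x.1 ^ k = x.2 ^ k} ≃ Z × (powMonoidHom k : Z →* Z).ker where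
  toFun x := (x.1.1, ⟨x.1.1⁻¹ * x.1.2, by
    rw [MonoidHom.mem_ker, powMonoidHom_apply, mul_pow, inv_pow, x.2, inv_mul_cancel]⟩)
  invFun y := ⟨(y.1, y.1 * y.2), by
    have := y.2.2
    rw [MonoidHom.mem_ker, powMonoidHom_apply] at this
    rw [mul_pow, this, mul_one]⟩
  left_inv x := by simp
  right_inv y := by simp

/-- In a commutative group, the solutions of `u² = v³` are the pairs `(t³, t²)`. -/
def squareCubeEquiv : {x : Z × Z // x.1 ^ 2 = x.2 ^ 3} ≃ Z where
  toFun x := x.1.1 * x.1.2⁻¹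
  invFun t := ⟨(t ^ 3, t ^ 2), by rw [← pow_mul, ← pow_mul]⟩
  left_inv x := Subtype.ext (Prod.ext (mul_inv_sq_cube x.2) (mul_inv_sq_sq x.2))
  right_inv t := pow_three_mul_inv_sq t

/-- In a commutative group, a triple with equal squares is given by its first entry and two
elements of the `2`-torsion. -/
def squareTriplesEquiv : {x : Z × Z × Z // x.1 ^ 2 = x.2.1 ^ 2 ∧ x.1 ^ 2 = x.2.2 ^ 2} ≃
    Z × (powMonoidHom 2 : Z →* Z).ker × (powMonoidHom 2 : Z →* Z).ker where
  toFun x := (x.1.1, ⟨x.1.1⁻¹ * x.1.2.1, by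
    rw [MonoidHom.mem_ker, powMonoidHom_apply, mul_pow, inv_pow, x.2.1, inv_mul_cancel]⟩,
    ⟨x.1.1⁻¹ * x.1.2.2, by
    rw [MonoidHom.mem_ker, powMonoidHom_apply, mul_pow, inv_pow, x.2.2, inv_mul_cancel]⟩)
  invFun y := ⟨(y.1, y.1 * y.2.1, y.1 * y.2.2), by
    have h := y.2.1.2
    have h' := y.2.2.2
    rw [MonoidHom.mem_ker, powMonoidHom_apply] at h h'
    rw [mul_pow, mul_pow, h, h', mul_one]
    exact ⟨rfl, rfl⟩⟩
  left_inv x := by simp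
  right_inv y := by simp

theorem hasCounts_comm {n c₂ c₃ : ℕ} (hn : Nat.card Z = n)
    (h₂ : Nat.card (powMonoidHom 2 : Z →* Z).ker = c₂)
    (h₃ : Nat.card (powMonoidHom 3 : Z →* Z).ker = c₃) :
    HasCounts Z n (n * (n * n)) (n * n) (n * c₃) (n * (c₂ * c₂)) n (n * n) (n * c₂) where
  card := hn
  commTriples := by
    rw [← hn, ← Nat.card_prod, ← Nat.card_prod]
    exact Nat.card_congr (Equiv.subtypeUnivEquiv fun x => ⟨Commute.all _ _, Commute.all _ _⟩)
  commSquarePairs := by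
    rw [← hn, ← Nat.card_prod]
    exact Nat.card_congr (Equiv.subtypeUnivEquiv fun x => Commute.all _ _)
  cubePairs := by
    rw [← hn, ← h₃, ← Nat.card_prod]
    exact Nat.card_congr (powPairsEquiv Z 3)
  squareTriples := by
    rw [← hn, ← h₂, ← Nat.card_prod, ← Nat.card_prod]
    exact Nat.card_congr (squareTriplesEquiv Z)
  squareCubePairs := by
    rw [← hn]
    exact Nat.card_congr (squareCubeEquiv Z)
  commPairs := by
    rw [← hn, ← Nat.card_prod]
    exact Nat.card_congr (Equiv.subtypeUnivEquiv fun x => Commute.all _ _)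
  squarePairs := by
    rw [← hn, ← h₂, ← Nat.card_prod]
    exact Nat.card_congr (powPairsEquiv Z 2)

end Comm

theorem card_cyc (n : ℕ) : Nat.card (Cyc n) = n := by
  rw [Nat.card_congr Multiplicative.toAdd, Nat.card_zmod]

theorem finite_cyc {n : ℕ} (hn : n ≠ 0) : Finite (Cyc n) :=
  have := NeZero.mk hn
  inferInstance

theorem card_pow_ker_cyc {n : ℕ} (hn : n ≠ 0) (k : ℕ) :
    Nat.card (powMonoidHom k : Cyc n →* Cyc n).ker = n.gcd k := by
  have := finite_cyc hn
  rw [IsCyclic.card_powMonoidHom_ker, card_cyc]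

theorem hasCounts_cyc {n : ℕ} (hn : n ≠ 0) :
    HasCounts (Cyc n) n (n * (n * n)) (n * n) (n * n.gcd 3) (n * (n.gcd 2 * n.gcd 2)) n (n * n)
      (n * n.gcd 2) :=
  hasCounts_comm (Cyc n) (card_cyc n) (card_pow_ker_cyc hn 2) (card_pow_ker_cyc hn 3)

/-! ### Partitions into at most three parts -/

theorem p3_of_neg {m : ℤ} (hm : m < 0) : p3 m = 0 := by
  have : {t : ℤ × ℤ × ℤ | 0 ≤ t.1 ∧ t.1 ≤ t.2.1 ∧ t.2.1 ≤ t.2.2 ∧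
      t.1 + t.2.1 + t.2.2 = m} = ∅ :=
    Set.eq_empty_of_forall_notMem fun t ht => by
      obtain ⟨h₁, h₂, h₃, h₄⟩ := ht
      omega
  rw [p3, this, Set.ncard_empty]

/-- Either the smallest part is zero, or `1` can be subtracted from each part. -/
theorem p3_eq_add (n : ℕ) : p3 n = p3 ((n : ℤ) - 3) + (n / 2 + 1) := by
  let S : ℤ → Set (ℤ × ℤ × ℤ) := fun m => {t | 0 ≤ t.1 ∧ t.1 ≤ t.2.1 ∧ t.2.1 ≤ t.2.2 ∧
    t.1 + t.2.1 + t.2.2 = m}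
  have hfin : ∀ m, (S m).Finite := fun m => by
    refine ((Set.finite_Icc 0 m).prod ((Set.finite_Icc 0 m).prod (Set.finite_Icc 0 m))).subset ?_
    rintro ⟨x, y, z⟩ ⟨h₁, h₂, h₃, h₄⟩
    simp only at h₁ h₂ h₃ h₄
    simp only [Set.mem_prod, Set.mem_Icc]
    omega
  -- `f` adds `1` to each part; `g` lists the solutions with smallest part `0`.
  let f : ℤ × ℤ × ℤ → ℤ × ℤ × ℤ := fun t => (t.1 + 1, t.2.1 + 1, t.2.2 + 1)
  let g : ℕ → ℤ × ℤ × ℤ := fun y => (0, (y : ℤ), n - y)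
  have hf : Function.Injective f := by
    rintro ⟨x, y, z⟩ ⟨x', y', z'⟩ h
    simp only [f, Prod.mk.injEq] at h ⊢
    omega
  have hg : Function.Injective g := by
    intro y y' h
    simp only [g, Prod.mk.injEq] at h
    omega
  have hS : S n = f '' S ((n : ℤ) - 3) ∪ g '' (Finset.range (n / 2 + 1) : Set ℕ) := by
    ext ⟨x, y, z⟩
    constructor
    · rintro ⟨h₁, h₂, h₃, h₄⟩
      simp only at h₁ h₂ h₃ h₄
      by_cases hx : x = 0
      · refine Or.inr ⟨y.toNat, ?_, ?_⟩
        · simp only [Finset.coe_range, Set.mem_Iio]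
          omega
        · simp only [g, Prod.mk.injEq]
          omega
      · refine Or.inl ⟨(x - 1, y - 1, z - 1), ⟨?_, ?_, ?_, ?_⟩, ?_⟩ <;> simp [f] <;> omega
    · rintro (⟨⟨x', y', z'⟩, ⟨h₁, h₂, h₃, h₄⟩, h⟩ | ⟨k, hk, h⟩)
      · simp only at h₁ h₂ h₃ h₄
        simp only [f, Prod.mk.injEq] at h
        refine ⟨?_, ?_, ?_, ?_⟩ <;> simp only <;> omega
      · simp only [Finset.coe_range, Set.mem_Iio] at hk
        simp only [g, Prod.mk.injEq] at h
        refine ⟨?_, ?_, ?_, ?_⟩ <;> simp only <;> omega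
  have hdisj : Disjoint (f '' S ((n : ℤ) - 3)) (g '' (Finset.range (n / 2 + 1) : Set ℕ)) := by
    rw [Set.disjoint_left]
    rintro _ ⟨⟨x, y, z⟩, ⟨h₁, -⟩, rfl⟩ ⟨k, -, h⟩
    simp only [f, g, Prod.mk.injEq] at h
    simp only at h₁
    omega
  change (S n).ncard = (S ((n : ℤ) - 3)).ncard + _
  rw [hS, Set.ncard_union_eq hdisj ((hfin _).image _) ((Finset.finite_toSet _).image _),
    Set.ncard_image_of_injective _ hf, Set.ncard_image_of_injective _ hg, Set.ncard_coe_finset,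
    Finset.card_range]

theorem twelve_mul_p3 (n : ℕ) :
    (12 * p3 n : ℤ) = n ^ 2 + 6 * n + 2 * n.gcd 3 + n.gcd 2 ^ 2 + 2 := by
  induction n using Nat.strong_induction_on with
  | _ n ih =>
    rw [p3_eq_add]
    have h2 : (n.gcd 2 : ℤ) ^ 2 = 4 - 3 * (n % 2 : ℕ) ∧
        (2 * (n / 2 : ℕ) : ℤ) = n - (n % 2 : ℕ) := by
      constructor
      · rcases Nat.mod_two_eq_zero_or_one n with h | h <;>
          rw [Nat.gcd_comm, Nat.gcd_rec, h] <;> simp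
      · omega
    by_cases hn : n < 3
    · rw [p3_of_neg (by omega)]
      interval_cases n <;> simp
    · obtain ⟨k, rfl⟩ := Nat.exists_eq_add_of_le (not_lt.1 hn)
      have e : ((3 + k : ℕ) : ℤ) - 3 = (k : ℕ) := by push_cast; ring
      have hk := ih k (by omega)
      have g3 : (3 + k).gcd 3 = k.gcd 3 := by simp
      have h2' : (k.gcd 2 : ℤ) ^ 2 = 4 - 3 * (k % 2 : ℕ) := by
        rcases Nat.mod_two_eq_zero_or_one k with h | h <;>
          rw [Nat.gcd_comm, Nat.gcd_rec, h] <;> simp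
      rw [e, g3]
      have hm : (((3 + k) % 2 : ℕ) : ℤ) = 1 - (k % 2 : ℕ) := by omega
      push_cast at *
      rw [h2.1, hm]
      rw [hm] at h2
      rw [h2'] at hk
      linarith [h2.2]

theorem gcd_prime_eq {q : ℕ} (hq : q.Prime) (n : ℕ) : n.gcd q = if q ∣ n then q else 1 := by
  split_ifs with h
  · exact Nat.gcd_eq_right h
  · exact (Nat.coprime_comm.1 ((Nat.Prime.coprime_iff_not_dvd hq).2 h))

theorem twelve_mul_p3_sub (n : ℕ) :
    (12 * p3 ((n : ℤ) - 3) : ℤ) = n ^ 2 + 2 * n.gcd 3 + n.gcd 2 ^ 2 - 6 * n.gcd 2 + 2 := by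
  have h := twelve_mul_p3 n
  rw [p3_eq_add] at h
  have h2 : (2 * (n / 2 + 1 : ℕ) : ℤ) = n + n.gcd 2 := by
    rw [gcd_prime_eq Nat.prime_two]
    split_ifs <;> omega
  push_cast at h h2
  linarith

theorem hasThetaDims_cyc {n : ℕ} (hn : 1 ≤ n) :
    HasThetaDims (Cyc n) (p3 n) (p3 ((n : ℤ) - 3)) := by
  have hn' : n ≠ 0 := Nat.one_le_iff_ne_zero.1 hn
  have := finite_cyc hn'
  have h := congrArg (Int.cast (R := ℚ)) (twelve_mul_p3 n)
  have h' := congrArg (Int.cast (R := ℚ)) (twelve_mul_p3_sub n)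
  push_cast at h h'
  refine (hasCounts_cyc hn').hasThetaDims ?_ ?_ <;> push_cast
  · linear_combination (-n : ℚ) * h
  · linear_combination (-(n : ℚ) / 6) * h + (n : ℚ) / 6 * h'

theorem p3_eq (n : ℕ) : (p3 n : ℚ) =
    (if 2 ∣ n ∧ 3 ∣ n then 1 / 12 * (n : ℚ) ^ 2 + 1 / 2 * n + 1
     else if 2 ∣ n ∧ ¬ 3 ∣ n then 1 / 12 * (n : ℚ) ^ 2 + 1 / 2 * n + 2 / 3
     else if ¬ 2 ∣ n ∧ 3 ∣ n then 1 / 12 * (n : ℚ) ^ 2 + 1 / 2 * n + 3 / 4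
     else 1 / 12 * (n : ℚ) ^ 2 + 1 / 2 * n + 5 / 12) := by
  have h := congrArg (Int.cast (R := ℚ)) (twelve_mul_p3 n)
  rw [gcd_prime_eq Nat.prime_two, gcd_prime_eq Nat.prime_three] at h
  by_cases h2 : 2 ∣ n <;> by_cases h3 : 3 ∣ n <;> simp only [h2, h3, if_true, if_false,
    not_true_eq_false, not_false_eq_true, and_true, and_false] at h ⊢ <;>
    push_cast at h <;> linarith

theorem p3_sub_eq (n : ℕ) : (p3 ((n : ℤ) - 3) : ℚ) =
    (if 2 ∣ n ∧ 3 ∣ n then 1 / 12 * (n : ℚ) ^ 2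
     else if 2 ∣ n ∧ ¬ 3 ∣ n then 1 / 12 * (n : ℚ) ^ 2 - 1 / 3
     else if ¬ 2 ∣ n ∧ 3 ∣ n then 1 / 12 * (n : ℚ) ^ 2 + 1 / 4
     else 1 / 12 * (n : ℚ) ^ 2 - 1 / 12) := by
  have h := congrArg (Int.cast (R := ℚ)) (twelve_mul_p3_sub n)
  rw [gcd_prime_eq Nat.prime_two, gcd_prime_eq Nat.prime_three] at h
  by_cases h2 : 2 ∣ n <;> by_cases h3 : 3 ∣ n <;> simp only [h2, h3, if_true, if_false,
    not_true_eq_false, not_false_eq_true, and_true, and_false] at h ⊢ <;>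
    push_cast at h <;> linarith

/-! ### Counting in an enumerated group -/

section Enumeration
variable {P C : Type}

/-- Summation over a group all of whose elements occur in the list `l`, with distinct codes. -/
theorem sum_enumeration [Fintype P] {κ : P → C} {l : List P} (hl : ∀ g, g ∈ l)
    (hn : (l.map κ).Nodup) (F : C → ℕ) : ∑ g : P, F (κ g) = ((l.map κ).map F).sum := by
  classical
  have h : (Finset.univ : Finset P) = l.toFinset := by
    ext g
    simp [hl]
  rw [h, List.sum_toFinset _ hn.of_map, List.map_map]
  rfl

theorem card_enumeration [Fintype P] {κ : P → C} {l : List P} (hl : ∀ g, g ∈ l)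
    (hn : (l.map κ).Nodup) (R : C → Bool) :
    Nat.card {g : P // R (κ g)} = (l.map κ).countP R := by
  classical
  rw [Nat.card_eq_fintype_card, Fintype.card_subtype, Finset.card_filter]
  refine (sum_enumeration hl hn fun c => if R c then 1 else 0).trans ?_
  generalize l.map κ = L
  induction L with
  | nil => rfl
  | cons c L ih => simp only [List.map_cons, List.sum_cons, ih, List.countP_cons]; ring

/-- The number of related pairs of entries of a list. -/
def pairCount (R : C → C → Bool) (L : List C) : ℕ := (L.map fun c => L.countP (R c)).sum

/-- The number of triples of entries of a list whose first entry is related to the other two. -/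
def tripleCount (R : C → C → Bool) (L : List C) : ℕ := (L.map fun c => L.countP (R c) ^ 2).sum

theorem card_pairs_enumeration {κ : P → C} {l : List P} (hl : ∀ g, g ∈ l)
    (hn : (l.map κ).Nodup) {R : C → C → Bool} {U : P × P → Prop}
    (h : ∀ x, U x ↔ R (κ x.1) (κ x.2)) :
    Nat.card {x // U x} = pairCount R (l.map κ) := by
  classical
  have : Finite P := Finite.of_finite_univ ((List.finite_toSet l).subset fun g _ => hl g)
  have := Fintype.ofFinite P
  rw [Nat.card_congr (Equiv.subtypeEquivRight h),
    card_pairs_eq_sum fun x y => R (κ x) (κ y) = true, pairCount, ← sum_enumeration hl hn]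
  exact Finset.sum_congr rfl fun x _ => card_enumeration hl hn _

theorem card_triples_enumeration {κ : P → C} {l : List P} (hl : ∀ g, g ∈ l)
    (hn : (l.map κ).Nodup) {R : C → C → Bool} {U : P × P × P → Prop}
    (h : ∀ x, U x ↔ R (κ x.1) (κ x.2.1) ∧ R (κ x.1) (κ x.2.2)) :
    Nat.card {x // U x} = tripleCount R (l.map κ) := by
  classical
  have : Finite P := Finite.of_finite_univ ((List.finite_toSet l).subset fun g _ => hl g)
  have := Fintype.ofFinite P
  rw [Nat.card_congr (Equiv.subtypeEquivRight h),
    card_triples_eq_sum fun x y => R (κ x) (κ y) = true, tripleCount, ← sum_enumeration hl hn]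
  exact Finset.sum_congr rfl fun x _ => by rw [card_enumeration hl hn]

/-- Boolean test that a list has no repeated entry, with respect to a given equality test. -/
def noDup (eqv : C → C → Bool) : List C → Bool
  | [] => true
  | c :: L => !L.any (eqv c) && noDup eqv L

theorem nodup_of_noDup {eqv : C → C → Bool} (heqv : ∀ c, eqv c c = true) {L : List C}
    (h : noDup eqv L = true) : L.Nodup := by
  induction L with
  | nil => exact List.nodup_nil
  | cons c L ih =>
    simp only [noDup, Bool.and_eq_true, Bool.not_eq_true', List.any_eq_false] at h
    exact List.nodup_cons.2 ⟨fun hc => h.1 c hc (heqv c), ih h.2⟩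

/-- The length of a list of codes and the counts of `HasCounts`, in terms of an equality test and a
multiplication of codes. A membership count over triples is the sum of the squares of the counts
over pairs, which keeps the evaluation quadratic. -/
def wordCounts (eqv : C → C → Bool) (mul : C → C → C) (L : List C) : List ℕ :=
  [L.length, tripleCount (fun c d => eqv (mul c d) (mul d c)) L,
    pairCount (fun c d => eqv (mul (mul c c) d) (mul d (mul c c))) L,
    pairCount (fun c d => eqv (mul c (mul c c)) (mul d (mul d d))) L,
    tripleCount (fun c d => eqv (mul c c) (mul d d)) L,
    pairCount (fun c d => eqv (mul c c) (mul d (mul d d))) L,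
    pairCount (fun c d => eqv (mul c d) (mul d c)) L,
    pairCount (fun c d => eqv (mul c c) (mul d d)) L]

/-- The counts of a group can be read off from any list of codes of its elements, provided that the
codes are multiplicative and that the codes in the list are distinct. -/
theorem hasCounts_of_enumeration [Group P] {eqv : C → C → Bool}
    (heqv : ∀ c d, eqv c d = true ↔ c = d) {mul : C → C → C} {κ : P → C}
    (hκ : ∀ x y, κ (x * y) = mul (κ x) (κ y)) {l : List P} (hl : ∀ g, g ∈ l)
    {L : List C} (hL : l.map κ = L) (hn : noDup eqv L = true) {n c₁ c₂ c₃ c₄ c₅ c₆ c₇ : ℕ}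
    (h : wordCounts eqv mul L = [n, c₁, c₂, c₃, c₄, c₅, c₆, c₇]) :
    HasCounts P n c₁ c₂ c₃ c₄ c₅ c₆ c₇ := by
  subst hL
  replace hn := nodup_of_noDup (fun c => (heqv c c).2 rfl) hn
  have hinj : ∀ {x y}, κ x = κ y ↔ x = y := fun {x y} =>
    ⟨fun h => List.inj_on_of_nodup_map hn (hl x) (hl y) h, fun h => by rw [h]⟩
  simp only [wordCounts, List.cons.injEq, and_true] at h
  obtain ⟨rfl, rfl, rfl, rfl, rfl, rfl, rfl, rfl⟩ := h
  refine ⟨?_, card_triples_enumeration hl hn fun x => ?_, card_pairs_enumeration hl hn fun x => ?_,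
    card_pairs_enumeration hl hn fun x => ?_, card_triples_enumeration hl hn fun x => ?_,
    card_pairs_enumeration hl hn fun x => ?_, card_pairs_enumeration hl hn fun x => ?_,
    card_pairs_enumeration hl hn fun x => ?_⟩
  · classical
    have : Finite P := Finite.of_finite_univ ((List.finite_toSet l).subset fun g _ => hl g)
    have := Fintype.ofFinite P
    have h : (Finset.univ : Finset P) = l.toFinset := by
      ext g
      simp [hl]
    rw [Nat.card_eq_fintype_card, ← Finset.card_univ, h, List.toFinset_card_of_nodup hn.of_map,
      List.length_map]
  all_goals simp only [heqv, ← hκ, hinj, commute_iff_eq, pow_succ', pow_zero, mul_one]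

end Enumeration

/-! ### Matrices over prime fields and double cosets -/

/-- A `2 × 2` matrix over `ZMod q`, its entries written row by row as natural numbers less than
`q`. The arithmetic of natural numbers is evaluated efficiently by the kernel. -/
abbrev MatCode := ℕ × ℕ × ℕ × ℕ

/-- The product of two matrices modulo `q`. -/
def MatCode.mul (q : ℕ) (x y : MatCode) : MatCode :=
  ((x.1 * y.1 + x.2.1 * y.2.2.1) % q, (x.1 * y.2.1 + x.2.1 * y.2.2.2) % q,
    (x.2.2.1 * y.1 + x.2.2.2 * y.2.2.1) % q, (x.2.2.1 * y.2.1 + x.2.2.2 * y.2.2.2) % q)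

/-- The powers of a matrix modulo `q`. -/
def MatCode.pow (q : ℕ) (x : MatCode) : ℕ → MatCode
  | 0 => (1, 0, 0, 1)
  | n + 1 => MatCode.mul q (MatCode.pow q x n) x

/-- Equality of codes, as a conjunction of comparisons of natural numbers. -/
def MatCode.beq (x y : MatCode) : Bool :=
  Nat.beq x.1 y.1 && (Nat.beq x.2.1 y.2.1 && (Nat.beq x.2.2.1 y.2.2.1 && Nat.beq x.2.2.2 y.2.2.2))

theorem MatCode.beq_eq (x y : MatCode) : MatCode.beq x y = true ↔ x = y := by
  simp [MatCode.beq, Prod.ext_iff]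

/-- The code of a matrix. -/
def matCode {q : ℕ} (A : Matrix.SpecialLinearGroup (Fin 2) (ZMod q)) : MatCode :=
  ((A 0 0).val, (A 0 1).val, (A 1 0).val, (A 1 1).val)

theorem matCode_mul {q : ℕ} [NeZero q] (A B : Matrix.SpecialLinearGroup (Fin 2) (ZMod q)) :
    matCode (A * B) = MatCode.mul q (matCode A) (matCode B) := by
  simp [matCode, MatCode.mul, Matrix.mul_apply, Fin.sum_univ_two, ZMod.val_add, ZMod.val_mul,
    Nat.add_mod]

theorem matCode_pow {q : ℕ} (hq : 1 < q) (A : Matrix.SpecialLinearGroup (Fin 2) (ZMod q)) (n : ℕ) :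
    matCode (A ^ n) = MatCode.pow q (matCode A) n := by
  have := NeZero.mk (Nat.ne_zero_of_lt hq)
  have := Fact.mk hq
  induction n with
  | zero => simp [matCode, MatCode.pow, ZMod.val_one]
  | succ n ih => rw [pow_succ, matCode_mul, ih]; rfl

/-- The elements `x bᵏ` for `x` in `xs` and `bʲ y bᵏ` for `y` in `ys`, with `j < r` and `k < 2 r`,
where `pw k` stands for `bᵏ`. -/
def doubleCosetList {M : Type} (mul : M → M → M) (pw : ℕ → M) (r : ℕ) (xs ys : List M) : List M :=
  (xs.flatMap fun x => (List.range (2 * r)).map fun k => mul x (pw k)) ++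
    ys.flatMap fun y => (List.range r).flatMap fun j =>
      (List.range (2 * r)).map fun k => mul (mul (pw j) y) (pw k)

theorem map_doubleCosetList {M N : Type} {mul : M → M → M} {pw : ℕ → M} {mul' : N → N → N}
    {pw' : ℕ → N} {f : M → N} (hmul : ∀ x y, f (mul x y) = mul' (f x) (f y))
    (hpw : ∀ k, f (pw k) = pw' k) (r : ℕ) (xs ys : List M) :
    (doubleCosetList mul pw r xs ys).map f = doubleCosetList mul' pw' r (xs.map f) (ys.map f) := by
  simp only [doubleCosetList, List.map_append, List.map_flatMap, List.flatMap_map, List.map_map,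
    Function.comp_def, hmul, hpw]

/-! ### Consequences of the binary polyhedral relations -/

section Polyhedral

variable {P : Type} [Group P]

theorem zpow_mul_eq_mul_zpow {b x : P} {k : ℤ} (h : b * x = x * b ^ k) (j : ℤ) :
    b ^ j * x = x * b ^ (k * j) := by
  have e : x⁻¹ * b * x = b ^ k := by rw [mul_assoc, h, inv_mul_cancel_left]
  have e' : x⁻¹ * b ^ j * x = b ^ (k * j) := by
    rw [zpow_mul, ← e]
    simpa using (conj_zpow (a := x⁻¹) (b := b) (i := j)).symm
  rw [← e']
  simp [mul_assoc]

/-- Let `a` and `b` generate a group in which `a³ = bʳ` is central and `b` has order dividing `2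
r`. If the double cosets `⟨b⟩ x ⟨b⟩` and `⟨b⟩ y ⟨b⟩`, with `x` in `xs` normalising `⟨b⟩` and `y`
in `ys`, contain `1` and are permuted by left multiplication by `a`, then they exhaust the group.
Here `a⁻¹` needs no separate treatment, being `b⁻ʳ a²`. -/
theorem mem_doubleCosetList {a b : P} {r : ℕ} (hr : 0 < r) (h2r : b ^ (2 * r) = 1)
    (har : a ^ 3 = b ^ r) (hcen : ∀ x, Commute (b ^ r) x) {xs ys : List P}
    (hcl : Subgroup.closure {a, b} = ⊤) (h1 : (1 : P) ∈ xs)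
    (hbx : ∀ x ∈ xs, ∃ k : ℤ, b * x = x * b ^ k)
    (hax : ∀ x ∈ xs, ∃ y ∈ xs ++ ys, ∃ j k : ℤ, a * x = b ^ j * y * b ^ k)
    (hay : ∀ x ∈ ys, ∀ i < r, ∃ y ∈ xs ++ ys, ∃ j k : ℤ, a * (b ^ i * x) = b ^ j * y * b ^ k)
    (g : P) : g ∈ doubleCosetList (· * ·) (b ^ ·) r xs ys := by
  have hmod : ∀ k : ℤ, ∃ l : ℕ, l < 2 * r ∧ b ^ k = b ^ l := fun k => by
    have hpos : 0 < 2 * (r : ℤ) := by omega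
    refine ⟨(k % (2 * r : ℤ)).toNat, ?_, ?_⟩
    · have := Int.emod_lt_of_pos k hpos
      have := Int.emod_nonneg k hpos.ne'
      omega
    · rw [← zpow_natCast, Int.toNat_of_nonneg (Int.emod_nonneg k hpos.ne')]
      have h0 : b ^ (2 * (r : ℤ)) = 1 := by exact_mod_cast h2r
      conv_lhs => rw [← Int.emod_add_mul_ediv k (2 * r), zpow_add, zpow_mul, h0, one_zpow, mul_one]
  -- As `b ^ r` is central, exponents on the left may be reduced modulo `r`.
  have hsplit : ∀ k : ℤ, ∃ i : ℕ, ∃ q : ℤ, i < r ∧ ∀ x, b ^ k * x = b ^ i * x * b ^ (r * q) :=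
    fun k => by
      have hpos : 0 < (r : ℤ) := by omega
      refine ⟨(k % (r : ℤ)).toNat, k / r, ?_, fun x => ?_⟩
      · have := Int.emod_lt_of_pos k hpos
        have := Int.emod_nonneg k hpos.ne'
        omega
      · have hq : Commute (b ^ ((r : ℤ) * (k / r))) x := by
          rw [zpow_mul, zpow_natCast]
          exact (hcen x).zpow_left _
        rw [← zpow_natCast, Int.toNat_of_nonneg (Int.emod_nonneg k hpos.ne'), mul_assoc, ← hq.eq,
          ← mul_assoc, ← zpow_add, Int.emod_add_mul_ediv]
  -- the union of the double cosets
  -- The union of the double cosets is stable under left multiplication by the generators and their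
  -- inverses.
  let R : P → Prop := fun g => ∃ y ∈ xs ++ ys, ∃ j k : ℤ, g = b ^ j * y * b ^ k
  have hRr : ∀ g, R g → ∀ k : ℤ, R (g * b ^ k) := by
    rintro g ⟨y, hy, j, k, rfl⟩ l
    exact ⟨y, hy, j, k + l, by rw [zpow_add]; simp only [mul_assoc]⟩
  have hRl : ∀ g, R g → ∀ k : ℤ, R (b ^ k * g) := by
    rintro g ⟨y, hy, j, k, rfl⟩ l
    exact ⟨y, hy, l + j, k, by rw [zpow_add]; simp only [mul_assoc]⟩
  have hRa : ∀ g, R g → R (a * g) := by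
    rintro g ⟨y, hy, j, k, rfl⟩
    rw [← mul_assoc]
    refine hRr _ ?_ k
    rcases List.mem_append.1 hy with hx | hy
    · obtain ⟨l, hl⟩ := hbx y hx
      rw [zpow_mul_eq_mul_zpow hl, ← mul_assoc]
      exact hRr _ (hax y hx) _
    · obtain ⟨i, q, hi, hq⟩ := hsplit j
      rw [hq, ← mul_assoc]
      exact hRr _ (hay y hy i hi) _
  have hR : R g := by
    have hg : g ∈ Subgroup.closure {a, b} := by rw [hcl]; trivial
    induction hg using Subgroup.closure_induction_left with
    | one => exact ⟨1, List.mem_append_left _ h1, 0, 0, by simp⟩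
    | mul_left x hx y _ ih =>
      rcases hx with rfl | rfl
      · exact hRa y ih
      · simpa using hRl y ih 1
    | inv_mul_cancel x hx y _ ih =>
      rcases hx with rfl | rfl
      · have e : x⁻¹ = b ^ (-(r : ℤ)) * (x * x) := by
          rw [zpow_neg, zpow_natCast, ← har]
          group
        rw [e, mul_assoc, mul_assoc]
        exact hRl _ (hRa _ (hRa _ ih)) _
      · simpa using hRl y ih (-1)
  obtain ⟨y, hy, j, k, rfl⟩ := hR
  rcases List.mem_append.1 hy with hx | hy
  · obtain ⟨l, hl⟩ := hbx y hx
    obtain ⟨n, hn, hn'⟩ := hmod (l * j + k)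
    refine List.mem_append_left _ (List.mem_flatMap.2 ⟨y, hx, List.mem_map.2
      ⟨n, List.mem_range.2 hn, ?_⟩⟩)
    change y * b ^ n = _
    rw [zpow_mul_eq_mul_zpow hl, ← hn', zpow_add, mul_assoc]
  · obtain ⟨i, q, hi, hq⟩ := hsplit j
    obtain ⟨n, hn, hn'⟩ := hmod (r * q + k)
    refine List.mem_append_right _ (List.mem_flatMap.2 ⟨y, hy, List.mem_flatMap.2
      ⟨i, List.mem_range.2 hi, List.mem_map.2 ⟨n, List.mem_range.2 hn, ?_⟩⟩⟩)
    change b ^ i * y * b ^ n = _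
    rw [hq, ← hn', zpow_add, mul_assoc, mul_assoc, mul_assoc]

section Relations
variable {a b c : P}

theorem polyhedral_sq (h₁ : (a * b) ^ 2 = c) (h₂ : a ^ 3 = c) : a * a = b * a * b := by
  have : a * (a * a) = a * (b * a * b) := by
    rw [← mul_assoc, ← sq, ← pow_succ, h₂, ← h₁, sq]
    simp only [mul_assoc]
  exact mul_left_cancel this

theorem polyhedral_aba (h₁ : (a * b) ^ 2 = c) : a * b * a = c * b⁻¹ := by
  rw [← h₁, sq]
  simp [mul_assoc]

theorem polyhedral_abba (h₁ : (a * b) ^ 2 = c) (h₂ : a ^ 3 = c) :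
    a * b ^ 2 * a = c * b⁻¹ * a * b⁻¹ := by
  rw [← polyhedral_aba h₁, eq_mul_inv_iff_mul_eq]
  calc a * b ^ 2 * a * b = a * b * (b * a * b) := by simp only [sq, mul_assoc]
    _ = _ := by rw [← polyhedral_sq h₁ h₂, mul_assoc]; simp only [mul_assoc]

theorem polyhedral_abinva (h₁ : (a * b) ^ 2 = c) (h₂ : a ^ 3 = c) :
    a * (c * b⁻¹) * a = b * (a * b ^ 3 * a) * b := by
  rw [← polyhedral_aba h₁]
  calc a * (a * b * a) * a = (a * a) * b * (a * a) := by simp only [mul_assoc]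
    _ = _ := by rw [polyhedral_sq h₁ h₂]; simp only [pow_succ, pow_zero, one_mul, mul_assoc]

/-- A power of `b` that is central and is inverted by some `x` is its own inverse. -/
theorem sq_eq_one_of_inverted {b c x : P} {r : ℕ} (hb : b ^ r = c) (hc : ∀ x, Commute c x)
    (hx : b * x * b = x) : c ^ 2 = 1 := by
  have h : b * x = x * b ^ (-1 : ℤ) := by
    rw [zpow_neg_one, eq_mul_inv_iff_mul_eq, hx]
  have h' := zpow_mul_eq_mul_zpow h r
  rw [zpow_natCast, hb, (hc x).eq, zpow_mul, zpow_neg_one, zpow_natCast, inv_pow, hb] at h'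
  rw [sq]
  nth_rewrite 1 [mul_left_cancel h']
  exact inv_mul_cancel c

end Relations

theorem closure_pair_eq_top {rels : Set (FreeGroup (Fin 2))} :
    Subgroup.closure {(PresentedGroup.of 0 : PresentedGroup rels), PresentedGroup.of 1} = ⊤ := by
  rw [← PresentedGroup.closure_range_of rels]
  congr 1
  ext x
  simp [Fin.exists_fin_two, eq_comm]

theorem commute_of_closure {a b c : P} (hcl : Subgroup.closure {a, b} = ⊤) (ha : Commute c a)
    (hb : Commute c b) (x : P) : Commute c x := by
  have : (⊤ : Subgroup P) ≤ Subgroup.centralizer {c} := by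
    rw [← hcl, Subgroup.closure_le]
    rintro y (rfl | rfl)
    · exact Subgroup.mem_centralizer_singleton_iff.2 ha.eq.symm
    · exact Subgroup.mem_centralizer_singleton_iff.2 hb.eq.symm
  exact (Subgroup.mem_centralizer_singleton_iff.1 (this (Subgroup.mem_top x))).symm

/-- The counts of a group covered by double cosets, computed on its image in `SL₂` over `ZMod q`.
The condition `hn` that the listed matrices are distinct implies that the homomorphism is
injective. -/
theorem hasCounts_polyhedral {b : P} {q r : ℕ} (hq : 1 < q)
    (f : P →* Matrix.SpecialLinearGroup (Fin 2) (ZMod q)) {xs ys : List P}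
    (hl : ∀ g, g ∈ doubleCosetList (· * ·) (b ^ ·) r xs ys) {β : MatCode} {xs' ys' : List MatCode}
    (hb : matCode (f b) = β) (hxs : xs.map (fun x => matCode (f x)) = xs')
    (hys : ys.map (fun x => matCode (f x)) = ys')
    (hn : noDup MatCode.beq (doubleCosetList (MatCode.mul q) (MatCode.pow q β) r xs' ys') = true)
    {n A B C D E F S : ℕ}
    (hcount : wordCounts MatCode.beq (MatCode.mul q)
      (doubleCosetList (MatCode.mul q) (MatCode.pow q β) r xs' ys') = [n, A, B, C, D, E, F, S]) :
    HasCounts P n A B C D E F S := by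
  have := NeZero.mk (Nat.ne_zero_of_lt hq)
  have hmul : ∀ x y : P, matCode (f (x * y)) = MatCode.mul q (matCode (f x)) (matCode (f y)) :=
    fun x y => by rw [map_mul, matCode_mul]
  have hmap : (doubleCosetList (· * ·) (b ^ ·) r xs ys).map (fun x => matCode (f x)) =
      doubleCosetList (MatCode.mul q) (MatCode.pow q β) r xs' ys' := by
    rw [map_doubleCosetList hmul (pw' := MatCode.pow q β) fun k => by
      rw [map_pow, matCode_pow hq, hb], hxs, hys]
  exact hasCounts_of_enumeration MatCode.beq_eq (κ := fun x => matCode (f x)) hmul hl hmap hn hcount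

end Polyhedral

/-! ### The binary tetrahedral, octahedral and icosahedral groups -/

section BinaryPolyhedral

/-- The generator `a` of a binary polyhedral group. -/
abbrev polyA (r : ℕ) : BinaryPolyhedral r := PresentedGroup.of 0
/-- The generator `b` of a binary polyhedral group. -/
abbrev polyB (r : ℕ) : BinaryPolyhedral r := PresentedGroup.of 1

theorem polyhedral_rel_sq (r : ℕ) : (polyA r * polyB r) ^ 2 = polyA r ^ 3 :=
  PresentedGroup.mk_eq_mk_of_mul_inv_mem (by simp)

theorem polyhedral_rel_pow (r : ℕ) : polyA r ^ 3 = polyB r ^ r :=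
  PresentedGroup.mk_eq_mk_of_mul_inv_mem (by simp)

theorem polyhedral_central (r : ℕ) (x : BinaryPolyhedral r) : Commute (polyB r ^ r) x := by
  refine commute_of_closure closure_pair_eq_top (a := polyA r) (b := polyB r) ?_
    ((Commute.refl _).pow_left r) x
  rw [← polyhedral_rel_pow]
  exact (Commute.refl _).pow_left 3

/-- The homomorphism defined by two elements that satisfy the binary polyhedral relations. -/
def polyhedralHom {r : ℕ} {H : Type} [Group H] (α β : H) (h₁ : (α * β) ^ 2 = α ^ 3)
    (h₂ : α ^ 3 = β ^ r) : BinaryPolyhedral r →* H :=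
  PresentedGroup.toGroup (f := ![α, β]) (by
    rintro _ (rfl | rfl)
    · simp [h₁]
    · simp [h₂])

theorem polyhedralHom_A {r : ℕ} {H : Type} [Group H] (α β : H) (h₁ : (α * β) ^ 2 = α ^ 3)
    (h₂ : α ^ 3 = β ^ r) : polyhedralHom α β h₁ h₂ (polyA r) = α :=
  PresentedGroup.toGroup.of _

theorem polyhedralHom_B {r : ℕ} {H : Type} [Group H] (α β : H) (h₁ : (α * β) ^ 2 = α ^ 3)
    (h₂ : α ^ 3 = β ^ r) : polyhedralHom α β h₁ h₂ (polyB r) = β :=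
  PresentedGroup.toGroup.of _

/-- The binary tetrahedral group is `⟨b⟩ ∪ ⟨b⟩ a ⟨b⟩`, and is isomorphic to `SL₂(𝔽₃)`. -/
theorem hasCounts_TStar : HasCounts TStar 24 1824 288 168 288 72 168 72 := by
  set a := polyA 3
  set b := polyB 3
  obtain ⟨c, hb⟩ : ∃ c, b ^ 3 = c := ⟨_, rfl⟩
  have ha : a ^ 3 = c := (polyhedral_rel_pow 3).trans hb
  have hab : (a * b) ^ 2 = c := (polyhedral_rel_sq 3).trans ha
  have hcen : ∀ x, Commute (b ^ 3) x := polyhedral_central 3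
  have hc : ∀ x, c * x = x * c := fun x => (hb ▸ hcen x).eq
  have e₁ := polyhedral_sq hab ha
  have e₂ := polyhedral_aba hab
  have e₃ := polyhedral_abba hab ha
  have e₄ := polyhedral_abinva hab ha
  have hb2 : c * b⁻¹ = b ^ 2 := by rw [← hb]; group
  rw [hb2] at e₂ e₃ e₄
  -- Both `e₃` and `e₄` compute `a * b ^ 2 * a`; comparing the results gives `c ^ 2 = 1`.
  have hc2 : c ^ 2 = 1 := by
    have h : b ^ 2 * a = c ^ 2 * (b ^ 2 * a) :=
      calc b ^ 2 * a = b ^ 2 * a * b⁻¹ * b := by group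
        _ = b * (a * c * a) * b * b := by rw [← e₃, e₄, hb]
        _ = c * (b * (a * a) * b ^ 2) := by rw [← hc]; simp only [sq, mul_assoc, hc b, hc _]
        _ = c * (b ^ 2 * a * b ^ 3) := by
          rw [e₁]; simp only [pow_succ, pow_zero, one_mul, mul_assoc]
        _ = c ^ 2 * (b ^ 2 * a) := by rw [hb, ← hc, sq c, mul_assoc]
    exact right_eq_mul.1 h
  have h2r : b ^ (2 * 3) = 1 := by rw [mul_comm, pow_mul, hb, hc2]
  have hl := mem_doubleCosetList (xs := [1]) (ys := [a]) (by norm_num) h2r (ha.trans hb.symm) hcen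
    closure_pair_eq_top (by simp) (by simpa using ⟨1, by simp⟩)
    (by simpa using Or.inr ⟨0, 0, by simp⟩) (by
      intro x hx i hi
      obtain rfl := List.mem_singleton.1 hx
      interval_cases i
      · exact ⟨a, by simp, 1, 1, by simpa using e₁⟩
      · exact ⟨1, by simp, 0, 2, by simpa [← mul_assoc] using e₂⟩
      · exact ⟨a, by simp, 2, -1, by simpa [← mul_assoc] using e₃⟩)
  let α : Matrix.SpecialLinearGroup (Fin 2) (ZMod 3) := ⟨!![0, 1; 2, 1], by decide⟩
  let β : Matrix.SpecialLinearGroup (Fin 2) (ZMod 3) := ⟨!![0, 2; 1, 1], by decide⟩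
  have h₁ : (α * β) ^ 2 = α ^ 3 := by decide
  have h₂ : α ^ 3 = β ^ 3 := by decide
  have hfa := polyhedralHom_A α β h₁ h₂
  have hfb := polyhedralHom_B α β h₁ h₂
  exact hasCounts_polyhedral (q := 3) (by norm_num) (polyhedralHom α β h₁ h₂) hl
    (β := (0, 2, 1, 1)) (xs' := [(1, 0, 0, 1)]) (ys' := [(0, 1, 2, 1)])
    (by rw [hfb]; decide) (by simp only [List.map, map_one]; decide)
    (by simp only [List.map, hfa, a]; decide) (by decide +kernel) (by decide +kernel)

/-- The binary octahedral group is `⟨b⟩ ∪ x ⟨b⟩ ∪ ⟨b⟩ a ⟨b⟩` where `x = a b³ a` inverts `b`; it is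
represented faithfully in `SL₂(𝔽₇)`. -/
theorem hasCounts_OStar : HasCounts OStar 48 6528 1152 192 5952 192 384 384 := by
  set a := polyA 4
  set b := polyB 4
  obtain ⟨c, hb⟩ : ∃ c, b ^ 4 = c := ⟨_, rfl⟩
  have ha : a ^ 3 = c := (polyhedral_rel_pow 4).trans hb
  have hab : (a * b) ^ 2 = c := (polyhedral_rel_sq 4).trans ha
  have hcen : ∀ x, Commute (b ^ 4) x := polyhedral_central 4
  have hc : ∀ x, c * x = x * c := fun x => (hb ▸ hcen x).eq
  have e₁ := polyhedral_sq hab ha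
  have e₂ := polyhedral_aba hab
  have e₃ := polyhedral_abba hab ha
  have e₄ := polyhedral_abinva hab ha
  have hb3 : c * b⁻¹ = b ^ 3 := by rw [← hb]; group
  rw [hb3] at e₂ e₃ e₄
  set x := a * b ^ 3 * a with hx
  have hc2 : c ^ 2 = 1 := sq_eq_one_of_inverted hb hc e₄.symm
  have hbx : b * x = x * b ^ (-1 : ℤ) := by
    rw [zpow_neg_one, eq_mul_inv_iff_mul_eq, ← e₄]
  have hax : a * x = b ^ 6 * a * b :=
    calc a * x = (a * a) * b ^ 3 * a := by simp only [hx, mul_assoc]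
      _ = b * a * b ^ 4 * a := by rw [e₁]; simp only [pow_succ, pow_zero, one_mul, mul_assoc]
      _ = b ^ 4 * (b * (a * a)) := by rw [hb, ← hc (b * a)]; simp only [mul_assoc]
      _ = b ^ 6 * a * b := by rw [e₁]; simp only [pow_succ, pow_zero, one_mul, mul_assoc]
  have h2r : b ^ (2 * 4) = 1 := by rw [mul_comm, pow_mul, hb, hc2]
  have hl := mem_doubleCosetList (xs := [1, x]) (ys := [a]) (by norm_num) h2r (ha.trans hb.symm)
    hcen closure_pair_eq_top (by simp) (by
      intro y hy
      simp only [List.mem_cons, List.not_mem_nil, or_false] at hy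
      rcases hy with rfl | rfl
      · exact ⟨1, by simp⟩
      · exact ⟨-1, hbx⟩) (by
      intro y hy
      simp only [List.mem_cons, List.not_mem_nil, or_false] at hy
      rcases hy with rfl | rfl
      · exact ⟨a, by simp, 0, 0, by simp⟩
      · exact ⟨a, by simp, 6, 1, by simpa using hax⟩) (by
      intro y hy i hi
      obtain rfl := List.mem_singleton.1 hy
      interval_cases i
      · exact ⟨a, by simp, 1, 1, by simpa using e₁⟩
      · exact ⟨1, by simp, 0, 3, by simpa [← mul_assoc] using e₂⟩
      · exact ⟨a, by simp, 3, -1, by simpa [← mul_assoc] using e₃⟩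
      · exact ⟨x, by simp, 0, 0, by simp [hx, mul_assoc]⟩)
  let α : Matrix.SpecialLinearGroup (Fin 2) (ZMod 7) := ⟨!![0, 1; 6, 1], by decide⟩
  let β : Matrix.SpecialLinearGroup (Fin 2) (ZMod 7) := ⟨!![1, 4; 2, 2], by decide⟩
  have h₁ : (α * β) ^ 2 = α ^ 3 := by decide
  have h₂ : α ^ 3 = β ^ 4 := by decide
  have hfa := polyhedralHom_A α β h₁ h₂
  have hfb := polyhedralHom_B α β h₁ h₂
  exact hasCounts_polyhedral (q := 7) (by norm_num) (polyhedralHom α β h₁ h₂) hl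
    (β := (1, 4, 2, 2)) (xs' := [(1, 0, 0, 1), (1, 1, 5, 6)]) (ys' := [(0, 1, 6, 1)])
    (by rw [hfb]; decide)
    (by simp only [List.map, map_one, hx, map_mul, map_pow, hfa, hfb, a, b]; decide)
    (by simp only [List.map, hfa, a]; decide) (by decide +kernel) (by decide +kernel)

/-- The binary icosahedral group is `⟨b⟩ ∪ x ⟨b⟩ ∪ ⟨b⟩ a ⟨b⟩ ∪ ⟨b⟩ w ⟨b⟩` where `w = a b³ a` and
`x = a b⁴ w` inverts `b`; it is isomorphic to `SL₂(𝔽₅)`. -/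
theorem hasCounts_IStar : HasCounts IStar 120 35520 4560 960 27360 720 1080 1080 := by
  set a := polyA 5
  set b := polyB 5
  obtain ⟨c, hb⟩ : ∃ c, b ^ 5 = c := ⟨_, rfl⟩
  have ha : a ^ 3 = c := (polyhedral_rel_pow 5).trans hb
  have hab : (a * b) ^ 2 = c := (polyhedral_rel_sq 5).trans ha
  have hcen : ∀ x, Commute (b ^ 5) x := polyhedral_central 5
  have hc : ∀ x, c * x = x * c := fun x => (hb ▸ hcen x).eq
  have e₁ := polyhedral_sq hab ha
  have e₂ := polyhedral_aba hab
  have e₃ := polyhedral_abba hab ha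
  have e₄ := polyhedral_abinva hab ha
  have hb4 : c * b⁻¹ = b ^ 4 := by rw [← hb]; group
  rw [hb4] at e₂ e₃ e₄
  set w := a * b ^ 3 * a with hw
  set x := a * b ^ 4 * w with hx
  have hbx' : b * x * b = x := by
    calc b * x * b = b * a * b ^ 3 * (b * w * b) := by
          rw [hx]; simp only [pow_succ, pow_zero, one_mul, mul_assoc]
      _ = b * a * b ^ 3 * (a * b ^ 4 * a) := by rw [e₄]
      _ = b * w * b * b ^ 3 * a := by
          rw [hw]; simp only [pow_succ, pow_zero, one_mul, mul_assoc]
      _ = x := by rw [← e₄, hx, hw]; simp only [mul_assoc]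
  have hc2 : c ^ 2 = 1 := sq_eq_one_of_inverted hb hc hbx'
  have hbx : b * x = x * b ^ (-1 : ℤ) := by
    rw [zpow_neg_one, eq_mul_inv_iff_mul_eq, hbx']
  have haw : a * w = b ^ 2 * w * b :=
    calc a * w = (a * a) * b ^ 3 * a := by simp only [hw, mul_assoc]
      _ = b * (a * b ^ 4 * a) := by rw [e₁]; simp only [pow_succ, pow_zero, one_mul, mul_assoc]
      _ = b ^ 2 * w * b := by rw [e₄]; simp only [pow_succ, pow_zero, one_mul, mul_assoc]
  have habw : a * (b * w) = b ^ 7 * a :=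
    calc a * (b * w) = (a * b * a) * b ^ 3 * a := by simp only [hw, mul_assoc]
      _ = b ^ 7 * a := by rw [e₂, ← pow_add]
  have habbw : a * (b ^ 2 * w) = b ^ 8 * a * b ^ (-1 : ℤ) :=
    calc a * (b ^ 2 * w) = (a * b ^ 2 * a) * b ^ 3 * a := by simp only [hw, mul_assoc]
      _ = b ^ 4 * a * b⁻¹ * b ^ 3 * a := by rw [e₃]
      _ = b ^ 4 * (a * b ^ 2 * a) := by
        simp only [pow_succ, pow_zero, one_mul, mul_assoc, inv_mul_cancel_left]
      _ = b ^ 8 * a * b ^ (-1 : ℤ) := by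
        rw [e₃, zpow_neg_one]; simp only [pow_succ, pow_zero, one_mul, mul_assoc]
  have hax : a * x = b ^ 8 * w * b :=
    calc a * x = (a * a) * b ^ 4 * w := by simp only [hx, mul_assoc]
      _ = b * a * b ^ 5 * w := by rw [e₁]; simp only [pow_succ, pow_zero, one_mul, mul_assoc]
      _ = b ^ 5 * (b * (a * w)) := by rw [hb, ← hc (b * a)]; simp only [mul_assoc]
      _ = b ^ 8 * w * b := by rw [haw]; simp only [pow_succ, pow_zero, one_mul, mul_assoc]
  have habbbw : a * (b ^ 3 * w) = b ^ 4 * w * b ^ (-1 : ℤ) := by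
    -- after one more multiplication by `a ^ 2` both sides are words in `x`
    -- After left multiplication by `a ^ 2` both sides become `a * (b * x)`.
    have h₁ : a * a * (a * (b ^ 3 * w)) = a * (b * x) :=
      calc a * a * (a * (b ^ 3 * w)) = a * ((a * a) * b ^ 3 * w) := by simp only [mul_assoc]
        _ = a * (b * x) := by
          rw [e₁, hx]; simp only [pow_succ, pow_zero, one_mul, mul_assoc]
    have h₂ : a * a * (b ^ 4 * w * b ^ (-1 : ℤ)) = a * (b * x) := by
      rw [hbx, hx]
      simp only [mul_assoc]
    exact mul_left_cancel (h₁.trans h₂.symm)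
  have h2r : b ^ (2 * 5) = 1 := by rw [mul_comm, pow_mul, hb, hc2]
  have hl := mem_doubleCosetList (xs := [1, x]) (ys := [a, w]) (by norm_num) h2r (ha.trans hb.symm)
    hcen closure_pair_eq_top (by simp) (by
      intro y hy
      simp only [List.mem_cons, List.not_mem_nil, or_false] at hy
      rcases hy with rfl | rfl
      · exact ⟨1, by simp⟩
      · exact ⟨-1, hbx⟩) (by
      intro y hy
      simp only [List.mem_cons, List.not_mem_nil, or_false] at hy
      rcases hy with rfl | rfl
      · exact ⟨a, by simp, 0, 0, by simp⟩
      · exact ⟨w, by simp, 8, 1, by simpa using hax⟩) (by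
      intro y hy i hi
      simp only [List.mem_cons, List.not_mem_nil, or_false] at hy
      rcases hy with rfl | rfl <;> interval_cases i
      · exact ⟨a, by simp, 1, 1, by simpa using e₁⟩
      · exact ⟨1, by simp, 0, 4, by simpa [← mul_assoc] using e₂⟩
      · exact ⟨a, by simp, 4, -1, by simpa [← mul_assoc] using e₃⟩
      · exact ⟨w, by simp, 0, 0, by simp [hw, mul_assoc]⟩
      · exact ⟨w, by simp, 1, 1, by simpa [← mul_assoc] using e₄⟩
      · exact ⟨w, by simp, 2, 1, by simpa using haw⟩
      · exact ⟨a, by simp, 7, 0, by simpa using habw⟩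
      · exact ⟨a, by simp, 8, -1, by simpa using habbw⟩
      · exact ⟨w, by simp, 4, -1, by simpa using habbbw⟩
      · exact ⟨x, by simp, 0, 0, by simp [hx, mul_assoc]⟩)
  let α : Matrix.SpecialLinearGroup (Fin 2) (ZMod 5) := ⟨!![0, 1; 4, 1], by decide⟩
  let β : Matrix.SpecialLinearGroup (Fin 2) (ZMod 5) := ⟨!![0, 4; 1, 3], by decide⟩
  have h₁ : (α * β) ^ 2 = α ^ 3 := by decide
  have h₂ : α ^ 3 = β ^ 5 := by decide
  have hfa := polyhedralHom_A α β h₁ h₂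
  have hfb := polyhedralHom_B α β h₁ h₂
  exact hasCounts_polyhedral (q := 5) (by norm_num) (polyhedralHom α β h₁ h₂) hl
    (β := (0, 4, 1, 3)) (xs' := [(1, 0, 0, 1), (4, 4, 2, 1)])
    (ys' := [(0, 1, 4, 1), (4, 4, 1, 0)])
    (by rw [hfb]; decide)
    (by simp only [List.map, map_one, hw, hx, map_mul, map_pow, hfa, hfb, a, b]; decide)
    (by simp only [List.map, hw, map_mul, map_pow, hfa, hfb, a, b]; decide)
    (by decide +kernel) (by decide +kernel)

end BinaryPolyhedral

/-! ### Semidirect products acting through a quotient -/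

section Reduction
variable {N Y Z : Type} [Group N] [CommGroup Y] [CommGroup Z] (φ : Y →* MulAut N) (ρ : Z →* Y)

/-- The homomorphism `N ⋊ Z → N ⋊ Y` for an action of `Z` that factors through `ρ : Z → Y`. -/
def semidirectReduction : N ⋊[φ.comp ρ] Z →* N ⋊[φ] Y :=
  SemidirectProduct.map (MonoidHom.id N) ρ fun _ => rfl

variable {φ ρ}

theorem semidirectReduction_right (x : N ⋊[φ.comp ρ] Z) :
    (semidirectReduction φ ρ x).right = ρ x.right := rfl

/-- `N ⋊ Z` is embedded in `(N ⋊ Y) × Z`. -/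
theorem eq_iff_semidirectReduction {x y : N ⋊[φ.comp ρ] Z} :
    x = y ↔ semidirectReduction φ ρ x = semidirectReduction φ ρ y ∧ x.right = y.right :=
  ⟨fun h => h ▸ ⟨rfl, rfl⟩, fun h => SemidirectProduct.ext (congrArg (·.left) h.1) h.2⟩

theorem pow_right (x : N ⋊[φ] Y) (k : ℕ) : (x ^ k).right = x.right ^ k :=
  map_pow SemidirectProduct.rightHom x k

/-- As `Z` is commutative, commuting in `N ⋊ Z` can be tested in `N ⋊ Y`. -/
theorem commute_iff_semidirectReduction {x y : N ⋊[φ.comp ρ] Z} :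
    Commute x y ↔ Commute (semidirectReduction φ ρ x) (semidirectReduction φ ρ y) := by
  rw [commute_iff_eq, eq_iff_semidirectReduction, map_mul, map_mul, commute_iff_eq]
  exact and_iff_left (mul_comm _ _)

theorem pow_eq_iff_semidirectReduction {x y : N ⋊[φ.comp ρ] Z} {k l : ℕ} :
    x ^ k = y ^ l ↔ semidirectReduction φ ρ x ^ k = semidirectReduction φ ρ y ^ l ∧
      x.right ^ k = y.right ^ l := by
  rw [eq_iff_semidirectReduction, map_pow, map_pow, pow_right, pow_right]

variable (hρ : Function.Surjective ρ)

/-- The fibres of `N ⋊ Z → N ⋊ Y` are cosets of the kernel of `ρ`. -/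
noncomputable def semidirectEquiv : N ⋊[φ.comp ρ] Z ≃ (N ⋊[φ] Y) × ρ.ker where
  toFun x := (semidirectReduction φ ρ x, ⟨(Function.surjInv hρ (ρ x.right))⁻¹ * x.right, by
    rw [MonoidHom.mem_ker, map_mul, map_inv, Function.surjInv_eq hρ, inv_mul_cancel]⟩)
  invFun y := ⟨y.1.left, Function.surjInv hρ y.1.right * y.2⟩
  left_inv x := by
    ext
    · rfl
    · simp [semidirectReduction_right]
  right_inv := by
    rintro ⟨y, k, hk⟩
    rw [MonoidHom.mem_ker] at hk
    refine Prod.ext (SemidirectProduct.ext rfl ?_) (Subtype.ext ?_)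
    · simp [semidirectReduction_right, hk, Function.surjInv_eq hρ]
    · simp [hk, Function.surjInv_eq hρ]

/-- If `ρ` kills the `k`-torsion of `Z`, then a pair in `N ⋊ Z` with equal `k`-th powers is a pair
in `N ⋊ Y` with equal `k`-th powers and equal components in `Y`, a lift of this component to `Z`,
and an element of the `k`-torsion, the quotient of the components in `Z`. -/
noncomputable def powPairsReductionEquiv {k : ℕ} (hk : ∀ t : Z, t ^ k = 1 → ρ t = 1) :
    {x : (N ⋊[φ.comp ρ] Z) × (N ⋊[φ.comp ρ] Z) // x.1 ^ k = x.2 ^ k} ≃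
      (ρ.ker × (powMonoidHom k : Z →* Z).ker) ×
        {x : (N ⋊[φ] Y) × (N ⋊[φ] Y) // x.1 ^ k = x.2 ^ k ∧ x.1.right = x.2.right} where
  toFun x :=
    have h := pow_eq_iff_semidirectReduction.1 x.2
    have h' : (x.1.1.right⁻¹ * x.1.2.right) ^ k = 1 := by
      rw [mul_pow, inv_pow, h.2, inv_mul_cancel]
    ((⟨(Function.surjInv hρ (ρ x.1.1.right))⁻¹ * x.1.1.right, by
      rw [MonoidHom.mem_ker, map_mul, map_inv, Function.surjInv_eq hρ, inv_mul_cancel]⟩,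
      ⟨x.1.1.right⁻¹ * x.1.2.right, h'⟩),
      ⟨(semidirectReduction φ ρ x.1.1, semidirectReduction φ ρ x.1.2), h.1, by
        have := hk _ h'
        rwa [map_mul, map_inv, inv_mul_eq_one] at this⟩)
  invFun y := ⟨(⟨y.2.1.1.left, Function.surjInv hρ y.2.1.1.right * y.1.1⟩,
    ⟨y.2.1.2.left, Function.surjInv hρ y.2.1.1.right * y.1.1 * y.1.2⟩), by
      obtain ⟨⟨⟨a, ha⟩, ⟨t, ht⟩⟩, ⟨u, v⟩, huv, hr⟩ := y
      have ht' : t ^ k = 1 := ht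
      have ht'' := hk t ht'
      rw [MonoidHom.mem_ker] at ha
      refine pow_eq_iff_semidirectReduction.2 ⟨?_, ?_⟩
      · convert huv using 2
        · exact SemidirectProduct.ext rfl (by
            simp [semidirectReduction_right, ha, Function.surjInv_eq hρ])
        · refine SemidirectProduct.ext rfl ?_
          simp only at hr
          simp [semidirectReduction_right, ha, ht'', Function.surjInv_eq hρ, hr]
      · simp [mul_pow, ht']⟩
  left_inv x := by
    refine Subtype.ext (Prod.ext (SemidirectProduct.ext rfl ?_) (SemidirectProduct.ext rfl ?_))
    · simp [semidirectReduction_right]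
    · simp [semidirectReduction_right]
  right_inv := by
    rintro ⟨⟨⟨a, ha⟩, ⟨t, ht⟩⟩, ⟨u, v⟩, huv, hr⟩
    have ht'' := hk t ht
    rw [MonoidHom.mem_ker] at ha
    simp only at hr
    refine Prod.ext (Prod.ext (Subtype.ext ?_) (Subtype.ext ?_)) (Subtype.ext (Prod.ext
      (SemidirectProduct.ext rfl ?_) (SemidirectProduct.ext rfl ?_)))
    · simp [ha, Function.surjInv_eq hρ]
    · exact inv_mul_cancel_left _ _
    · simp [semidirectReduction_right, ha, Function.surjInv_eq hρ]
    · simp [semidirectReduction_right, ha, ht'', Function.surjInv_eq hρ, hr]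

/-- The analogue of `powPairsReductionEquiv` for triples with equal `k`-th powers. -/
noncomputable def powTriplesReductionEquiv {k : ℕ} (hk : ∀ t : Z, t ^ k = 1 → ρ t = 1) :
    {x : (N ⋊[φ.comp ρ] Z) × (N ⋊[φ.comp ρ] Z) × (N ⋊[φ.comp ρ] Z) //
        x.1 ^ k = x.2.1 ^ k ∧ x.1 ^ k = x.2.2 ^ k} ≃
      (ρ.ker × (powMonoidHom k : Z →* Z).ker × (powMonoidHom k : Z →* Z).ker) ×
        {x : (N ⋊[φ] Y) × (N ⋊[φ] Y) × (N ⋊[φ] Y) //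
          (x.1 ^ k = x.2.1 ^ k ∧ x.1.right = x.2.1.right) ∧
            (x.1 ^ k = x.2.2 ^ k ∧ x.1.right = x.2.2.right)} where
  toFun x :=
    (((powPairsReductionEquiv hρ hk ⟨(x.1.1, x.1.2.1), x.2.1⟩).1.1,
      (powPairsReductionEquiv hρ hk ⟨(x.1.1, x.1.2.1), x.2.1⟩).1.2,
      (powPairsReductionEquiv hρ hk ⟨(x.1.1, x.1.2.2), x.2.2⟩).1.2),
      ⟨(semidirectReduction φ ρ x.1.1, semidirectReduction φ ρ x.1.2.1,
        semidirectReduction φ ρ x.1.2.2),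
        (powPairsReductionEquiv hρ hk ⟨(x.1.1, x.1.2.1), x.2.1⟩).2.2,
        (powPairsReductionEquiv hρ hk ⟨(x.1.1, x.1.2.2), x.2.2⟩).2.2⟩)
  invFun y :=
    ⟨(((powPairsReductionEquiv hρ hk).symm ((y.1.1, y.1.2.1), ⟨(y.2.1.1, y.2.1.2.1), y.2.2.1⟩)).1.1,
      ((powPairsReductionEquiv hρ hk).symm ((y.1.1, y.1.2.1), ⟨(y.2.1.1, y.2.1.2.1), y.2.2.1⟩)).1.2,
      ((powPairsReductionEquiv hρ hk).symm ((y.1.1, y.1.2.2), ⟨(y.2.1.1, y.2.1.2.2), y.2.2.2⟩)).1.2),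
      ((powPairsReductionEquiv hρ hk).symm ((y.1.1, y.1.2.1), ⟨(y.2.1.1, y.2.1.2.1), y.2.2.1⟩)).2,
      ((powPairsReductionEquiv hρ hk).symm ((y.1.1, y.1.2.2), ⟨(y.2.1.1, y.2.1.2.2), y.2.2.2⟩)).2⟩
  left_inv x := by
    have h₁ := (powPairsReductionEquiv hρ hk).symm_apply_apply ⟨(x.1.1, x.1.2.1), x.2.1⟩
    have h₂ := (powPairsReductionEquiv hρ hk).symm_apply_apply ⟨(x.1.1, x.1.2.2), x.2.2⟩
    rw [Subtype.ext_iff, Prod.ext_iff] at h₁ h₂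
    exact Subtype.ext (Prod.ext h₁.1 (Prod.ext h₁.2 h₂.2))
  right_inv y := by
    have h₁ := (powPairsReductionEquiv hρ hk).apply_symm_apply
      ((y.1.1, y.1.2.1), ⟨(y.2.1.1, y.2.1.2.1), y.2.2.1⟩)
    have h₂ := (powPairsReductionEquiv hρ hk).apply_symm_apply
      ((y.1.1, y.1.2.2), ⟨(y.2.1.1, y.2.1.2.2), y.2.2.2⟩)
    exact Prod.ext (Prod.ext (congrArg (·.1.1) h₁) (Prod.ext (congrArg (·.1.2) h₁)
      (congrArg (·.1.2) h₂))) (Subtype.ext (Prod.ext (congrArg (·.2.1.1) h₁)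
        (Prod.ext (congrArg (·.2.1.2) h₁) (congrArg (·.2.1.2) h₂))))

/-- A solution of `u² = v³` in `N ⋊ Z` is a solution in `N ⋊ Y` together with a lift to `Z` of the
element `t` of `Y` for which the components of `u` and `v` are `t³` and `t²`. -/
noncomputable def squareCubeReductionEquiv :
    {x : (N ⋊[φ.comp ρ] Z) × (N ⋊[φ.comp ρ] Z) // x.1 ^ 2 = x.2 ^ 3} ≃
      ρ.ker × {x : (N ⋊[φ] Y) × (N ⋊[φ] Y) // x.1 ^ 2 = x.2 ^ 3} where
  toFun x :=
    (⟨(Function.surjInv hρ (ρ (x.1.1.right * x.1.2.right⁻¹)))⁻¹ *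
      (x.1.1.right * x.1.2.right⁻¹), by
      rw [MonoidHom.mem_ker, map_mul ρ (_⁻¹), map_inv, Function.surjInv_eq hρ, inv_mul_cancel]⟩,
      ⟨(semidirectReduction φ ρ x.1.1, semidirectReduction φ ρ x.1.2),
        (pow_eq_iff_semidirectReduction.1 x.2).1⟩)
  invFun y := ⟨(⟨y.2.1.1.left, (Function.surjInv hρ (y.2.1.1.right * y.2.1.2.right⁻¹) * y.1) ^ 3⟩,
    ⟨y.2.1.2.left, (Function.surjInv hρ (y.2.1.1.right * y.2.1.2.right⁻¹) * y.1) ^ 2⟩), by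
      obtain ⟨⟨a, ha⟩, ⟨u, v⟩, huv⟩ := y
      rw [MonoidHom.mem_ker] at ha
      have hr := congrArg (·.right) huv
      simp only [pow_right] at hr
      refine pow_eq_iff_semidirectReduction.2 ⟨?_, ?_⟩
      · convert huv using 2
        · exact SemidirectProduct.ext rfl ((map_pow ρ _ 3).trans (by
            rw [map_mul ρ, Function.surjInv_eq hρ, ha, mul_one, mul_inv_sq_cube hr]))
        · exact SemidirectProduct.ext rfl ((map_pow ρ _ 2).trans (by
            rw [map_mul ρ, Function.surjInv_eq hρ, ha, mul_one, mul_inv_sq_sq hr]))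
      · rw [← pow_mul, ← pow_mul]⟩
  left_inv x := by
    have hr := (pow_eq_iff_semidirectReduction.1 x.2).2
    refine Subtype.ext (Prod.ext (SemidirectProduct.ext rfl ?_) (SemidirectProduct.ext rfl ?_))
    · simp [semidirectReduction_right, mul_inv_sq_cube hr]
    · simp [semidirectReduction_right, mul_inv_sq_sq hr]
  right_inv := by
    rintro ⟨⟨a, ha⟩, ⟨u, v⟩, huv⟩
    rw [MonoidHom.mem_ker] at ha
    have hr := congrArg (·.right) huv
    simp only [pow_right] at hr
    refine Prod.ext (Subtype.ext ?_) (Subtype.ext (Prod.ext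
      (SemidirectProduct.ext rfl ?_) (SemidirectProduct.ext rfl ?_)))
    · simp only [pow_three_mul_inv_sq, map_mul, ha, Function.surjInv_eq hρ, mul_one,
        inv_mul_cancel_left]
    · exact (map_pow ρ _ 3).trans (by
        rw [map_mul ρ, Function.surjInv_eq hρ, ha, mul_one, mul_inv_sq_cube hr])
    · exact (map_pow ρ _ 2).trans (by
        rw [map_mul ρ, Function.surjInv_eq hρ, ha, mul_one, mul_inv_sq_sq hr])

/-- The counts of `N ⋊ Z` in terms of counts in `N ⋊ Y`, when `Z` acts through `ρ : Z → Y` and `ρ`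
kills the `2`-torsion and the `3`-torsion of `Z`. -/
theorem hasCounts_semidirect {n A B E F κ c₂ c₃ : ℕ}
    (hρ : Function.Surjective ρ) (hn : Nat.card (N ⋊[φ] Y) = n)
    (hA : commTriples (N ⋊[φ] Y) = A) (hB : commSquarePairs (N ⋊[φ] Y) = B)
    (hE : squareCubePairs (N ⋊[φ] Y) = E) (hF : commPairs (N ⋊[φ] Y) = F)
    (hκ : Nat.card ρ.ker = κ)
    (hc₂ : Nat.card (powMonoidHom 2 : Z →* Z).ker = c₂)
    (hc₃ : Nat.card (powMonoidHom 3 : Z →* Z).ker = c₃)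
    (h₂ : ∀ t : Z, t ^ 2 = 1 → ρ t = 1) (h₃ : ∀ t : Z, t ^ 3 = 1 → ρ t = 1) {C' D' S' : ℕ}
    (hC' : Nat.card {x : (N ⋊[φ] Y) × (N ⋊[φ] Y) // x.1 ^ 3 = x.2 ^ 3 ∧ x.1.right = x.2.right} = C')
    (hD' : Nat.card {x : (N ⋊[φ] Y) × (N ⋊[φ] Y) × (N ⋊[φ] Y) //
          (x.1 ^ 2 = x.2.1 ^ 2 ∧ x.1.right = x.2.1.right) ∧
            (x.1 ^ 2 = x.2.2 ^ 2 ∧ x.1.right = x.2.2.right)} = D')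
    (hS' : Nat.card {x : (N ⋊[φ] Y) × (N ⋊[φ] Y) // x.1 ^ 2 = x.2 ^ 2 ∧ x.1.right = x.2.right} =
      S') :
    HasCounts (N ⋊[φ.comp ρ] Z) (n * κ) (A * (κ * (κ * κ))) (B * (κ * κ)) (κ * c₃ * C')
      (κ * (c₂ * c₂) * D') (κ * E) (F * (κ * κ)) (κ * c₂ * S') where
  card := by rw [Nat.card_congr (semidirectEquiv hρ), Nat.card_prod, hn, hκ]
  commTriples := by
    rw [← hA, ← hκ, ← Nat.card_prod, ← Nat.card_prod]
    refine (card_triples_congr (semidirectEquiv hρ) fun x => ?_).trans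
      ((card_triples_prod (S := fun _ => True) fun x => (and_iff_left trivial).symm).trans
        (congrArg _ (Nat.card_congr (Equiv.subtypeUnivEquiv fun _ => trivial))))
    exact and_congr commute_iff_semidirectReduction commute_iff_semidirectReduction
  commSquarePairs := by
    rw [← hB, ← hκ, ← Nat.card_prod]
    refine (card_pairs_congr (semidirectEquiv hρ) fun x => ?_).trans
      ((card_pairs_prod (S := fun _ => True) fun x => (and_iff_left trivial).symm).trans
        (congrArg _ (Nat.card_congr (Equiv.subtypeUnivEquiv fun _ => trivial))))
    rw [commute_iff_semidirectReduction, map_pow]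
    rfl
  commPairs := by
    rw [← hF, ← hκ, ← Nat.card_prod]
    refine (card_pairs_congr (semidirectEquiv hρ) fun x => ?_).trans
      ((card_pairs_prod (S := fun _ => True) fun x => (and_iff_left trivial).symm).trans
        (congrArg _ (Nat.card_congr (Equiv.subtypeUnivEquiv fun _ => trivial))))
    exact commute_iff_semidirectReduction
  cubePairs := by
    rw [← hC', ← hκ, ← hc₃, ← Nat.card_prod, ← Nat.card_prod]
    exact Nat.card_congr (powPairsReductionEquiv hρ h₃)
  squarePairs := by
    rw [← hS', ← hκ, ← hc₂, ← Nat.card_prod, ← Nat.card_prod]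
    exact Nat.card_congr (powPairsReductionEquiv hρ h₂)
  squareTriples := by
    rw [← hD', ← hκ, ← hc₂, ← Nat.card_prod, ← Nat.card_prod, ← Nat.card_prod]
    exact Nat.card_congr (powTriplesReductionEquiv hρ h₂)
  squareCubePairs := by
    rw [← hE, ← hκ]
    exact (Nat.card_congr (squareCubeReductionEquiv hρ)).trans (Nat.card_prod _ _)

end Reduction

/-! ### Dicyclic groups -/

section Fibres
variable {G : Type}

open Classical in
theorem sum_const_add_ite [Fintype G] (p : G → Prop) (u v : ℕ) :
    ∑ x, (u + if p x then v else 0) = Nat.card G * u + Nat.card {x // p x} * v := by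
  rw [Finset.sum_add_distrib, ← Finset.sum_filter, Finset.sum_const, Finset.sum_const,
    smul_eq_mul, smul_eq_mul, Nat.card_eq_fintype_card, Nat.card_eq_fintype_card,
    Fintype.card_subtype, Finset.card_univ]

open Classical in
theorem card_subtype_const (q : Prop) :
    Nat.card {_x : G // q} = if q then Nat.card G else 0 := by
  split_ifs with h
  · exact Nat.card_congr (Equiv.subtypeUnivEquiv fun _ => h)
  · have : IsEmpty {_x : G // q} := ⟨fun x => h x.2⟩
    exact Nat.card_of_isEmpty

theorem card_pow_eq {I : Type} [CommGroup I] (k : ℕ) (a : I) :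
    Nat.card {b // a ^ k = b ^ k} = Nat.card (powMonoidHom k : I →* I).ker :=
  Nat.card_congr
    { toFun b := ⟨a⁻¹ * b, by
        rw [MonoidHom.mem_ker, powMonoidHom_apply, mul_pow, inv_pow]
        exact inv_mul_eq_one.2 b.2⟩
      invFun t := ⟨a * t, by
        have := t.2
        rw [MonoidHom.mem_ker, powMonoidHom_apply] at this
        rw [mul_pow, this, mul_one]⟩
      left_inv b := by simp
      right_inv t := by simp }

end Fibres

/-- The group `G` consists of the elements `r a` of a commutative subgroup isomorphic to `I` and of
the elements `s a = r a * s 1`, where `s 1` inverts the subgroup and has square `r z`.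
With `z = 1` these are the generalised dihedral groups. -/
structure IsDicyclic {G I : Type} [Group G] [CommGroup I] (r s : I → G) (z : I) : Prop where
  bijective : Function.Bijective (Sum.elim r s)
  sq_eq_one : z ^ 2 = 1
  mul_rr a b : r a * r b = r (a * b)
  mul_rs a b : r a * s b = s (a * b)
  mul_sr a b : s a * r b = s (a * b⁻¹)
  mul_ss a b : s a * s b = r (a * b⁻¹ * z)

namespace IsDicyclic
variable {G I : Type} [Group G] [CommGroup I] {r s : I → G} {z : I}

section
variable (h : IsDicyclic r s z)
include h

theorem r_inj {a b : I} : r a = r b ↔ a = b :=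
  ⟨fun e => Sum.inl_injective (h.bijective.1 e), fun e => by rw [e]⟩

theorem s_inj {a b : I} : s a = s b ↔ a = b :=
  ⟨fun e => Sum.inr_injective (h.bijective.1 e), fun e => by rw [e]⟩

theorem r_ne_s (a b : I) : r a ≠ s b :=
  fun e => Sum.inl_ne_inr (h.bijective.1 (a₁ := Sum.inl a) (a₂ := Sum.inr b) e)

theorem r_eq_s {a b : I} : r a = s b ↔ False := iff_false_intro (h.r_ne_s a b)

theorem s_eq_r {a b : I} : s a = r b ↔ False := iff_false_intro (h.r_ne_s b a).symm

theorem pow_r (a : I) (k : ℕ) : r a ^ k = r (a ^ k) := by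
  induction k with
  | zero =>
    rw [pow_zero, pow_zero]
    exact mul_left_cancel (a := r 1) (by rw [h.mul_rr, mul_one, mul_one])
  | succ k ih => rw [pow_succ, ih, h.mul_rr, pow_succ]

theorem sq_s (a : I) : s a ^ 2 = r z := by
  rw [sq, h.mul_ss, mul_inv_cancel, one_mul]

theorem cube_s (a : I) : s a ^ 3 = s (z * a) := by
  rw [pow_succ, h.sq_s, h.mul_rs]

theorem card_eq [Finite I] (p : G → Prop) :
    Nat.card {x // p x} = Nat.card {a // p (r a)} + Nat.card {a // p (s a)} := by
  have e := Equiv.subtypeEquiv (Equiv.ofBijective _ h.bijective)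
    (p := fun x => p (Sum.elim r s x)) (q := p) fun _ => Iff.rfl
  rw [← Nat.card_congr e, Nat.card_congr Equiv.subtypeSum, Nat.card_sum]
  rfl

theorem sum_eq [Fintype G] [Fintype I] (f : G → ℕ) : ∑ x, f x = ∑ a, f (r a) + ∑ a, f (s a) := by
  rw [← (Equiv.ofBijective _ h.bijective).sum_comp, Fintype.sum_sum_type]
  rfl

theorem commute_rr (a b : I) : Commute (r a) (r b) := by
  rw [commute_iff_eq, h.mul_rr, h.mul_rr, mul_comm]

theorem commute_rs {a b : I} : Commute (r a) (s b) ↔ a ^ 2 = 1 := by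
  rw [commute_iff_eq, h.mul_rs, h.mul_sr, h.s_inj, mul_comm, mul_right_inj, eq_inv_iff_mul_eq_one,
    sq]

theorem commute_sr {a b : I} : Commute (s b) (r a) ↔ a ^ 2 = 1 :=
  ⟨fun e => h.commute_rs.1 e.symm, fun e => (h.commute_rs.2 e).symm⟩

theorem commute_ss {a b : I} : Commute (s a) (s b) ↔ a ^ 2 = b ^ 2 := by
  rw [commute_iff_eq, h.mul_ss, h.mul_ss, h.r_inj, mul_left_inj, ← div_eq_mul_inv, ← div_eq_mul_inv,
    div_eq_div_iff_mul_eq_mul, sq, sq]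

open Classical in
theorem card_commute_r [Finite I] (a : I) :
    Nat.card {y // Commute (r a) y} = Nat.card I + if a ^ 2 = 1 then Nat.card I else 0 := by
  rw [h.card_eq]
  simp only [h.commute_rs, card_subtype_const]
  rw [Nat.card_congr (Equiv.subtypeUnivEquiv fun b => h.commute_rr a b)]

theorem card_commute_s [Finite I] (a : I) :
    Nat.card {y // Commute (s a) y} = 2 * Nat.card (powMonoidHom 2 : I →* I).ker := by
  rw [h.card_eq]
  simp only [h.commute_sr, h.commute_ss, card_pow_eq]
  rw [two_mul]
  rfl

open Classical in
theorem card_sq_r [Finite I] (a : I) :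
    Nat.card {y // r a ^ 2 = y ^ 2} =
      Nat.card (powMonoidHom 2 : I →* I).ker + if a ^ 2 = z then Nat.card I else 0 := by
  rw [h.card_eq]
  simp only [h.pow_r, h.sq_s, h.r_inj, card_subtype_const, card_pow_eq]

theorem card_sq_s [Finite I] (a : I) :
    Nat.card {y // s a ^ 2 = y ^ 2} = Nat.card {b : I // b ^ 2 = z} + Nat.card I := by
  classical
  rw [h.card_eq]
  simp only [h.pow_r, h.sq_s, h.r_inj, card_subtype_const, if_true, eq_comm (a := z)]

theorem card_cube_r [Finite I] (a : I) :
    Nat.card {y // r a ^ 3 = y ^ 3} = Nat.card (powMonoidHom 3 : I →* I).ker := by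
  classical
  rw [h.card_eq]
  simp only [h.pow_r, h.cube_s, h.r_inj, h.r_eq_s, card_subtype_const, card_pow_eq, if_false,
    add_zero]

theorem card_cube_s [Finite I] (a : I) : Nat.card {y // s a ^ 3 = y ^ 3} = 1 := by
  classical
  rw [h.card_eq]
  simp only [h.pow_r, h.cube_s, h.s_inj, h.s_eq_r, card_subtype_const, if_false, zero_add,
    mul_right_inj]
  exact Nat.card_eq_one_iff_unique.2 ⟨⟨fun x y => Subtype.ext (x.2.symm.trans y.2)⟩, ⟨⟨a, rfl⟩⟩⟩

open Classical in
theorem card_sqrt_cube_r [Finite I] (a : I) :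
    Nat.card {y // y ^ 2 = r a ^ 3} =
      Nat.card {b // b ^ 2 = a ^ 3} + if a ^ 3 = z then Nat.card I else 0 := by
  rw [h.card_eq]
  simp only [h.pow_r, h.sq_s, h.r_inj, card_subtype_const, eq_comm (a := z)]

theorem card_sqrt_cube_s [Finite I] (a : I) : Nat.card {y // y ^ 2 = s a ^ 3} = 0 := by
  classical
  rw [h.card_eq]
  simp only [h.pow_r, h.sq_s, h.cube_s, h.r_eq_s, card_subtype_const, if_false]

/-- Since `z³ = z`, the cube roots of `z` form a coset of the `3`-torsion. -/
theorem card_cube_eq : Nat.card {a : I // a ^ 3 = z} = Nat.card (powMonoidHom 3 : I →* I).ker := by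
  rw [← card_pow_eq 3 z, pow_succ z, h.sq_eq_one, one_mul]
  simp only [eq_comm]

end

theorem hasCounts [Finite I] (h : IsDicyclic r s z) {i i₂ i₃ i₄ w : ℕ} (hi : Nat.card I = i)
    (h₂ : Nat.card (powMonoidHom 2 : I →* I).ker = i₂)
    (h₃ : Nat.card (powMonoidHom 3 : I →* I).ker = i₃)
    (h₄ : Nat.card (powMonoidHom 4 : I →* I).ker = i₄)
    (hw : Nat.card {a : I // a ^ 2 = z} = w) :
    HasCounts G (2 * i) (i ^ 3 + 3 * i₂ * i ^ 2 + 4 * i * i₂ ^ 2) (3 * i ^ 2 + i₄ * i)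
      (i * i₃ + i) (i * i₂ ^ 2 + w * (2 * i₂ * i + i ^ 2) + i * (w + i) ^ 2) (i + i₃ * i)
      (i ^ 2 + 3 * i₂ * i) (i * i₂ + 2 * w * i + i ^ 2) := by
  classical
  have := Fintype.ofFinite I
  have := Fintype.ofBijective _ h.bijective
  have h₂' : Nat.card {a : I // a ^ 2 = 1} = i₂ := h₂
  have h₄' : Nat.card {a : I // a ^ 4 = 1} = i₄ := h₄
  have hsq (p : I → Prop) (u v : ℕ) (x : I) :
      (u + if p x then v else 0) ^ 2 = u ^ 2 + if p x then 2 * u * v + v ^ 2 else 0 := by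
    split_ifs <;> ring
  refine ⟨?_, ?_, ?_, ?_, ?_, ?_, ?_, ?_⟩
  · rw [← Nat.card_congr (Equiv.ofBijective _ h.bijective), Nat.card_sum, hi, two_mul]
  · rw [commTriples, card_triples_eq_sum fun x y : G => Commute x y, h.sum_eq]
    simp only [h.card_commute_r, h.card_commute_s, hsq, sum_const_add_ite, Finset.sum_const,
      Finset.card_univ, ← Nat.card_eq_fintype_card, smul_eq_mul, hi, h₂, h₂']
    ring
  · rw [commSquarePairs, card_pairs_eq_sum fun x y : G => Commute (x ^ 2) y, h.sum_eq]
    simp only [h.pow_r, h.sq_s, h.card_commute_r, sum_const_add_ite, Finset.sum_const,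
      Finset.card_univ, ← Nat.card_eq_fintype_card, smul_eq_mul, hi, h₄', h.sq_eq_one, if_true,
      ← pow_mul, Nat.reduceMul]
    ring
  · rw [cubePairs, card_pairs_eq_sum fun x y : G => x ^ 3 = y ^ 3, h.sum_eq]
    simp only [h.card_cube_r, h.card_cube_s, Finset.sum_const,
      Finset.card_univ, ← Nat.card_eq_fintype_card, smul_eq_mul, hi, h₃, mul_one]
  · rw [squareTriples, card_triples_eq_sum fun x y : G => x ^ 2 = y ^ 2, h.sum_eq]
    simp only [h.card_sq_r, h.card_sq_s, hsq, sum_const_add_ite, Finset.sum_const,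
      Finset.card_univ, ← Nat.card_eq_fintype_card, smul_eq_mul, hi, h₂, hw]
  · rw [squareCubePairs, ← Nat.card_congr (Equiv.subtypeEquiv
      (p := fun x : G × G => x.2 ^ 2 = x.1 ^ 3)
      (Equiv.prodComm G G) fun x => Iff.rfl),
      card_pairs_eq_sum fun x y : G => y ^ 2 = x ^ 3, h.sum_eq]
    have hE : ∑ a : I, Nat.card {b : I // b ^ 2 = a ^ 3} = i := by
      rw [← card_pairs_eq_sum fun x y : I => y ^ 2 = x ^ 3, ← hi,
        ← Nat.card_congr (squareCubeEquiv I)]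
      exact Nat.card_congr (Equiv.subtypeEquiv (Equiv.prodComm I I) fun x => Iff.rfl)
    have hz := sum_const_add_ite (fun a : I => a ^ 3 = z) 0 i
    simp only [zero_add, mul_zero, h.card_cube_eq, h₃] at hz
    simp only [h.card_sqrt_cube_r, h.card_sqrt_cube_s, Finset.sum_add_distrib, hE, hi, hz,
      Finset.sum_const_zero, add_zero]
  · rw [commPairs, card_pairs_eq_sum fun x y : G => Commute x y, h.sum_eq]
    simp only [h.card_commute_r, h.card_commute_s, sum_const_add_ite, Finset.sum_const,
      Finset.card_univ, ← Nat.card_eq_fintype_card, smul_eq_mul, hi, h₂, h₂']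
    ring
  · rw [squarePairs, card_pairs_eq_sum fun x y : G => x ^ 2 = y ^ 2, h.sum_eq]
    simp only [h.card_sq_r, h.card_sq_s, sum_const_add_ite, Finset.sum_const,
      Finset.card_univ, ← Nat.card_eq_fintype_card, smul_eq_mul, hi, h₂, hw]
    ring

end IsDicyclic

/-! ### Homomorphisms from cyclic groups -/

section CycHom

/-- The standard generator of the cyclic group. -/
def cycGen (n : ℕ) : Cyc n := Multiplicative.ofAdd 1

theorem cycGen_pow_self (n : ℕ) : cycGen n ^ n = 1 := by
  rw [cycGen, ← ofAdd_nsmul, nsmul_one, ZMod.natCast_self]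
  rfl

variable {n : ℕ} [NeZero n]

theorem pow_val_add {P : Type} [Group P] {y : P} (hy : y ^ n = 1) (i j : ZMod n) :
    y ^ (i + j).val = y ^ i.val * y ^ j.val := by
  rw [← pow_add, ZMod.val_add, ← pow_eq_pow_mod _ hy]

theorem cycGen_pow_val (x : Cyc n) : cycGen n ^ (Multiplicative.toAdd x).val = x := by
  rw [cycGen, ← ofAdd_nsmul, nsmul_one, ZMod.natCast_zmod_val]
  rfl

/-- The homomorphism from the cyclic group of order `n` that sends the generator to `y`. -/
def cycHom {P : Type} [Group P] (y : P) (hy : y ^ n = 1) : Cyc n →* P :=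
  MonoidHom.mk' (fun x => y ^ (Multiplicative.toAdd x).val) fun _ _ => pow_val_add hy _ _

theorem cycHom_gen {P : Type} [Group P] (y : P) (hy : y ^ n = 1) : cycHom y hy (cycGen n) = y := by
  change y ^ (1 : ZMod n).val = y
  rw [ZMod.val_one_eq_one_mod, ← pow_eq_pow_mod _ hy, pow_one]

theorem cyc_hom_ext {M : Type} [Monoid M] {f g : Cyc n →* M} (h : f (cycGen n) = g (cycGen n)) :
    f = g :=
  MonoidHom.ext fun x => by rw [← cycGen_pow_val x, map_pow, map_pow, h]

/-- Homomorphisms from a semidirect product with a cyclic group: compatibility with the action need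
only be checked for the generator. -/
def cycSemidirectLift {N P : Type} [Group N] [Group P] {φ : Cyc n →* MulAut N} (f : N →* P)
    (g : Cyc n →* P)
    (h : ∀ x, f (φ (cycGen n) x) = g (cycGen n) * f x * (g (cycGen n))⁻¹) : N ⋊[φ] Cyc n →* P :=
  SemidirectProduct.lift f g fun c => by
    rw [← cycGen_pow_val c]
    generalize (Multiplicative.toAdd c).val = k
    induction k with
    | zero => ext x; simp
    | succ k ih =>
      ext x
      have ihx := DFunLike.congr_fun ih (φ (cycGen n) x)
      simp only [MonoidHom.comp_apply, MulEquiv.coe_toMonoidHom, MulAut.conj_apply] at ihx ⊢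
      rw [pow_succ, map_mul, map_mul, MulAut.mul_apply, ihx, h]
      simp only [mul_assoc, mul_inv_rev]

section
variable {N P : Type} [Group N] [Group P] {φ : Cyc n →* MulAut N} (f : N →* P) (g : Cyc n →* P)
  (h : ∀ x, f (φ (cycGen n) x) = g (cycGen n) * f x * (g (cycGen n))⁻¹)

theorem cycSemidirectLift_inl (x : N) :
    cycSemidirectLift f g h (SemidirectProduct.inl x) = f x := SemidirectProduct.lift_inl ..

theorem cycSemidirectLift_inr (x : Cyc n) :
    cycSemidirectLift f g h (SemidirectProduct.inr x) = g x := SemidirectProduct.lift_inr ..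

end

end CycHom

/-! ### Binary dihedral groups -/

section BinaryDihedral
variable {p : ℕ}

/-- The relations of the binary dihedral group imply that `x` inverts `y`. As `x` also commutes
with `x² = yᵖ`, it follows that `y²ᵖ = 1`. -/
theorem dicyclic_relations {P : Type} [Group P] {x y : P} (h₁ : x ^ 2 = (x * y) ^ 2)
    (h₂ : (x * y) ^ 2 = y ^ p) : y * x = x * y⁻¹ ∧ y ^ (2 * p) = 1 := by
  have h : y * x = x * y⁻¹ := by
    rw [sq, sq, mul_assoc, mul_right_inj, ← mul_assoc] at h₁
    rw [eq_mul_inv_iff_mul_eq, ← h₁]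
  refine ⟨h, ?_⟩
  have hc : SemiconjBy x y⁻¹ y := h.symm
  have hc' := (hc.pow_right p).eq
  rw [inv_pow, ← h₂, ← h₁, (Commute.refl x).pow_left 2 |>.eq, mul_right_inj,
    inv_eq_iff_mul_eq_one] at hc'
  rw [mul_comm, pow_mul, ← h₂, ← h₁, sq, hc']

/-- The generator `x` of the binary dihedral group. -/
abbrev binaryDihedralX (p : ℕ) : BinaryDihedral p := PresentedGroup.of 0
/-- The generator `y` of the binary dihedral group. -/
abbrev binaryDihedralY (p : ℕ) : BinaryDihedral p := PresentedGroup.of 1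

theorem binaryDihedral_rel (p : ℕ) :
    binaryDihedralX p ^ 2 = (binaryDihedralX p * binaryDihedralY p) ^ 2 ∧
      (binaryDihedralX p * binaryDihedralY p) ^ 2 = binaryDihedralY p ^ p :=
  ⟨PresentedGroup.mk_eq_mk_of_mul_inv_mem (by simp),
    PresentedGroup.mk_eq_mk_of_mul_inv_mem (by simp)⟩

/-- The homomorphism from the binary dihedral group to the quaternion group, `x ↦ xa 0`, `y ↦ a
1`. -/
def binaryDihedralHom (p : ℕ) : BinaryDihedral p →* QuaternionGroup p :=
  PresentedGroup.toGroup (f := ![QuaternionGroup.xa 0, QuaternionGroup.a 1]) (by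
    rintro _ (rfl | rfl)
    · rw [map_mul, map_inv, mul_inv_eq_one]
      simp [sq]
    · rw [map_mul, map_inv, mul_inv_eq_one]
      simp [sq])

theorem binaryDihedralHom_X :
    binaryDihedralHom p (binaryDihedralX p) = QuaternionGroup.xa 0 :=
  PresentedGroup.toGroup.of _
theorem binaryDihedralHom_Y :
    binaryDihedralHom p (binaryDihedralY p) = QuaternionGroup.a 1 :=
  PresentedGroup.toGroup.of _

theorem pow_val_neg_mul {n : ℕ} [NeZero n] {P : Type} [Group P] {x y : P} (hy : y ^ n = 1)
    (h : y * x = x * y⁻¹) (i : ZMod n) : y ^ i.val * x = x * y ^ (-i).val := by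
  have e : y ^ (-i).val = (y⁻¹) ^ i.val := by
    rw [inv_pow, ← mul_eq_one_iff_eq_inv, ← pow_val_add hy, neg_add_cancel, ZMod.val_zero, pow_zero]
  rw [e]
  exact ((show SemiconjBy x y⁻¹ y from h.symm).pow_right _).eq.symm

/-- The homomorphism from the quaternion group defined by two elements that satisfy the binary
dihedral relations. -/
def quaternionHom {P : Type} [Group P] [NeZero p] {x y : P} (h₁ : x ^ 2 = (x * y) ^ 2)
    (h₂ : (x * y) ^ 2 = y ^ p) : QuaternionGroup p →* P :=
  have h := dicyclic_relations h₁ h₂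
  have hx (i : ZMod (2 * p)) : y ^ i.val * x = x * y ^ (-i).val := pow_val_neg_mul h.2 h.1 i
  have hz : y ^ (p : ZMod (2 * p)).val = x * x := by
    rw [ZMod.val_natCast, ← pow_eq_pow_mod _ h.2, ← h₂, ← h₁, sq]
  MonoidHom.mk'
    (fun
      | .a i => y ^ i.val
      | .xa i => x * y ^ i.val) (by
    rintro (i | i) (j | j)
    · simp only [QuaternionGroup.a_mul_a, pow_val_add h.2]
    · simp only [QuaternionGroup.a_mul_xa]
      rw [← mul_assoc, hx, mul_assoc, ← pow_val_add h.2, sub_eq_neg_add]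
    · simp only [QuaternionGroup.xa_mul_a, pow_val_add h.2, mul_assoc]
    · simp only [QuaternionGroup.xa_mul_xa]
      rw [mul_assoc x, ← mul_assoc (y ^ i.val), hx, mul_assoc x, ← mul_assoc x x, ← hz,
        ← pow_val_add h.2, ← pow_val_add h.2]
      congr 2
      ring)

theorem quaternionHom_a {P : Type} [Group P] [NeZero p] {x y : P} (h₁ : x ^ 2 = (x * y) ^ 2)
    (h₂ : (x * y) ^ 2 = y ^ p) (i) : quaternionHom h₁ h₂ (.a i) = y ^ i.val := rfl

theorem quaternionHom_xa {P : Type} [Group P] [NeZero p] {x y : P} (h₁ : x ^ 2 = (x * y) ^ 2)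
    (h₂ : (x * y) ^ 2 = y ^ p) (i) : quaternionHom h₁ h₂ (.xa i) = x * y ^ i.val := rfl

theorem quaternion_hom_ext {M : Type} [Monoid M] [NeZero p] {f g : QuaternionGroup p →* M}
    (h₁ : f (.xa 0) = g (.xa 0)) (h₂ : f (.a 1) = g (.a 1)) : f = g := by
  have ha (i : ZMod (2 * p)) : f (.a i) = g (.a i) := by
    rw [← ZMod.natCast_zmod_val i, ← QuaternionGroup.a_one_pow, map_pow, map_pow, h₂]
  refine MonoidHom.ext ?_
  rintro (i | i)
  · exact ha i
  · have : (QuaternionGroup.xa i) = .xa 0 * .a i := by simp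
    rw [this, map_mul, map_mul, h₁, ha]

/-- The binary dihedral group is the quaternion group. -/
def binaryDihedralEquiv (p : ℕ) [NeZero p] : BinaryDihedral p ≃* QuaternionGroup p :=
  (binaryDihedralHom p).toMulEquiv (quaternionHom (binaryDihedral_rel p).1 (binaryDihedral_rel p).2)
    (PresentedGroup.ext fun i => by
      fin_cases i
      · change quaternionHom (binaryDihedral_rel p).1 (binaryDihedral_rel p).2
          (binaryDihedralHom p (binaryDihedralX p)) = binaryDihedralX p
        rw [binaryDihedralHom_X, quaternionHom_xa, ZMod.val_zero, pow_zero, mul_one]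
      · change quaternionHom (binaryDihedral_rel p).1 (binaryDihedral_rel p).2
          (binaryDihedralHom p (binaryDihedralY p)) = binaryDihedralY p
        rw [binaryDihedralHom_Y, quaternionHom_a, ZMod.val_one_eq_one_mod,
          ← pow_eq_pow_mod _ (dicyclic_relations (binaryDihedral_rel p).1
            (binaryDihedral_rel p).2).2, pow_one])
    (quaternion_hom_ext (by simp [quaternionHom_xa, binaryDihedralHom_X])
      (by
        simp only [MonoidHom.comp_apply, quaternionHom_a, map_pow, binaryDihedralHom_Y,
          QuaternionGroup.a_one_pow, ZMod.natCast_zmod_val, MonoidHom.id_apply]))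

/-- The sign in the second map accounts for the convention `xa i = x * aⁱ = a⁻ⁱ * x`. -/
theorem isDicyclic_quaternionGroup (p : ℕ) [NeZero p] :
    IsDicyclic (G := QuaternionGroup p) (I := Cyc (2 * p))
      (fun i => .a (Multiplicative.toAdd i)) (fun i => .xa (-Multiplicative.toAdd i))
      (Multiplicative.ofAdd (p : ZMod (2 * p))) where
  bijective := by
    constructor
    · rintro (i | i) (j | j) h <;> simp_all
    · rintro (i | i)
      · exact ⟨.inl (.ofAdd i), rfl⟩
      · exact ⟨.inr (.ofAdd (-i)), by simp⟩
  sq_eq_one := by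
    rw [← ofAdd_nsmul, nsmul_eq_mul, ← Nat.cast_mul, ZMod.natCast_self]
    rfl
  mul_rr i j := by simp
  mul_rs i j := by simp; ring
  mul_sr i j := by simp; ring
  mul_ss i j := by simp; ring

/-- For even `p`, the square roots of the involution of a cyclic group of order `2 p` form a coset
of the `2`-torsion. -/
theorem card_sqrt_half {p : ℕ} (hp : p ≠ 0) (he : Even p) :
    Nat.card {a : Cyc (2 * p) // a ^ 2 = Multiplicative.ofAdd (p : ZMod (2 * p))} = 2 := by
  obtain ⟨q, hq⟩ := he
  have e := card_pow_ker_cyc (mul_ne_zero two_ne_zero hp) 2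
  rw [Nat.gcd_mul_right_left] at e
  refine Eq.trans ?_ e
  rw [← card_pow_eq 2 (Multiplicative.ofAdd (q : ZMod (2 * p)))]
  have : (Multiplicative.ofAdd (q : ZMod (2 * p))) ^ 2 =
      Multiplicative.ofAdd (p : ZMod (2 * p)) := by
    rw [← ofAdd_nsmul, nsmul_eq_mul, hq]
    push_cast
    ring_nf
  rw [this]
  exact Nat.card_congr (Equiv.subtypeEquivRight fun _ => eq_comm)

/-- For odd `p`, the involution of a cyclic group of order `2 p` is not a square. -/
theorem card_sqrt_half_odd {p : ℕ} (ho : Odd p) :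
    Nat.card {a : Cyc (2 * p) // a ^ 2 = Multiplicative.ofAdd (p : ZMod (2 * p))} = 0 := by
  have : IsEmpty {a : Cyc (2 * p) // a ^ 2 = Multiplicative.ofAdd (p : ZMod (2 * p))} := by
    refine ⟨fun ⟨a, ha⟩ => ?_⟩
    have h : Multiplicative.ofAdd (p : ZMod (2 * p)) ^ p = 1 := by
      rw [← ha, ← pow_mul, ← orderOf_dvd_iff_pow_eq_one]
      exact (orderOf_dvd_natCard a).trans (card_cyc (2 * p)).dvd
    rw [← ofAdd_nsmul, nsmul_eq_mul, ← Nat.cast_mul] at h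
    replace h := (ZMod.natCast_eq_zero_iff _ _).1 (Multiplicative.ofAdd.injective h)
    exact Nat.not_even_iff_odd.2 ho
      (even_iff_two_dvd.2 ((Nat.mul_dvd_mul_iff_right ho.pos).1 h))
  exact Nat.card_of_isEmpty

end BinaryDihedral

section BinaryDihedral
variable {p : ℕ}

theorem gcd_two_mul_three (p : ℕ) : (2 * p).gcd 3 = p.gcd 3 :=
  Nat.Coprime.gcd_mul_left_cancel p (by norm_num)

theorem hasCounts_binaryDihedral_of_even (hp : p ≠ 0) (he : Even p) :
    HasCounts (BinaryDihedral p) (4 * p) (8 * p ^ 3 + 24 * p ^ 2 + 32 * p) (12 * p ^ 2 + 8 * p)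
      (2 * p * p.gcd 3 + 2 * p) (8 * p ^ 3 + 24 * p ^ 2 + 32 * p) (2 * p + 2 * p * p.gcd 3)
      (4 * p ^ 2 + 12 * p) (4 * p ^ 2 + 12 * p) := by
  have := NeZero.mk hp
  have h0 : 2 * p ≠ 0 := mul_ne_zero two_ne_zero hp
  have := finite_cyc h0
  have h := (isDicyclic_quaternionGroup p).hasCounts (card_cyc _) (card_pow_ker_cyc h0 2)
    (card_pow_ker_cyc h0 3) (card_pow_ker_cyc h0 4) (card_sqrt_half hp he)
  have h4 : (2 * p).gcd 4 = 4 := by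
    obtain ⟨q, rfl⟩ := he
    exact Nat.gcd_eq_right ⟨q, by ring⟩
  rw [Nat.gcd_mul_right_left, gcd_two_mul_three, h4] at h
  convert h.congr (binaryDihedralEquiv p).symm using 1 <;> ring

theorem hasCounts_binaryDihedral_of_odd (ho : Odd p) :
    HasCounts (BinaryDihedral p) (4 * p) (8 * p ^ 3 + 24 * p ^ 2 + 32 * p) (12 * p ^ 2 + 4 * p)
      (2 * p * p.gcd 3 + 2 * p) (8 * p ^ 3 + 8 * p) (2 * p + 2 * p * p.gcd 3)
      (4 * p ^ 2 + 12 * p) (4 * p ^ 2 + 4 * p) := by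
  have hp := ho.pos.ne'
  have := NeZero.mk hp
  have h0 : 2 * p ≠ 0 := mul_ne_zero two_ne_zero hp
  have := finite_cyc h0
  have h := (isDicyclic_quaternionGroup p).hasCounts (card_cyc _) (card_pow_ker_cyc h0 2)
    (card_pow_ker_cyc h0 3) (card_pow_ker_cyc h0 4) (card_sqrt_half_odd ho)
  have h4 : (2 * p).gcd 4 = 2 := by
    rw [show 4 = 2 * 2 from rfl, Nat.gcd_mul_left, ho.coprime_two_right]
  rw [Nat.gcd_mul_right_left, gcd_two_mul_three, h4] at h
  convert h.congr (binaryDihedralEquiv p).symm using 1 <;> ring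

end BinaryDihedral

/-! ### Projections between cyclic groups -/

section CycProj
variable {n m : ℕ} [NeZero n]

/-- The projection from a cyclic group to a cyclic group of smaller order. -/
def cycProj (h : m ∣ n) : Cyc n →* Cyc m :=
  cycHom (cycGen m) (orderOf_dvd_iff_pow_eq_one.1
    ((orderOf_dvd_of_pow_eq_one (cycGen_pow_self m)).trans h))

theorem cycProj_gen (h : m ∣ n) : cycProj h (cycGen n) = cycGen m := cycHom_gen _ _

theorem cycProj_surjective [NeZero m] (h : m ∣ n) : Function.Surjective (cycProj h) := fun x =>
  ⟨cycGen n ^ (Multiplicative.toAdd x).val, by rw [map_pow, cycProj_gen, cycGen_pow_val]⟩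

theorem card_cycProj_ker [NeZero m] (h : m ∣ n) : Nat.card (cycProj h).ker = n / m := by
  have e := (cycProj h).ker.card_mul_index
  rw [Subgroup.index_ker, MonoidHom.range_eq_top.2 (cycProj_surjective h), Subgroup.card_top,
    card_cyc, card_cyc] at e
  exact (Nat.div_eq_of_eq_mul_left (NeZero.pos m) e.symm).symm

theorem cycProj_eq_one_of_mul_dvd (h : m ∣ n) {d : ℕ} (hd : d ≠ 0) (hdm : d * m ∣ n) (t : Cyc n)
    (ht : t ^ d = 1) : cycProj h t = 1 := by
  rw [← cycGen_pow_val t] at ht ⊢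
  rw [← pow_mul, cycGen, ← ofAdd_nsmul, nsmul_one] at ht
  have h' := hdm.trans ((ZMod.natCast_eq_zero_iff _ _).1 (Multiplicative.ofAdd.injective ht))
  rw [mul_comm d, Nat.mul_dvd_mul_iff_right hd.bot_lt] at h'
  rw [map_pow, cycProj_gen]
  exact orderOf_dvd_iff_pow_eq_one.1
    ((orderOf_dvd_of_pow_eq_one (cycGen_pow_self m)).trans h')

theorem cycProj_eq_one_of_coprime (h : m ∣ n) {d : ℕ} (hd : d.Coprime m) (t : Cyc n)
    (ht : t ^ d = 1) : cycProj h t = 1 := by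
  have h₁ : cycProj h t ^ d = 1 := by rw [← map_pow, ht, map_one]
  have h₂ : cycProj h t ^ m = 1 := orderOf_dvd_iff_pow_eq_one.1
    ((orderOf_dvd_natCard _).trans (card_cyc m).dvd)
  rw [← orderOf_dvd_iff_pow_eq_one] at h₁ h₂
  exact orderOf_eq_one_iff.1 (Nat.dvd_one.1 (hd ▸ Nat.dvd_gcd h₁ h₂))

end CycProj

/-! ### The metacyclic groups `DPrime` -/

section DPrime

/-- The action of the cyclic group of order `2` by inversion. -/
def inversionAction (p : ℕ) : Cyc 2 →* MulAut (Cyc p) :=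
  cycHom (MulEquiv.inv (Cyc p)) (by ext x; simp [sq])

theorem inversionAction_gen (p : ℕ) (x : Cyc p) : inversionAction p (cycGen 2) x = x⁻¹ := by
  rw [inversionAction, cycHom_gen]
  rfl

theorem eq_one_or_eq_cycGen : ∀ c : Cyc 2, c = 1 ∨ c = cycGen 2 := by decide

/-- The dihedral group, as a semidirect product. -/
theorem isDicyclic_semidirect (p : ℕ) :
    IsDicyclic (G := Cyc p ⋊[inversionAction p] Cyc 2) (fun a => ⟨a, 1⟩)
      (fun a => ⟨a, cycGen 2⟩) 1 where
  bijective := by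
    constructor
    · rintro (a | a) (b | b) h
      · exact congrArg _ (congrArg (·.left) h)
      · exact absurd (congrArg (·.right) h) (show (1 : Cyc 2) ≠ cycGen 2 by decide)
      · exact absurd (congrArg (·.right) h) (show cycGen 2 ≠ (1 : Cyc 2) by decide)
      · exact congrArg _ (congrArg (·.left) h)
    · rintro ⟨a, c⟩
      obtain rfl | rfl := eq_one_or_eq_cycGen c
      · exact ⟨.inl a, rfl⟩
      · exact ⟨.inr a, rfl⟩
  sq_eq_one := one_pow 2
  mul_rr a b := by ext <;> simp
  mul_rs a b := by ext <;> simp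
  mul_sr a b := by ext <;> simp [inversionAction_gen]
  mul_ss a b := by ext <;> simp [inversionAction_gen]; decide

/-- The cyclic group of order `2 ^ (k + 2)` acts on the cyclic group of order `p` through its
quotient of order `2`, which acts by inversion. -/
abbrev DPrimeModel (k p : ℕ) : Type :=
  Cyc p ⋊[(inversionAction p).comp (cycProj (Dvd.intro_left (2 ^ (k + 1)) rfl : 2 ∣ 2 ^ (k + 2)))]
    Cyc (2 ^ (k + 2))

theorem hasCounts_dPrimeModel (k : ℕ) {p : ℕ} (ho : Odd p) :
    HasCounts (DPrimeModel k p) (2 * p * 2 ^ (k + 1))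
      ((p ^ 3 + 3 * p ^ 2 + 4 * p) * (2 ^ (k + 1) * (2 ^ (k + 1) * 2 ^ (k + 1))))
      ((3 * p ^ 2 + p) * (2 ^ (k + 1) * 2 ^ (k + 1))) (2 ^ (k + 1) * 1 * (p * p.gcd 3 + p))
      (2 ^ (k + 1) * (2 * 2) * (p + p ^ 3)) (2 ^ (k + 1) * (p + p.gcd 3 * p))
      ((p ^ 2 + 3 * p) * (2 ^ (k + 1) * 2 ^ (k + 1))) (2 ^ (k + 1) * 2 * (p + p ^ 2)) := by
  classical
  have hp := ho.pos.ne'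
  have := NeZero.mk hp
  have hD := isDicyclic_semidirect p
  have hc (d : ℕ) : Nat.card {a : Cyc p // a ^ d = 1} = p.gcd d := card_pow_ker_cyc hp d
  have h2 : p.gcd 2 = 1 := ho.coprime_two_right
  have h4 : p.gcd 4 = 1 := Nat.Coprime.pow_right 2 h2
  have h := hD.hasCounts (card_cyc _) (card_pow_ker_cyc hp 2)
    (card_pow_ker_cyc hp 3) (card_pow_ker_cyc hp 4) (hc 2)
  rw [h2, h4] at h
  have hne : ((1 : Cyc 2) = cycGen 2) ↔ False := by decide
  have hne' : (cycGen 2 = (1 : Cyc 2)) ↔ False := by decide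
  -- Cubing is injective on the quotient of order `2`, so equal cubes have equal right components.
  have hcube : ∀ c d : Cyc 2, c ^ 3 = d ^ 3 → c = d := by decide
  have : Finite (Cyc p ⋊[inversionAction p] Cyc 2) := Finite.of_surjective _ hD.bijective.2
  have := Fintype.ofFinite (Cyc p ⋊[inversionAction p] Cyc 2)
  have hr (a : Cyc p) : Nat.card {y : Cyc p ⋊[inversionAction p] Cyc 2 //
      (⟨a, 1⟩ : Cyc p ⋊[inversionAction p] Cyc 2) ^ 2 = y ^ 2 ∧ 1 = y.right} = 1 := by
    rw [hD.card_eq]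
    simp only [hD.pow_r, hD.r_inj, hne, and_false, and_true, card_pow_eq, card_pow_ker_cyc hp, h2,
      card_subtype_const, if_false]
  have hs (a : Cyc p) : Nat.card {y : Cyc p ⋊[inversionAction p] Cyc 2 //
      (⟨a, cycGen 2⟩ : Cyc p ⋊[inversionAction p] Cyc 2) ^ 2 = y ^ 2 ∧ cycGen 2 = y.right} = p := by
    rw [hD.card_eq]
    simp only [hD.sq_s, hne', and_false, and_true, card_subtype_const, if_false, if_true, card_cyc,
      zero_add]
  refine hasCounts_semidirect (cycProj_surjective _) (h.card) ?_ ?_ ?_ ?_ ?_ ?_ ?_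
    (cycProj_eq_one_of_mul_dvd _ two_ne_zero ⟨2 ^ k, by ring⟩)
    (cycProj_eq_one_of_coprime _ (by norm_num)) ?_ ?_ ?_
  · rw [h.commTriples]; ring
  · rw [h.commSquarePairs, one_mul]
  · exact h.squareCubePairs
  · rw [h.commPairs, mul_one]
  · rw [card_cycProj_ker, pow_succ, Nat.mul_div_cancel _ two_pos]
  · rw [card_pow_ker_cyc (by positivity), pow_succ, Nat.gcd_mul_left_left]
  · rw [card_pow_ker_cyc (by positivity)]
    exact Nat.Coprime.pow_left _ (by norm_num)
  · rw [← h.cubePairs]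
    refine Nat.card_congr (Equiv.subtypeEquivRight fun x => and_iff_left_of_imp fun e => ?_)
    have := congrArg (·.right) e
    simp only [pow_right] at this
    exact hcube _ _ this
  · rw [card_triples_eq_sum fun x y : Cyc p ⋊[inversionAction p] Cyc 2 =>
      x ^ 2 = y ^ 2 ∧ x.right = y.right, hD.sum_eq]
    simp only [hr, hs, Finset.sum_const, Finset.card_univ, ← Nat.card_eq_fintype_card, card_cyc,
      smul_eq_mul]
    ring
  · rw [card_pairs_eq_sum fun x y : Cyc p ⋊[inversionAction p] Cyc 2 =>
      x ^ 2 = y ^ 2 ∧ x.right = y.right, hD.sum_eq]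
    simp only [hr, hs, Finset.sum_const, Finset.card_univ, ← Nat.card_eq_fintype_card, card_cyc,
      smul_eq_mul]
    ring

/-- The generator `x` of the group `DPrime k p`. -/
abbrev dPrimeX (k p : ℕ) : DPrime k p := PresentedGroup.of 0
/-- The generator `y` of the group `DPrime k p`. -/
abbrev dPrimeY (k p : ℕ) : DPrime k p := PresentedGroup.of 1

variable (k p : ℕ)

theorem dPrimeX_pow : dPrimeX k p ^ 2 ^ (k + 2) = 1 :=
  PresentedGroup.one_of_mem (rels := {_, _, _}) (by simp)

theorem dPrimeY_pow : dPrimeY k p ^ p = 1 :=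
  PresentedGroup.one_of_mem (rels := {_, _, _}) (by simp)

theorem dPrime_rel : dPrimeX k p * (dPrimeY k p)⁻¹ = dPrimeY k p * dPrimeX k p :=
  PresentedGroup.mk_eq_mk_of_mul_inv_mem (by simp)

theorem dPrimeModel_gen_smul (x : Cyc p) :
    (inversionAction p).comp (cycProj (Dvd.intro_left (2 ^ (k + 1)) rfl : 2 ∣ 2 ^ (k + 2)))
      (cycGen _) x = x⁻¹ := by
  rw [MonoidHom.comp_apply, cycProj_gen, inversionAction_gen]

/-- The homomorphism from the presented group to the semidirect product. -/
def dPrimeHom : DPrime k p →* DPrimeModel k p :=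
  PresentedGroup.toGroup (f := ![SemidirectProduct.inr (cycGen _), SemidirectProduct.inl (cycGen _)])
    (by
      rintro _ (rfl | rfl | rfl)
      · rw [map_pow, FreeGroup.lift_apply_of]
        change (SemidirectProduct.inr (cycGen _) : DPrimeModel k p) ^ _ = 1
        rw [← map_pow, cycGen_pow_self, map_one]
      · rw [map_pow, FreeGroup.lift_apply_of]
        change (SemidirectProduct.inl (cycGen _) : DPrimeModel k p) ^ _ = 1
        rw [← map_pow, cycGen_pow_self, map_one]
      · rw [map_mul, map_inv, mul_inv_eq_one]
        simp only [map_mul, map_inv, FreeGroup.lift_apply_of]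
        change (SemidirectProduct.inr (cycGen _) : DPrimeModel k p) *
          (SemidirectProduct.inl (cycGen _))⁻¹ =
            SemidirectProduct.inl (cycGen _) * SemidirectProduct.inr (cycGen _)
        rw [← map_inv, ← mul_inv_eq_iff_eq_mul, ← map_inv, ← SemidirectProduct.inl_aut,
          dPrimeModel_gen_smul, inv_inv])

theorem dPrimeHom_X : dPrimeHom k p (dPrimeX k p) = SemidirectProduct.inr (cycGen _) :=
  PresentedGroup.toGroup.of _

theorem dPrimeHom_Y : dPrimeHom k p (dPrimeY k p) = SemidirectProduct.inl (cycGen _) :=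
  PresentedGroup.toGroup.of _

variable [NeZero p]

/-- The homomorphism from the semidirect product to the presented group. -/
def dPrimeInv : DPrimeModel k p →* DPrime k p :=
  cycSemidirectLift (cycHom (dPrimeY k p) (dPrimeY_pow k p))
    (cycHom (dPrimeX k p) (dPrimeX_pow k p)) fun x => by
    have h : dPrimeX k p * dPrimeY k p * (dPrimeX k p)⁻¹ = (dPrimeY k p)⁻¹ := by
      have := dPrime_rel k p
      rw [mul_inv_eq_iff_eq_mul, eq_inv_mul_iff_mul_eq, ← mul_assoc, ← this, inv_mul_cancel_right]
    rw [dPrimeModel_gen_smul, cycHom_gen, ← cycGen_pow_val x, ← inv_pow, map_pow, map_pow, map_inv,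
      cycHom_gen, ← conj_pow, h]

theorem dPrimeInv_inr_gen : dPrimeInv k p (SemidirectProduct.inr (cycGen _)) = dPrimeX k p :=
  (cycSemidirectLift_inr _ _ _ _).trans (cycHom_gen _ _)

theorem dPrimeInv_inl_gen : dPrimeInv k p (SemidirectProduct.inl (cycGen _)) = dPrimeY k p :=
  (cycSemidirectLift_inl _ _ _ _).trans (cycHom_gen _ _)

/-- The group `DPrime k p` is a semidirect product of cyclic groups. -/
def dPrimeEquiv : DPrime k p ≃* DPrimeModel k p :=
  (dPrimeHom k p).toMulEquiv (dPrimeInv k p)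
    (PresentedGroup.ext fun i => by
      fin_cases i
      · exact (congrArg (dPrimeInv k p) (dPrimeHom_X k p)).trans (dPrimeInv_inr_gen k p)
      · exact (congrArg (dPrimeInv k p) (dPrimeHom_Y k p)).trans (dPrimeInv_inl_gen k p))
    (SemidirectProduct.hom_ext
      (cyc_hom_ext ((congrArg (dPrimeHom k p) (dPrimeInv_inl_gen k p)).trans (dPrimeHom_Y k p)))
      (cyc_hom_ext ((congrArg (dPrimeHom k p) (dPrimeInv_inr_gen k p)).trans (dPrimeHom_X k p))))

end DPrime

/-! ### The groups `TPrime` -/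

section TPrime

/-- The quaternion group of order `8`, with the generators `x = xa 0` and `y = a 1` of the binary
dihedral presentation. -/
abbrev Q8 : Type := QuaternionGroup 2

/-- The endomorphism `x ↦ y`, `y ↦ x y` of the quaternion group. -/
def q8CycleHom : Q8 →* Q8 :=
  quaternionHom (x := .a 1) (y := .xa 1) (by decide) (by decide)

/-- The automorphism `x ↦ y`, `y ↦ x y` of order three. -/
def q8Cycle : MulAut Q8 :=
  q8CycleHom.toMulEquiv (q8CycleHom.comp q8CycleHom)
    (quaternion_hom_ext (by decide) (by decide)) (quaternion_hom_ext (by decide) (by decide))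

theorem q8Cycle_pow_three : q8Cycle ^ 3 = 1 := MulEquiv.ext (by decide)

/-- The action of the cyclic group of order `3` on the quaternion group by `q8Cycle`. -/
def q8Action : Cyc 3 →* MulAut Q8 := cycHom q8Cycle q8Cycle_pow_three

/-- The binary tetrahedral group, as a semidirect product. -/
abbrev BinaryTetrahedral : Type := Q8 ⋊[q8Action] Cyc 3

/-- The elements of the binary tetrahedral group. -/
def binaryTetrahedralList : List BinaryTetrahedral :=
  (List.finRange 3).flatMap fun c => (List.finRange 4).flatMap fun i =>
    [⟨.a i, Multiplicative.ofAdd c⟩, ⟨.xa i, Multiplicative.ofAdd c⟩]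

theorem mem_binaryTetrahedralList (g : BinaryTetrahedral) : g ∈ binaryTetrahedralList := by
  obtain ⟨i | i, c⟩ := g
  · exact List.mem_flatMap.2 ⟨c, List.mem_finRange _, List.mem_flatMap.2
      ⟨i, List.mem_finRange _, List.mem_cons_self⟩⟩
  · exact List.mem_flatMap.2 ⟨c, List.mem_finRange _, List.mem_flatMap.2
      ⟨i, List.mem_finRange _, List.mem_cons_of_mem _ List.mem_cons_self⟩⟩

theorem hasCounts_binaryTetrahedral : HasCounts BinaryTetrahedral 24 1824 288 168 288 72 168 72 :=
  hasCounts_of_enumeration (C := BinaryTetrahedral) (eqv := fun c d => decide (c = d))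
    (fun _ _ => decide_eq_true_iff) (mul := (· * ·)) (κ := id) (fun _ _ => rfl) mem_binaryTetrahedralList
    (List.map_id _) (by decide +kernel) (by decide +kernel)

theorem card_cubePairs_right_eq : Nat.card {x : BinaryTetrahedral × BinaryTetrahedral //
    x.1 ^ 3 = x.2 ^ 3 ∧ x.1.right = x.2.right} = 72 := by
  rw [card_pairs_enumeration (C := BinaryTetrahedral) (κ := id) mem_binaryTetrahedralList
    (nodup_of_noDup (eqv := fun c d => decide (c = d)) (by simp) (by decide +kernel))
    (R := fun c d => decide (c * (c * c) = d * (d * d) ∧ c.right = d.right))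
    (fun x => by simp [pow_succ', pow_zero])]
  decide +kernel

end TPrime

section TPrime

/-- The cyclic group of order `3 ^ k` acts on the quaternion group through its quotient of order
`3`. -/
abbrev TPrimeModel {k : ℕ} (hk : 3 ∣ 3 ^ k) : Type :=
  Q8 ⋊[q8Action.comp (cycProj hk)] Cyc (3 ^ k)

theorem eq_of_sq_eq_sq : ∀ c d : Cyc 3, c ^ 2 = d ^ 2 → c = d := by decide

theorem sq_eq_and_right_eq_iff {x y : BinaryTetrahedral} :
    (x ^ 2 = y ^ 2 ∧ x.right = y.right) ↔ x ^ 2 = y ^ 2 :=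
  and_iff_left_of_imp fun e => eq_of_sq_eq_sq _ _ (by
    simpa only [pow_right] using congrArg (·.right) e)

/-- For `k = 1` the projection from the cyclic group of order `3 ^ k` is injective on the
`3`-torsion, so that the reduction does not apply. -/
theorem hasCounts_tPrimeModel {k : ℕ} (h3 : 3 ∣ 3 ^ k) (hk : 2 ≤ k) :
    HasCounts (TPrimeModel h3) (24 * 3 ^ (k - 1))
      (1824 * (3 ^ (k - 1) * (3 ^ (k - 1) * 3 ^ (k - 1))))
      (288 * (3 ^ (k - 1) * 3 ^ (k - 1))) (3 ^ (k - 1) * 3 * 72) (3 ^ (k - 1) * (1 * 1) * 288)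
      (3 ^ (k - 1) * 72) (168 * (3 ^ (k - 1) * 3 ^ (k - 1))) (3 ^ (k - 1) * 1 * 72) := by
  have h := hasCounts_binaryTetrahedral
  obtain ⟨j, rfl⟩ := Nat.exists_eq_add_of_le' hk
  refine hasCounts_semidirect (cycProj_surjective _) h.card h.commTriples h.commSquarePairs
    h.squareCubePairs h.commPairs ?_ ?_ ?_ (cycProj_eq_one_of_coprime _ (by norm_num))
    (cycProj_eq_one_of_mul_dvd _ three_ne_zero ⟨3 ^ j, by ring⟩) card_cubePairs_right_eq ?_ ?_
  · rw [card_cycProj_ker, pow_succ, Nat.mul_div_cancel _ three_pos]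
    rfl
  · rw [card_pow_ker_cyc (by positivity)]
    exact Nat.Coprime.pow_left _ (by norm_num)
  · rw [card_pow_ker_cyc (by positivity), pow_succ, Nat.gcd_mul_left_left]
  · rw [← h.squareTriples]
    exact Nat.card_congr (Equiv.subtypeEquivRight fun x =>
      and_congr sq_eq_and_right_eq_iff sq_eq_and_right_eq_iff)
  · rw [← h.squarePairs]
    exact Nat.card_congr (Equiv.subtypeEquivRight fun x => sq_eq_and_right_eq_iff)

/-- For `k = 1` the model is the binary tetrahedral group itself. -/
noncomputable def tPrimeModelOneEquiv (h3 : 3 ∣ 3 ^ 1) : TPrimeModel h3 ≃* BinaryTetrahedral :=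
  MulEquiv.ofBijective (semidirectReduction q8Action (cycProj h3)) <| by
    have hs : Function.Surjective (cycProj h3) := cycProj_surjective h3
    have hi : Function.Injective (cycProj h3) := by decide +revert
    refine ⟨fun x y e => SemidirectProduct.ext (congrArg (·.left) e)
      (hi (congrArg (·.right) e)), fun x => ?_⟩
    obtain ⟨c, hc⟩ := hs x.right
    exact ⟨⟨x.left, c⟩, SemidirectProduct.ext rfl hc⟩

/-- The generator `x` of the group `TPrime k`. -/
abbrev tPrimeX (k : ℕ) : TPrime k := PresentedGroup.of 0
/-- The generator `y` of the group `TPrime k`. -/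
abbrev tPrimeY (k : ℕ) : TPrime k := PresentedGroup.of 1
/-- The generator `z` of the group `TPrime k`. -/
abbrev tPrimeZ (k : ℕ) : TPrime k := PresentedGroup.of 2

variable {k : ℕ}

theorem tPrime_rel :
    tPrimeX k ^ 2 = (tPrimeX k * tPrimeY k) ^ 2 ∧ (tPrimeX k * tPrimeY k) ^ 2 = tPrimeY k ^ 2 :=
  ⟨PresentedGroup.mk_eq_mk_of_mul_inv_mem (by simp),
    PresentedGroup.mk_eq_mk_of_mul_inv_mem (by simp)⟩

theorem tPrime_conj_X : tPrimeZ k * tPrimeX k * (tPrimeZ k)⁻¹ = tPrimeY k :=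
  PresentedGroup.mk_eq_mk_of_mul_inv_mem (by simp)

theorem tPrime_conj_Y : tPrimeZ k * tPrimeY k * (tPrimeZ k)⁻¹ = tPrimeX k * tPrimeY k :=
  PresentedGroup.mk_eq_mk_of_mul_inv_mem (by simp)

theorem tPrimeZ_pow : tPrimeZ k ^ 3 ^ k = 1 :=
  PresentedGroup.one_of_mem (rels := {_, _, _, _, _}) (by simp)

variable (h3 : 3 ∣ 3 ^ k)

theorem tPrimeModel_gen_smul (x : Q8) : q8Action.comp (cycProj h3) (cycGen _) x = q8CycleHom x := by
  rw [MonoidHom.comp_apply, cycProj_gen, q8Action, cycHom_gen]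
  rfl

theorem tPrimeModel_conj (x : Q8) : (SemidirectProduct.inr (cycGen _) : TPrimeModel h3) *
    SemidirectProduct.inl x * (SemidirectProduct.inr (cycGen _))⁻¹ =
      SemidirectProduct.inl (q8CycleHom x) := by
  rw [← tPrimeModel_gen_smul h3, SemidirectProduct.inl_aut, map_inv]

/-- The homomorphism from the presented group to the semidirect product. -/
def tPrimeHom : TPrime k →* TPrimeModel h3 :=
  PresentedGroup.toGroup (f := ![SemidirectProduct.inl (.xa 0), SemidirectProduct.inl (.a 1),
    SemidirectProduct.inr (cycGen _)]) (by
    rintro _ (rfl | rfl | rfl | rfl | rfl)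
    · simp only [map_mul, map_inv, map_pow, FreeGroup.lift_apply_of, mul_inv_eq_one]
      change (SemidirectProduct.inl (.xa 0) : TPrimeModel h3) ^ 2 =
        (SemidirectProduct.inl (.xa 0) * SemidirectProduct.inl (.a 1)) ^ 2
      rw [← map_mul, ← map_pow, ← map_pow]
      exact congrArg _ (by decide)
    · simp only [map_mul, map_inv, map_pow, FreeGroup.lift_apply_of, mul_inv_eq_one]
      change (SemidirectProduct.inl (.xa 0) * SemidirectProduct.inl (.a 1) : TPrimeModel h3) ^ 2 =
        SemidirectProduct.inl (.a 1) ^ 2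
      rw [← map_mul, ← map_pow, ← map_pow]
      exact congrArg _ (by decide)
    · simp only [map_mul, map_inv, FreeGroup.lift_apply_of, mul_inv_eq_one]
      exact (tPrimeModel_conj h3 (.xa 0)).trans (congrArg _ (by decide))
    · simp only [map_mul, map_inv, FreeGroup.lift_apply_of, mul_inv_eq_one]
      exact (tPrimeModel_conj h3 (.a 1)).trans ((congrArg _ (by decide)).trans (map_mul _ _ _))
    · rw [map_pow, FreeGroup.lift_apply_of]
      change (SemidirectProduct.inr (cycGen _) : TPrimeModel h3) ^ _ = 1
      rw [← map_pow, cycGen_pow_self, map_one])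

theorem tPrimeHom_X : tPrimeHom h3 (tPrimeX k) = SemidirectProduct.inl (.xa 0) :=
  PresentedGroup.toGroup.of _
theorem tPrimeHom_Y : tPrimeHom h3 (tPrimeY k) = SemidirectProduct.inl (.a 1) :=
  PresentedGroup.toGroup.of _
theorem tPrimeHom_Z : tPrimeHom h3 (tPrimeZ k) = SemidirectProduct.inr (cycGen _) :=
  PresentedGroup.toGroup.of _

/-- The homomorphism from the quaternion group to the subgroup generated by `x` and `y`. -/
def q8ToTPrime (k : ℕ) : Q8 →* TPrime k := quaternionHom (tPrime_rel (k := k)).1 tPrime_rel.2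

theorem q8ToTPrime_xa : q8ToTPrime k (.xa 0) = tPrimeX k := by
  rw [q8ToTPrime, quaternionHom_xa, ZMod.val_zero, pow_zero, mul_one]

theorem q8ToTPrime_a : q8ToTPrime k (.a 1) = tPrimeY k := pow_one _

theorem q8ToTPrime_cycle : (q8ToTPrime k).comp q8CycleHom =
    (MulAut.conj (tPrimeZ k)).toMonoidHom.comp (q8ToTPrime k) := by
  refine quaternion_hom_ext ?_ ?_
  · simp only [MonoidHom.comp_apply, MulEquiv.coe_toMonoidHom, MulAut.conj_apply, q8ToTPrime_xa]
    rw [tPrime_conj_X, ← q8ToTPrime_a]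
    exact congrArg _ (by decide)
  · simp only [MonoidHom.comp_apply, MulEquiv.coe_toMonoidHom, MulAut.conj_apply, q8ToTPrime_a]
    rw [tPrime_conj_Y, ← q8ToTPrime_a, ← q8ToTPrime_xa, ← map_mul]
    exact congrArg _ (by decide)

/-- The homomorphism from the semidirect product to the presented group. -/
def tPrimeInv : TPrimeModel h3 →* TPrime k :=
  cycSemidirectLift (q8ToTPrime k) (cycHom (tPrimeZ k) tPrimeZ_pow) fun x => by
    rw [tPrimeModel_gen_smul, cycHom_gen]
    exact DFunLike.congr_fun q8ToTPrime_cycle x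

theorem tPrimeInv_inl (x : Q8) : tPrimeInv h3 (SemidirectProduct.inl x) = q8ToTPrime k x :=
  cycSemidirectLift_inl _ _ _ _

theorem tPrimeInv_inr_gen : tPrimeInv h3 (SemidirectProduct.inr (cycGen _)) = tPrimeZ k :=
  (cycSemidirectLift_inr _ _ _ _).trans (cycHom_gen _ _)

/-- The group `TPrime k` is a semidirect product of the quaternion group and a cyclic group. -/
def tPrimeEquiv : TPrime k ≃* TPrimeModel h3 :=
  (tPrimeHom h3).toMulEquiv (tPrimeInv h3)
    (PresentedGroup.ext fun i => by
      fin_cases i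
      · exact (congrArg (tPrimeInv h3) (tPrimeHom_X h3)).trans
          ((tPrimeInv_inl h3 _).trans q8ToTPrime_xa)
      · exact (congrArg (tPrimeInv h3) (tPrimeHom_Y h3)).trans
          ((tPrimeInv_inl h3 _).trans q8ToTPrime_a)
      · exact (congrArg (tPrimeInv h3) (tPrimeHom_Z h3)).trans (tPrimeInv_inr_gen h3))
    (SemidirectProduct.hom_ext
      (quaternion_hom_ext
        ((congrArg (tPrimeHom h3) ((tPrimeInv_inl h3 _).trans q8ToTPrime_xa)).trans
          (tPrimeHom_X h3))
        ((congrArg (tPrimeHom h3) ((tPrimeInv_inl h3 _).trans q8ToTPrime_a)).trans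
          (tPrimeHom_Y h3)))
      (cyc_hom_ext ((congrArg (tPrimeHom h3) (tPrimeInv_inr_gen h3)).trans (tPrimeHom_Z h3))))

end TPrime

/-! ### The dimensions -/

/-- The dimensions for `ℤ/m × G`, with `m` odd. The factor `m` common to all counts and to the
order has been cancelled. -/
theorem hasThetaDims_cyc_prod {G : Type} [Group G] {n A B C D E F S m g : ℕ} (hm : 1 ≤ m)
    (h₂ : Nat.Coprime m 2) (h₃ : m.gcd 3 = g) (h : HasCounts G n A B C D E F S) (hn : n ≠ 0)
    {d d' : ℚ} (hd : (m ^ 2 * A + 6 * m * B + 2 * g * C + D + 2 * E : ℚ) = 12 * n * d)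
    (hd' : (m * F + S : ℚ) = 2 * n * (d - d')) : HasThetaDims (Cyc m × G) d d' := by
  have hm0 := Nat.one_le_iff_ne_zero.1 hm
  have h' := (hasCounts_cyc hm0).prod h
  rw [h₂.gcd_eq_one, h₃] at h'
  have : Finite (Cyc m × G) := Nat.finite_of_card_ne_zero (by
    rw [h'.card]
    exact mul_ne_zero hm0 hn)
  refine h'.hasThetaDims ?_ ?_
  · push_cast
    linear_combination (m : ℚ) * hd
  · push_cast
    linear_combination (m : ℚ) * hd'

end ThetaSpace

theorem theorem3 :
    -- (a) cyclic groups
    (∀ n : ℕ, 1 ≤ n →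
      HasThetaDims (Cyc n) (p3 n) (p3 ((n : ℤ) - 3)) ∧
      (p3 n : ℚ) =
        (if 2 ∣ n ∧ 3 ∣ n then 1 / 12 * (n : ℚ) ^ 2 + 1 / 2 * n + 1
         else if 2 ∣ n ∧ ¬ 3 ∣ n then 1 / 12 * (n : ℚ) ^ 2 + 1 / 2 * n + 2 / 3
         else if ¬ 2 ∣ n ∧ 3 ∣ n then 1 / 12 * (n : ℚ) ^ 2 + 1 / 2 * n + 3 / 4
         else 1 / 12 * (n : ℚ) ^ 2 + 1 / 2 * n + 5 / 12) ∧
      (p3 ((n : ℤ) - 3) : ℚ) =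
        (if 2 ∣ n ∧ 3 ∣ n then 1 / 12 * (n : ℚ) ^ 2
         else if 2 ∣ n ∧ ¬ 3 ∣ n then 1 / 12 * (n : ℚ) ^ 2 - 1 / 3
         else if ¬ 2 ∣ n ∧ 3 ∣ n then 1 / 12 * (n : ℚ) ^ 2 + 1 / 4
         else 1 / 12 * (n : ℚ) ^ 2 - 1 / 12)) ∧
    -- (b) (1) products with binary dihedral groups, even p
    (∀ m p : ℕ, 1 ≤ m → 0 < p → Even p → Nat.Coprime m (2 * p) →
      HasThetaDims (Cyc m × BinaryDihedral p)
        (if ¬ 3 ∣ p ∧ ¬ 3 ∣ m then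
          1 / 6 * (m : ℚ) ^ 2 * (p : ℚ) ^ 2 + 1 / 2 * (m : ℚ) ^ 2 * p + 2 / 3 * (m : ℚ) ^ 2
            + 3 / 2 * m * p + 1 / 6 * (p : ℚ) ^ 2 + m + 1 / 2 * p + 1
         else
          1 / 6 * (m : ℚ) ^ 2 * (p : ℚ) ^ 2 + 1 / 2 * (m : ℚ) ^ 2 * p + 2 / 3 * (m : ℚ) ^ 2
            + 3 / 2 * m * p + 1 / 6 * (p : ℚ) ^ 2 + m + 1 / 2 * p + 4 / 3)
        (if ¬ 3 ∣ p ∧ ¬ 3 ∣ m then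
          1 / 6 * (m : ℚ) ^ 2 * (p : ℚ) ^ 2 + 1 / 2 * (m : ℚ) ^ 2 * p + 2 / 3 * (m : ℚ) ^ 2
            + m * p + 1 / 6 * (p : ℚ) ^ 2 - 1 / 2 * m - 1 / 2
         else
          1 / 6 * (m : ℚ) ^ 2 * (p : ℚ) ^ 2 + 1 / 2 * (m : ℚ) ^ 2 * p + 2 / 3 * (m : ℚ) ^ 2
            + m * p + 1 / 6 * (p : ℚ) ^ 2 - 1 / 2 * m - 1 / 6)) ∧
    -- (b) (2) products with binary dihedral groups, odd p
    (∀ m p : ℕ, 1 ≤ m → 0 < p → Odd p → Nat.Coprime m (2 * p) →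
      HasThetaDims (Cyc m × BinaryDihedral p)
        (if ¬ 3 ∣ p ∧ ¬ 3 ∣ m then
          1 / 6 * (m : ℚ) ^ 2 * (p : ℚ) ^ 2 + 1 / 2 * (m : ℚ) ^ 2 * p + 2 / 3 * (m : ℚ) ^ 2
            + 3 / 2 * m * p + 1 / 6 * (p : ℚ) ^ 2 + 1 / 2 * m + 1 / 2
         else
          1 / 6 * (m : ℚ) ^ 2 * (p : ℚ) ^ 2 + 1 / 2 * (m : ℚ) ^ 2 * p + 2 / 3 * (m : ℚ) ^ 2
            + 3 / 2 * m * p + 1 / 6 * (p : ℚ) ^ 2 + 1 / 2 * m + 5 / 6)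
        (if ¬ 3 ∣ p ∧ ¬ 3 ∣ m then
          1 / 6 * (m : ℚ) ^ 2 * (p : ℚ) ^ 2 + 1 / 2 * (m : ℚ) ^ 2 * p + 2 / 3 * (m : ℚ) ^ 2
            + m * p + 1 / 6 * (p : ℚ) ^ 2 - m - 1 / 2 * p
         else
          1 / 6 * (m : ℚ) ^ 2 * (p : ℚ) ^ 2 + 1 / 2 * (m : ℚ) ^ 2 * p + 2 / 3 * (m : ℚ) ^ 2
            + m * p + 1 / 6 * (p : ℚ) ^ 2 - m - 1 / 2 * p + 1 / 3)) ∧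
    -- (c) products with D'
    (∀ m k p : ℕ, 1 ≤ m → 3 ≤ p → Odd p → Nat.Coprime m (2 * p) →
      HasThetaDims (Cyc m × DPrime k p)
        (if ¬ 3 ∣ p ∧ ¬ 3 ∣ m then
          1 / 6 * (2 : ℚ) ^ (2 * k) * (m : ℚ) ^ 2 * (p : ℚ) ^ 2
            + 1 / 2 * (2 : ℚ) ^ (2 * k) * (m : ℚ) ^ 2 * p
            + 2 / 3 * (2 : ℚ) ^ (2 * k) * (m : ℚ) ^ 2
            + 3 / 2 * (2 : ℚ) ^ k * m * p + 1 / 6 * (p : ℚ) ^ 2 + 1 / 2 * (2 : ℚ) ^ k * m + 1 / 2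
         else
          1 / 6 * (2 : ℚ) ^ (2 * k) * (m : ℚ) ^ 2 * (p : ℚ) ^ 2
            + 1 / 2 * (2 : ℚ) ^ (2 * k) * (m : ℚ) ^ 2 * p
            + 2 / 3 * (2 : ℚ) ^ (2 * k) * (m : ℚ) ^ 2
            + 3 / 2 * (2 : ℚ) ^ k * m * p + 1 / 6 * (p : ℚ) ^ 2 + 1 / 2 * (2 : ℚ) ^ k * m + 5 / 6)
        (if ¬ 3 ∣ p ∧ ¬ 3 ∣ m then
          1 / 6 * (2 : ℚ) ^ (2 * k) * (m : ℚ) ^ 2 * (p : ℚ) ^ 2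
            + 1 / 2 * (2 : ℚ) ^ (2 * k) * (m : ℚ) ^ 2 * p
            + 2 / 3 * (2 : ℚ) ^ (2 * k) * (m : ℚ) ^ 2
            + (2 : ℚ) ^ k * m * p - (2 : ℚ) ^ k * m + 1 / 6 * (p : ℚ) ^ 2 - 1 / 2 * p
         else
          1 / 6 * (2 : ℚ) ^ (2 * k) * (m : ℚ) ^ 2 * (p : ℚ) ^ 2
            + 1 / 2 * (2 : ℚ) ^ (2 * k) * (m : ℚ) ^ 2 * p
            + 2 / 3 * (2 : ℚ) ^ (2 * k) * (m : ℚ) ^ 2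
            + (2 : ℚ) ^ k * m * p - (2 : ℚ) ^ k * m + 1 / 6 * (p : ℚ) ^ 2 - 1 / 2 * p + 1 / 3)) ∧
    -- (d) products with the binary tetrahedral group
    (∀ m : ℕ, 1 ≤ m → Nat.Coprime m 6 →
      HasThetaDims (Cyc m × TStar)
        (19 / 3 * (m : ℚ) ^ 2 + 6 * m + 8 / 3) (19 / 3 * (m : ℚ) ^ 2 + 5 / 2 * m + 7 / 6)) ∧
    -- (e) products with T', k = 1 (the values are those of the binary tetrahedral group) and 2 ≤ k
    (∀ m : ℕ, 1 ≤ m → Nat.Coprime m 6 →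
      HasThetaDims (Cyc m × TPrime 1)
        (19 / 3 * (m : ℚ) ^ 2 + 6 * m + 8 / 3) (19 / 3 * (m : ℚ) ^ 2 + 5 / 2 * m + 7 / 6)) ∧
    (∀ m k : ℕ, 1 ≤ m → Nat.Coprime m 6 → 2 ≤ k →
      HasThetaDims (Cyc m × TPrime k)
        (19 * (3 : ℚ) ^ (2 * (k : ℤ) - 3) * (m : ℚ) ^ 2 + 2 * (3 : ℚ) ^ k * m + 3)
        (19 * (3 : ℚ) ^ (2 * (k : ℤ) - 3) * (m : ℚ) ^ 2 + 5 / 6 * (3 : ℚ) ^ k * m + 3 / 2)) ∧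
    -- (f) products with the binary octahedral group
    (∀ m : ℕ, 1 ≤ m → Nat.Coprime m 6 →
      HasThetaDims (Cyc m × OStar)
        (34 / 3 * (m : ℚ) ^ 2 + 12 * m + 35 / 3) (34 / 3 * (m : ℚ) ^ 2 + 8 * m + 23 / 3)) ∧
    -- (g) products with the binary icosahedral group
    (∀ m : ℕ, 1 ≤ m → Nat.Coprime m 30 →
      HasThetaDims (Cyc m × IStar)
        (74 / 3 * (m : ℚ) ^ 2 + 19 * m + 64 / 3) (74 / 3 * (m : ℚ) ^ 2 + 29 / 2 * m + 101 / 6)) := by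
  have hsix (m : ℕ) (h : Nat.Coprime m 6) : Nat.Coprime m 2 ∧ m.gcd 3 = 1 :=
    ⟨h.coprime_dvd_right (by norm_num), h.coprime_dvd_right (by norm_num)⟩
  refine ⟨fun n hn => ?_, fun m p hm hp he hmp => ?_, fun m p hm hp ho hmp => ?_,
    fun m k p hm hp ho hmp => ?_, fun m hm hm6 => ?_, fun m hm hm6 => ?_, fun m k hm hm6 hk => ?_,
    fun m hm hm6 => ?_, fun m hm hm30 => ?_⟩
  · exact ⟨hasThetaDims_cyc hn, p3_eq n, p3_sub_eq n⟩
  · have h2 : Nat.Coprime m 2 := hmp.coprime_dvd_right (Dvd.intro _ rfl)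
    have h := hasCounts_binaryDihedral_of_even hp.ne' he
    rw [gcd_prime_eq Nat.prime_three] at h
    refine hasThetaDims_cyc_prod hm h2 (gcd_prime_eq Nat.prime_three m) h (by positivity) ?_ ?_
    all_goals
      by_cases hm3 : 3 ∣ m <;> by_cases hp3 : 3 ∣ p
      · exact absurd (Nat.dvd_gcd hm3 (hp3.mul_left 2)) (by rw [hmp.gcd_eq_one]; norm_num)
      all_goals
        simp only [hm3, hp3, not_true_eq_false, not_false_eq_true, and_true, and_false, if_true,
          if_false]
        push_cast
        ring
  · have h2 : Nat.Coprime m 2 := hmp.coprime_dvd_right (Dvd.intro _ rfl)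
    have h := hasCounts_binaryDihedral_of_odd ho
    rw [gcd_prime_eq Nat.prime_three] at h
    refine hasThetaDims_cyc_prod hm h2 (gcd_prime_eq Nat.prime_three m) h (by positivity) ?_ ?_
    all_goals
      by_cases hm3 : 3 ∣ m <;> by_cases hp3 : 3 ∣ p
      · exact absurd (Nat.dvd_gcd hm3 (hp3.mul_left 2)) (by rw [hmp.gcd_eq_one]; norm_num)
      all_goals
        simp only [hm3, hp3, not_true_eq_false, not_false_eq_true, and_true, and_false, if_true,
          if_false]
        push_cast
        ring
  · have h2 : Nat.Coprime m 2 := hmp.coprime_dvd_right (Dvd.intro _ rfl)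
    have : NeZero p := ⟨ho.pos.ne'⟩
    have h := (hasCounts_dPrimeModel k ho).congr (dPrimeEquiv k p).symm
    rw [gcd_prime_eq Nat.prime_three] at h
    refine hasThetaDims_cyc_prod hm h2 (gcd_prime_eq Nat.prime_three m) h
      (mul_ne_zero (mul_ne_zero two_ne_zero ho.pos.ne') (by positivity)) ?_ ?_
    all_goals
      by_cases hm3 : 3 ∣ m <;> by_cases hp3 : 3 ∣ p
      · exact absurd (Nat.dvd_gcd hm3 (hp3.mul_left 2)) (by rw [hmp.gcd_eq_one]; norm_num)
      all_goals
        simp only [hm3, hp3, not_true_eq_false, not_false_eq_true, and_true, and_false, if_true,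
          if_false]
        push_cast
        ring
  · refine hasThetaDims_cyc_prod hm (hsix m hm6).1 (hsix m hm6).2 hasCounts_TStar (by norm_num)
      ?_ ?_ <;> (push_cast; ring)
  · refine hasThetaDims_cyc_prod hm (hsix m hm6).1 (hsix m hm6).2
      (hasCounts_binaryTetrahedral.congr
        ((tPrimeEquiv (dvd_pow_self 3 one_ne_zero)).trans (tPrimeModelOneEquiv _)).symm) (by norm_num)
      ?_ ?_ <;> (push_cast; ring)
  · have h3 : 3 ∣ 3 ^ k := dvd_pow_self 3 (by omega)
    have h := (hasCounts_tPrimeModel h3 hk).congr (tPrimeEquiv h3).symm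
    obtain ⟨j, rfl⟩ := Nat.exists_eq_add_of_le' hk
    have e : (3 : ℚ) ^ (2 * ((j + 2 : ℕ) : ℤ) - 3) = 3 ^ (2 * j + 1) := by
      rw [← zpow_natCast]
      congr 1
      push_cast
      ring
    rw [e]
    refine hasThetaDims_cyc_prod hm (hsix m hm6).1 (hsix m hm6).2 h (by positivity)
      ?_ ?_ <;> (push_cast; ring)
  · refine hasThetaDims_cyc_prod hm (hsix m hm6).1 (hsix m hm6).2 hasCounts_OStar (by norm_num)
      ?_ ?_ <;> (push_cast; ring)
  · refine hasThetaDims_cyc_prod hm (hm30.coprime_dvd_right (by norm_num))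
      (hm30.coprime_dvd_right (by norm_num : 3 ∣ 30)) hasCounts_IStar (by norm_num)
      ?_ ?_ <;> (push_cast; ring)
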